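/- **Setting.** Let $F$ be a non-archimedean local field with ring of integers $\mathcal O$, residue field of order $q$ and residue characteristic $p\neq 2$, and normalized absolute value $|s|=q^{-v(s)}$. Let $\lambda:F\to\mathbb C^*$ be a non-trivial continuous unitary character of $F^+$, and let $d_\lambda t$ be its self-dual Haar measure, i.e. the Haar measure for which $\mathcal F_\lambda\mathcal F_\lambda\phi(t)=\phi(-t)$ for all locally constant compactly supported $\phi:F\to\mathbb C$, where $\mathcal F_\lambda\phi(s)=\int_F\lambda(st)\phi(t)\,dt$. Let $\mathbb Q(\lambda)\subset\mathbb C$ be generated by the values of $\lambda$ and $E=\mathbb Q(\lambda)(\sqrt{-1})$, which contains $\sqrt q$. Let $\mathcal P$ be the topological closure of the prime ring of $F$. The values of $\lambda$ are roots of unity of $p$-power order, and for $s\in\mathcal P^*$ let $\sigma_s\in\operatorname{Gal}(\mathbb Q(\lambda)/\mathbb Q)$ be the automorphism $z\mapsto z^s$ on these values (that is, $\sigma_s(z)=z^r$ if $z^{p^n}=1$, $r\in\mathbb Z$ and $s\equiv r \bmod p^n\mathcal P$). Put $$\mathfrak G=\{\sigma\in\operatorname{Gal}(E/\mathbb Q(\sqrt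 q)) : \exists s\in\mathcal O^*,\ s^2\in\mathcal P^*\text{ and }\sigma|_{\mathbb Q(\lambda)}=\sigma_{s^2}\}.$$ Let $V$ be a finite-dimensional $F$-vector space with a non-degenerate alternating form $\langle\ ,\ \rangle$ and $V=X\oplus Y$ with $X,Y$ maximal totally isotropic; let $x_1,\dots,x_n$ be a basis of $X$ and $y_1,\dots,y_n$ the dual basis of $Y$, $\langle x_i,y_j\rangle=\delta_{ij}$. Linear maps of $V$ are written on the right. Write $g\in\operatorname{Sp}(V)$ in blocks $a:X\to X$, $b:X\to Y$, $c:Y\to X$, $d:Y\to Y$, and let $Y_g=Y/\ker c$. Let $P\subset\operatorname{Sp}(V)$ be the stabilizer of $Y$, and for $0\le i\le n$ let $\tau_i\in\operatorname{Sp}(V)$ be given by $x_j\mapsto -y_j$, $y_j\mapsto x_j$ for $j\le i$ and $x_j\mapsto x_j$, $y_j\mapsto y_j$ for $j>i$. For $g=p_1\tau_ip_2$ with $p_1,p_2\in P$, let $\mu_{\lambda,g}$ be the Haar measure on $Y_g$ which is $|\det(p_1p_2|_Y)|^{-1/2}$ times the pullback, under the isomorphism $Y_g\to Y_{\tau_i}$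 induced by $p_1$, of $\prod_{k=1}^i d_\lambda y_k$ on $Y_{\tau_i}\cong\operatorname{span}(y_1,\dots,y_i)$. Let $\mathcal S(X,E)$ be the space of locally constant, compactly supported functions $X\to E$, and let $W_\lambda(g)$ be the operator on $\mathcal S(X,E)$ given by $$[W_\lambda(g)\phi](x)=\int_{Y_g}\lambda\Bigl(\tfrac{\langle xa,xb\rangle-2\langle xb,yc\rangle+\langle yc,yd\rangle}{2}\Bigr)\phi(xa+yc)\,d\mu_{\lambda,g}y .$$ For $\sigma\in\operatorname{Gal}(E/\mathbb Q)$ put $(\sigma\phi)(x)=\sigma(\phi(x))$ and, for $T\in\operatorname{End}\mathcal S(X,E)$, ${}^\sigma T(\phi)=\sigma\bigl[T(\sigma^{-1}\phi)\bigr]$. For $s\in F^*$ let $g_s\in\operatorname{Sp}(V)$ be $(x+y)g_s=s^{-1}x+sy$ for $x\in X$, $y\in Y$. **Proposition 14 (Fundamental Identity).** For every $g\in\operatorname{Sp}(V)$ the operator $W_\lambda(g)$ is well defined on $\mathcal S(X,E)$: a decomposition $g=p_1\tau_ip_2$ exists, $\mu_{\lambda,g}$ does not depend on it, and the integral formula preserves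 $\mathcal S(X,E)$. Moreover: 1. Let $\sigma\in\mathfrak G$ and $s\in\mathcal O^*$ with $\sigma|_{\mathbb Q(\lambda)}=\sigma_{s^2}$. Then $W_\lambda(g_s)$ is invertible and, for all $g\in\operatorname{Sp}(V)$, $${}^\sigma W_\lambda(g)=W_\lambda(g_s)^{-1}\,W_\lambda(g)\,W_\lambda(g_s).$$ 2. (Corollary) ${}^\sigma W_\lambda(g_t)=W_\lambda(g_t)$ for all $t\in F^*$ and $\sigma\in\mathfrak G$. -/

import Mathlib

open MeasureTheory ValuativeRel
open scoped ValuativeRel NNReal ENNReal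

noncomputable section

namespace WeilRep

/-! ### Bruhat-Schwartz spaces and Galois actions -/

/-- The Bruhat-Schwartz space `S(A, L)`: locally constant functions of compact support on `A` with
values in a subfield `L` of `ℂ`. -/
def schwartzBruhat (A : Type*) [TopologicalSpace A] (L : IntermediateField ℚ ℂ) :
    Submodule L (A → L) where
  carrier := {φ | IsLocallyConstant φ ∧ HasCompactSupport φ}
  zero_mem' := ⟨IsLocallyConstant.const 0, HasCompactSupport.zero⟩
  add_mem' := fun hf hg => ⟨hf.1.add hg.1, hf.2.add hg.2⟩
  smul_mem' := fun c _ hf =>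
    ⟨hf.1.comp (fun z => c • z), hf.2.comp_left (g := fun z => c • z) (smul_zero c)⟩

/-- The action of `Gal(L/ℚ)` on `S(A, L)`: `(σ φ)(x) = σ (φ x)`. -/
def galoisAct {A : Type*} [TopologicalSpace A] {L : IntermediateField ℚ ℂ} (σ : Gal(L/ℚ))
    (φ : schwartzBruhat A L) : schwartzBruhat A L :=
  ⟨fun x => σ (φ.1 x), φ.2.1.comp σ, φ.2.2.comp_left (map_zero σ)⟩

/-- The action of `Gal(L/ℚ)` on `End S(A, L)`: `(^σ T) φ = σ (T (σ⁻¹ φ))`. -/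
def galoisConj {A : Type*} [TopologicalSpace A] {L : IntermediateField ℚ ℂ} (σ : Gal(L/ℚ))
    (T : Module.End L (schwartzBruhat A L)) : Module.End L (schwartzBruhat A L) where
  toFun φ := galoisAct σ (T (galoisAct σ⁻¹ φ))
  map_add' φ ψ := by
    have h : galoisAct σ⁻¹ (φ + ψ) = galoisAct σ⁻¹ φ + galoisAct σ⁻¹ ψ :=
      Subtype.ext (funext fun x => map_add σ⁻¹ (φ.1 x) (ψ.1 x))
    rw [h, map_add]
    exact Subtype.ext (funext fun x => map_add σ _ _)
  map_smul' c φ := by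
    have h : galoisAct σ⁻¹ (c • φ) = σ⁻¹ c • galoisAct σ⁻¹ φ :=
      Subtype.ext (funext fun x => map_mul σ⁻¹ c (φ.1 x))
    rw [h, map_smul]
    refine Subtype.ext (funext fun x => ?_)
    refine (map_mul σ (σ⁻¹ c) _).trans ?_
    have h2 : σ (σ⁻¹ c) = c := AlgEquiv.apply_symm_apply σ c
    rw [h2]
    rfl

section Field

variable (F : Type*) [Field F] [ValuativeRel F] [TopologicalSpace F] [IsNonarchimedeanLocalField F]

/-! ### The local field -/

/-- The order `q` of the residue field. -/
def residueCard : ℕ := Nat.card 𝓀[F]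

/-- The residue characteristic `p`. -/
def residueChar : ℕ := ringChar 𝓀[F]

theorem residueCard_ne_zero : (residueCard F : ℝ≥0) ≠ 0 := by
  have : residueCard F ≠ 0 := Nat.card_pos.ne'
  exact_mod_cast this

variable {F}

/-- The normalized absolute value `|s| = q ^ (-v s)`, `|0| = 0`.  The isomorphism of the value group
with `ℤᵐ⁰` preserves the order, so it sends the valuation of a uniformizer to `exp (-1)`. -/
def absF (s : F) : ℝ :=
  WithZeroMulInt.toNNReal (residueCard_ne_zero F)
    (IsNonarchimedeanLocalField.valueGroupWithZeroIsoInt F (valuation F s))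

variable (F) in
/-- The topological closure `𝒫` in `F` of the prime ring of `F`. -/
def primeRing : Subring F := (⊥ : Subring F).topologicalClosure

/-! ### The character, its field of values and Galois groups -/

/-- `ℚ(χ)`, the field generated by the values of the character `χ`. -/
def charField (χ : AddChar F Circle) : IntermediateField ℚ ℂ :=
  IntermediateField.adjoin ℚ (Set.range fun t : F => (χ t : ℂ))

/-- `E = ℚ(χ)(√-1)`. -/
def fieldE (χ : AddChar F Circle) : IntermediateField ℚ ℂ :=
  charField χ ⊔ IntermediateField.adjoin ℚ {Complex.I}

/-- `τ` is the automorphism `σ_s` of `ℚ(χ)` attached to `s ∈ 𝒫ˣ`: it acts on the values of `χ`,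
which are roots of unity of `p`-power order, by `z ↦ z ^ s`. Here `z ^ s = z ^ r` if `z ^ (p ^ n) = 1`
and `r` is an integer with `s ≡ r` modulo `p ^ n 𝒫`. -/
def IsSigma (χ : AddChar F Circle) (s : Fˣ) (τ : Gal(charField χ/ℚ)) : Prop :=
  (s : F) ∈ primeRing F ∧ ((s⁻¹ : Fˣ) : F) ∈ primeRing F ∧
  ∀ (n : ℕ) (r : ℤ), (∃ w ∈ primeRing F, (s : F) - r = (residueChar F : F) ^ n * w) →
    ∀ z : charField χ, (∃ t : F, (z : ℂ) = χ t) → z ^ (residueChar F ^ n) = 1 → τ z = z ^ r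

/-- The restriction of `σ ∈ Gal(E/ℚ)` to `ℚ(χ)` is `σ_s` (in particular `s ∈ 𝒫ˣ`). -/
def RestrictsToSigma (χ : AddChar F Circle) (σ : Gal(fieldE χ/ℚ)) (s : Fˣ) : Prop :=
  ∃ τ : Gal(charField χ/ℚ), IsSigma χ s τ ∧
    ∀ z : charField χ, σ (IntermediateField.inclusion le_sup_left z) =
      IntermediateField.inclusion le_sup_left (τ z)

/-- `ℚ(√q)` as a subfield of `E`. -/
def sqrtField (χ : AddChar F Circle) : IntermediateField ℚ (fieldE χ) :=
  (IntermediateField.adjoin ℚ {((Real.sqrt (residueCard F) : ℝ) : ℂ)}).comap (fieldE χ).val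

/-- A unit of the ring of integers, seen in `Fˣ`. -/
def unitF (s : 𝒪[F]ˣ) : Fˣ := Units.map (𝒪[F].subtype : 𝒪[F] →* F) s

/-- The set `𝔊` of all `σ ∈ Gal(E/ℚ(√q))` whose restriction to `ℚ(χ)` is `σ_{s²}` for some unit `s`
of the ring of integers. -/
def frakG (χ : AddChar F Circle) : Set Gal(fieldE χ/ℚ) :=
  {σ | σ ∈ (sqrtField χ).fixingSubgroup ∧ ∃ s : 𝒪[F]ˣ, RestrictsToSigma χ σ (unitF s ^ 2)}

/-- The Fourier transform on `F` for the character `χ` and the measure `μ`. -/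
def fourier [MeasurableSpace F] (χ : AddChar F Circle) (μ : Measure F) (φ : F → ℂ) (s : F) : ℂ :=
  ∫ t, (χ (s * t) : ℂ) * φ t ∂μ

/-- `μ` is the self-dual Haar measure of `F` associated with `χ`. -/
def IsSelfDual [MeasurableSpace F] (χ : AddChar F Circle) (μ : Measure F) : Prop :=
  μ.IsAddHaarMeasure ∧ ∀ φ : F → ℂ, IsLocallyConstant φ → HasCompactSupport φ →
    ∀ t, fourier χ μ (fourier χ μ φ) t = φ (-t)

end Field

/-! ### Symplectic group and polarization -/

section Linear

variable {F : Type*} [Field F] {V : Type*} [AddCommGroup V] [Module F V]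

/-- The isometry group of the form `B`. Elements are composed as maps written on the left; a product
`g h` of operators written on the right of vectors is the product `h * g` here. -/
def Sp (B : LinearMap.BilinForm F V) : Subgroup (V ≃ₗ[F] V) where
  carrier := {g | ∀ v w, B (g v) (g w) = B v w}
  one_mem' := fun _ _ => rfl
  mul_mem' := fun {g h} hg hh v w => (hg (h v) (h w)).trans (hh v w)
  inv_mem' := fun {g} hg v w => by
    have h := hg (g⁻¹ v) (g⁻¹ w)
    have e : ∀ u, g (g⁻¹ u) = u := fun u => g.apply_symm_apply u
    rw [e, e] at h
    exact h.symm

/-- A decomposition `V = X ⊕ Y` into totally isotropic subspaces (which are then maximal totally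
isotropic when `B` is non-degenerate and alternating), with a basis `x_1, …, x_n` of `X` and the
dual basis `y_1, …, y_n` of `Y`. -/
structure Polarization (B : LinearMap.BilinForm F V) where
  /-- half the dimension of `V` -/
  n : ℕ
  /-- the first totally isotropic subspace -/
  X : Submodule F V
  /-- the second totally isotropic subspace -/
  Y : Submodule F V
  isCompl : IsCompl X Y
  isotropic_X : ∀ x ∈ X, ∀ x' ∈ X, B x x' = 0
  isotropic_Y : ∀ y ∈ Y, ∀ y' ∈ Y, B y y' = 0
  /-- the basis `x_1, …, x_n` of `X` -/
  basisX : Module.Basis (Fin n) F X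
  /-- the basis `y_1, …, y_n` of `Y` -/
  basisY : Module.Basis (Fin n) F Y
  dual : ∀ i j, B (basisX i : V) (basisY j : V) = if i = j then 1 else 0

namespace Polarization

variable {B : LinearMap.BilinForm F V} (P : Polarization B)

/-- `V ≃ X × Y`. -/
def split : V ≃ₗ[F] (P.X × P.Y) := (Submodule.prodEquivOfIsCompl P.X P.Y P.isCompl).symm

/-- The component in `X`. -/
def projX : V →ₗ[F] P.X := LinearMap.fst F P.X P.Y ∘ₗ P.split.toLinearMap

/-- The component in `Y`. -/
def projY : V →ₗ[F] P.Y := LinearMap.snd F P.X P.Y ∘ₗ P.split.toLinearMap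

theorem proj_add (v : V) : (P.projX v : V) + (P.projY v : V) = v :=
  P.split.symm_apply_apply v

/-- The block `a : X → X` of `g`. -/
def blockA (g : Sp B) : P.X →ₗ[F] P.X := P.projX ∘ₗ g.1.toLinearMap ∘ₗ P.X.subtype

/-- The block `b : X → Y` of `g`. -/
def blockB (g : Sp B) : P.X →ₗ[F] P.Y := P.projY ∘ₗ g.1.toLinearMap ∘ₗ P.X.subtype

/-- The block `c : Y → X` of `g`. -/
def blockC (g : Sp B) : P.Y →ₗ[F] P.X := P.projX ∘ₗ g.1.toLinearMap ∘ₗ P.Y.subtype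

/-- The block `d : Y → Y` of `g`. -/
def blockD (g : Sp B) : P.Y →ₗ[F] P.Y := P.projY ∘ₗ g.1.toLinearMap ∘ₗ P.Y.subtype

/-- `Y_g = Y / ker c`. -/
abbrev quotY (g : Sp B) : Type _ := P.Y ⧸ LinearMap.ker (P.blockC g)

/-- The map `τ_i`: `x_j ↦ -y_j` and `y_j ↦ x_j` for the first `i` indices `j`, and `x_j ↦ x_j`,
`y_j ↦ y_j` for the others. -/
def tau (i : ℕ) : V →ₗ[F] V :=
  ((P.basisX.constr F fun j => if j.val < i then -(P.basisY j : V) else (P.basisX j : V)).coprod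
    (P.basisY.constr F fun j => if j.val < i then (P.basisX j : V) else (P.basisY j : V))) ∘ₗ
    P.split.toLinearMap

/-- The parabolic subgroup of `Sp(V)` that leaves `Y` invariant. -/
def parabolic : Set (Sp B) := {g | P.Y.map g.1.toLinearMap = P.Y}

/-- The linear map `x + y ↦ s⁻¹ x + s y`. -/
def gsEquiv (s : Fˣ) : V ≃ₗ[F] V :=
  P.split ≪≫ₗ
    (LinearEquiv.prodCongr (LinearEquiv.smulOfUnit s⁻¹) (LinearEquiv.smulOfUnit s)) ≪≫ₗ P.split.symm

theorem gsEquiv_apply (s : Fˣ) (v : V) :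
    P.gsEquiv s v = ((s⁻¹ : Fˣ) : F) • (P.projX v : V) + (s : F) • (P.projY v : V) := rfl

theorem form_eq (v w : V) :
    B v w = B (P.projX v : V) (P.projY w : V) + B (P.projY v : V) (P.projX w : V) := by
  conv_lhs => rw [← P.proj_add v, ← P.proj_add w]
  simp [P.isotropic_X _ (P.projX v).2 _ (P.projX w).2,
    P.isotropic_Y _ (P.projY v).2 _ (P.projY w).2]

/-- The element `g_s` of `Sp(V)`: `x + y ↦ s⁻¹ x + s y`. -/
def gs (s : Fˣ) : Sp B := ⟨P.gsEquiv s, fun v w => by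
  rw [P.form_eq v w, gsEquiv_apply, gsEquiv_apply]
  simp [P.isotropic_X _ (P.projX v).2 _ (P.projX w).2,
    P.isotropic_Y _ (P.projY v).2 _ (P.projY w).2]⟩

/-- The argument `(⟨xa, xb⟩ - 2⟨xb, yc⟩ + ⟨yc, yd⟩) / 2` of the character. -/
def phase (g : Sp B) (x : P.X) (y : P.Y) : F :=
  (B (P.blockA g x : V) (P.blockB g x : V) - 2 * B (P.blockB g x : V) (P.blockC g y : V)
    + B (P.blockC g y : V) (P.blockD g y : V)) / 2

theorem phase_congr (g : Sp B) (x : P.X) {y y' : P.Y} (h : P.blockC g y = P.blockC g y') :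
    P.phase g x y = P.phase g x y' := by
  have hk : B (P.blockC g y : V) (P.blockD g (y - y') : V) = 0 := by
    have h1 := g.2 (y : V) ((y - y' : P.Y) : V)
    rw [P.isotropic_Y _ y.2 _ (y - y').2, P.form_eq] at h1
    have h2 : P.projX (g.1 ((y - y' : P.Y) : V)) = 0 := by
      change P.blockC g (y - y') = 0
      rw [map_sub, h, sub_self]
    rw [h2] at h1
    have h3 : B (P.projX (g.1 (y : V)) : V) (P.projY (g.1 ((y - y' : P.Y) : V)) : V) + 0 = 0 := by
      simpa only [ZeroMemClass.coe_zero, map_zero] using h1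
    rw [add_zero] at h3
    exact h3
  have h3 : B (P.blockC g y : V) (P.blockD g y : V) = B (P.blockC g y : V) (P.blockD g y' : V) := by
    rw [map_sub, Submodule.coe_sub, map_sub, sub_eq_zero] at hk
    exact hk
  unfold phase
  rw [h3, h]

end Polarization

end Linear

/-! ### The Weil operators -/

section Weil

variable {F : Type*} [Field F] [ValuativeRel F] [TopologicalSpace F] [IsNonarchimedeanLocalField F]
  [MeasurableSpace F] {V : Type*} [AddCommGroup V] [Module F V] [TopologicalSpace V]
  {B : LinearMap.BilinForm F V} (P : Polarization B) (χ : AddChar F Circle)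

/-- The integrand `y ↦ χ((⟨xa, xb⟩ - 2⟨xb, yc⟩ + ⟨yc, yd⟩) / 2) φ(xa + yc)` as a function on the
quotient `Y_g`. -/
def weilIntegrand (g : Sp B) (φ : P.X → ℂ) (x : P.X) : P.quotY g → ℂ :=
  Quotient.lift
    (fun y : P.Y => (χ (P.phase g x y) : ℂ) * φ (P.blockA g x + P.blockC g y))
    (fun y y' hyy => by
      have h : P.blockC g y = P.blockC g y' := by
        have h0 := (Submodule.quotientRel_def _).1 hyy
        rw [LinearMap.mem_ker, map_sub, sub_eq_zero] at h0
        exact h0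
      simp only [P.phase_congr g x h, h])

/-- `m` is the Haar measure `μ_{χ,g}` on (the Borel sets of) `Y_g`. For `g = p₁ τ_i p₂` (maps written
on the right), with `p₁`, `p₂` in the parabolic subgroup, it is `|det (p₁ p₂ | Y)| ^ (-1/2)` times
the pullback along the isomorphism `Y_g → Y_{τ_i}` induced by `p₁` of the product measure
`∏ d_χ y_k`, where `Y_{τ_i}` is identified with the span of `y_1, …, y_i` and `d_χ` is the self-dual
measure. The pullback is written as the push-forward of the measure on `F^i` along
`u ↦ (∑ u_k y_k) p₁⁻¹` modulo `ker c`. -/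
def IsWeilMeasure (g : Sp B) (m : @Measure (P.quotY g) (borel _)) : Prop :=
  ∃ μ : Measure F, IsSelfDual χ μ ∧
  ∃ (i : ℕ) (hi : i ≤ P.n), ∃ p₁ ∈ P.parabolic, ∃ p₂ ∈ P.parabolic,
    (∀ v, g.1 v = p₂.1 (P.tau i (p₁.1 v))) ∧
    m = ENNReal.ofReal (absF (LinearMap.det (P.blockD (p₂ * p₁))) ^ (-(1 / 2) : ℝ)) •
      @Measure.map (Fin i → F) (P.quotY g) _ (borel _)
        (fun u => Submodule.Quotient.mk
          (P.blockD p₁⁻¹ (∑ k : Fin i, u k • P.basisY (Fin.castLE hi k))))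
        (Measure.pi fun _ => μ)

/-- `T` is the Weil operator `W_χ(g)` on `S(X, L)`, given by the integral formula. -/
def IsWeilOperator (L : IntermediateField ℚ ℂ) (g : Sp B)
    (T : Module.End L (schwartzBruhat P.X L)) : Prop :=
  ∃ m : @Measure (P.quotY g) (borel _), IsWeilMeasure P χ g m ∧
    ∀ (φ : schwartzBruhat P.X L) (x : P.X),
      (((T φ).1 x : L) : ℂ) = ∫ y, weilIntegrand P χ g (fun x' => ((φ.1 x' : L) : ℂ)) x y ∂m

/-- The Weil operator `W_χ(g)` on `S(X, E)`, `E = ℚ(χ)(√-1)`. -/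
def weilOperator (g : Sp B) : Module.End (fieldE χ) (schwartzBruhat P.X (fieldE χ)) :=
  Classical.epsilon (IsWeilOperator P χ (fieldE χ) g)

end Weil

end WeilRep

end

noncomputable section

set_option linter.unusedSectionVars false
set_option linter.style.haveILetI false
set_option linter.unusedSimpArgs false

/-! Write `g = p₂ τ_i p₁` (maps on the left) with `p₁`, `p₂` stabilizing `Y`. Then `Y_g` is
parametrized by `u ∈ F^i`, and the operator becomes `c ∫ χ(Q(x,u)) φ(ℓ(x,u)) du`, where `ℓ` is
linear and `Q` is homogeneous of degree 2, both jointly in `(x,u)`.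

The Fundamental Identity is a scaling argument. The self-dual measure gives every ball a power of
`√q`, and `c = |det|^(-1/2)` is one too. For a locally constant `φ` of compact support the integral
is a finite sum of values in `E` weighted by numbers of `ℚ(√q)`. Hence `σ` passes through to the
integrand (`exists_integral_mem`, `weilOperator_apply`), where it turns `χ(t)` into `χ(s²t)`
(`RestrictsToSigma.apply_eq`). Since `s² Q(x,u) = Q(sx,su)`, and `u ↦ su` preserves the measure for
a unit `s`, the result is `W(g)` applied to `φ(s⁻¹ ·)` and evaluated at `sx`. As `W(g_s) φ(x) =
φ(s⁻¹x)`, this is conjugation by `W(g_s)` (`fundamental_identity`). That `√q` lies in `E` comes from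
a quadratic Gauss sum.

Well-definedness needs three further facts. A decomposition exists because the Lagrangian `g(Y)`
admits a symplectic basis adapted to `g(Y) ∩ Y` (`exists_bruhat`). The measure is independent of it
because two decompositions differ by a pair intertwined by `τ_i`, whose determinants on `Y` differ
by the square of the Jacobian of the change of coordinates on `F^i` (`det_blockD_of_intertwine`,
`IsWeilMeasure.unique`). The Schwartz space is preserved because the phase is a coboundary, so the
operator factors as multiplication and substitution for `p₁`, a partial Fourier transform for `τ_i`,
and the same for `p₂` (`integral_orbit_eq`). -/

namespace WeilRep

open WithZero Filter Topology

/-! ### Balls and the topology of the local field. -/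

section LocalField

variable {F : Type*} [Field F] [ValuativeRel F] [TopologicalSpace F] [IsNonarchimedeanLocalField F]

variable (F) in
/-- The valuation of `F` with values in `ℤᵐ⁰`. -/
def intVal : Valuation F ℤᵐ⁰ :=
  (valuation F).map
    (MonoidWithZeroHom.ofClass
      (IsNonarchimedeanLocalField.valueGroupWithZeroIsoInt F))
    (IsNonarchimedeanLocalField.valueGroupWithZeroIsoInt F).strictMono.monotone

theorem intVal_apply (x : F) :
    intVal F x = IsNonarchimedeanLocalField.valueGroupWithZeroIsoInt F (valuation F x) := rfl

theorem intVal_le_iff {x y : F} : intVal F x ≤ intVal F y ↔ valuation F x ≤ valuation F y :=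
  (IsNonarchimedeanLocalField.valueGroupWithZeroIsoInt F).strictMono.le_iff_le

theorem intVal_surjective : Function.Surjective (intVal F) :=
  (EquivLike.surjective (IsNonarchimedeanLocalField.valueGroupWithZeroIsoInt F)).comp valuation_surjective

variable (F) in
/-- The closed ball `{x | |x| ≤ q ^ m}`. -/
def ball (m : ℤ) : AddSubgroup F := (intVal F).leAddSubgroup (exp m)

theorem mem_ball {m : ℤ} {x : F} : x ∈ ball F m ↔ intVal F x ≤ exp m := Iff.rfl

theorem mem_ball_zero {x : F} : x ∈ ball F 0 ↔ x ∈ 𝒪[F] := by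
  rw [mem_ball, exp_zero, ← map_one (intVal F), intVal_le_iff, map_one]
  rfl

theorem ball_mono {m n : ℤ} (h : m ≤ n) : ball F m ≤ ball F n :=
  fun _ hx => le_trans (mem_ball.1 hx) (exp_le_exp.2 h)

theorem exists_intVal_eq_exp (m : ℤ) : ∃ x : F, intVal F x = exp m := intVal_surjective _

theorem exists_eq_exp {x : F} (hx : x ≠ 0) : ∃ m : ℤ, intVal F x = exp m :=
  ⟨log (intVal F x), (exp_log ((intVal F).ne_zero_iff.2 hx)).symm⟩

theorem mul_mem_ball {m n : ℤ} {x y : F} (hx : x ∈ ball F m) (hy : y ∈ ball F n) :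
    x * y ∈ ball F (m + n) := by
  rw [mem_ball, map_mul, exp_add]
  exact mul_le_mul' hx hy

theorem mul_mem_ball_iff {k m : ℤ} {s x : F} (hs : intVal F s = exp k) :
    s * x ∈ ball F (k + m) ↔ x ∈ ball F m := by
  rw [mem_ball, mem_ball, map_mul, hs, exp_add, mul_le_mul_iff_right₀ exp_pos]

theorem exists_mem_ball (x : F) : ∃ m : ℤ, x ∈ ball F m := ⟨log (intVal F x), le_exp_log⟩

theorem hasBasis_ball : (𝓝 (0 : F)).HasBasis (fun _ : ℤ => True) fun m => (ball F m : Set F) := by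
  refine (IsValuativeTopology.hasBasis_nhds_zero' F).to_hasBasis ?_ ?_
  · intro γ hγ
    obtain ⟨y, rfl⟩ := valuation_surjective γ
    obtain ⟨m, hm⟩ := exists_eq_exp (((valuation F).ne_zero_iff).1 hγ)
    -- The given neighbourhoods are strict balls, so the closed ball has to be one step smaller.
    refine ⟨m - 1, trivial, fun x hx => ?_⟩
    have h : intVal F x < intVal F y := by
      rw [hm]
      exact lt_of_le_of_lt hx (exp_lt_exp.2 (by omega))
    exact lt_of_not_ge fun h' => not_le_of_gt h (intVal_le_iff.2 h')
  · intro m _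
    obtain ⟨y, hy⟩ := exists_intVal_eq_exp (F := F) m
    refine ⟨valuation F y, ?_, fun x hx => ?_⟩
    · rw [(valuation F).ne_zero_iff, ← (intVal F).ne_zero_iff, hy]
      exact exp_ne_zero
    · change intVal F x ≤ exp m
      rw [← hy, intVal_le_iff]
      exact le_of_lt hx

theorem isOpen_ball (m : ℤ) : IsOpen (ball F m : Set F) :=
  (ball F m).isOpen_of_mem_nhds (hasBasis_ball.mem_of_mem (i := m) trivial)

theorem isCompact_ball (m : ℤ) : IsCompact (ball F m : Set F) := by
  obtain ⟨y, hy⟩ := exists_intVal_eq_exp (F := F) m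
  convert IsNonarchimedeanLocalField.isCompact_closedBall F (valuation F y) using 1
  ext x
  change intVal F x ≤ exp m ↔ _
  rw [← hy, intVal_le_iff]
  rfl

theorem isClosed_ball (m : ℤ) : IsClosed (ball F m : Set F) :=
  (ball F m).isClosed_of_isOpen (isOpen_ball m)

instance : (𝓝 (0 : F)).IsCountablyGenerated := hasBasis_ball.isCountablyGenerated

instance : T2Space F := by
  refine IsTopologicalAddGroup.t2Space_of_zero_sep fun x hx => ?_
  obtain ⟨m, hm⟩ := exists_eq_exp hx
  refine ⟨ball F (m - 1), hasBasis_ball.mem_of_mem trivial, fun h => ?_⟩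
  rw [SetLike.mem_coe, mem_ball, hm, exp_le_exp] at h
  omega

instance : SigmaCompactSpace F := by
  refine ⟨⟨fun n : ℕ => ball F n, fun n => isCompact_ball _, Set.eq_univ_of_forall fun x => ?_⟩⟩
  obtain ⟨m, hm⟩ := exists_mem_ball x
  exact Set.mem_iUnion.2 ⟨m.toNat, ball_mono (Int.self_le_toNat m) hm⟩

/-- A countable basis at 0 makes the uniformity pseudometrizable, and `σ`-compactness does the rest.
It is needed so that the product measurable spaces on `F × F` and `F^i` are Borel. -/
instance : SecondCountableTopology F := by
  letI := IsTopologicalAddGroup.rightUniformSpace F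
  haveI := isUniformAddGroup_of_addCommGroup (G := F)
  haveI := IsUniformAddGroup.uniformity_countably_generated (α := F)
  letI := UniformSpace.pseudoMetricSpace F
  exact EMetric.secondCountable_of_sigmaCompact F

theorem isCompact_subset_ball {K : Set F} (hK : IsCompact K) : ∃ m : ℤ, K ⊆ ball F m := by
  obtain ⟨t, ht⟩ := hK.elim_directed_cover (fun m : ℤ => (ball F m : Set F)) (fun m => isOpen_ball m)
    (fun x _ => Set.mem_iUnion.2 (exists_mem_ball x))
    (directed_of_isDirected_le fun _ _ h => ball_mono h)
  exact ⟨t, ht⟩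

theorem absF_eq {x : F} {m : ℤ} (h : intVal F x = exp m) : absF x = (residueCard F : ℝ) ^ m := by
  rw [intVal_apply] at h
  rw [absF, h, WithZeroMulInt.toNNReal_neg_apply _ exp_ne_zero]
  simp [exp]

theorem absF_mul (x y : F) : absF (x * y) = absF x * absF y := by
  simp [absF]

theorem absF_one : absF (1 : F) = 1 := by
  simp [absF]

theorem intVal_unitF (s : 𝒪[F]ˣ) : intVal F (unitF s : F) = 1 := by
  have key : ∀ t : 𝒪[F]ˣ, intVal F (unitF t : F) ≤ 1 := fun t => by
    rw [← exp_zero]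
    exact mem_ball_zero.2 t.1.2
  refine le_antisymm (key s) ?_
  have h2 := key s⁻¹
  have h3 : (unitF s : F) * (unitF s⁻¹ : F) = 1 := by
    rw [unitF, unitF, map_inv, Units.mul_inv]
  have h4 : intVal F (unitF s : F) * intVal F (unitF s⁻¹ : F) = 1 := by rw [← map_mul, h3, map_one]
  calc 1 = intVal F (unitF s : F) * intVal F (unitF s⁻¹ : F) := h4.symm
    _ ≤ intVal F (unitF s : F) * 1 := mul_le_mul_right h2 _
    _ = _ := mul_one _

end LocalField

/-! ### Measures of compact open sets by counting cosets. -/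

section Counting

variable {G : Type*} [AddCommGroup G] [TopologicalSpace G] [IsTopologicalAddGroup G]

theorem finite_image_mk {H : AddSubgroup G} (hH : IsOpen (H : Set G)) {S : Set G}
    (hS : IsCompact S) : ((QuotientAddGroup.mk : G → G ⧸ H) '' S).Finite := by
  haveI := QuotientAddGroup.discreteTopology hH
  exact (hS.image QuotientAddGroup.continuous_mk).finite_of_discrete

/-- `S` is a disjoint union of cosets of `H`, finitely many by compactness, all of measure `μ H`.
Thus one small ball or box determines the measure of every compact open set up to an integer factor.
-/
theorem measure_eq_ncard_mul [MeasurableSpace G] [BorelSpace G] (μ : Measure G)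
    [μ.IsAddLeftInvariant] {H : AddSubgroup G} (hH : IsOpen (H : Set G)) {S : Set G}
    (hS : IsCompact S) (hSH : ∀ x ∈ S, ∀ h ∈ H, x + h ∈ S) :
    μ S = ((QuotientAddGroup.mk : G → G ⧸ H) '' S).ncard * μ H := by
  classical
  have hfin := finite_image_mk hH hS
  have hcoset : ∀ g : G, (QuotientAddGroup.mk : G → G ⧸ H) ⁻¹' {QuotientAddGroup.mk g} =
      (fun x => -g + x) ⁻¹' (H : Set G) := fun g => by
    ext x
    rw [Set.mem_preimage, Set.mem_singleton_iff, eq_comm, QuotientAddGroup.eq]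
    rfl
  have hunion : S = ⋃ c ∈ hfin.toFinset, (QuotientAddGroup.mk : G → G ⧸ H) ⁻¹' {c} := by
    ext x
    simp only [Set.Finite.mem_toFinset, Set.mem_iUnion, Set.mem_preimage, Set.mem_singleton_iff,
      exists_prop, exists_eq_right']
    refine ⟨fun hx => Set.mem_image_of_mem _ hx, fun ⟨y, hy, hyx⟩ => ?_⟩
    have h := hSH y hy _ (QuotientAddGroup.eq.1 hyx)
    rwa [add_neg_cancel_left] at h
  have hpre : ∀ c : G ⧸ H, MeasurableSet ((QuotientAddGroup.mk : G → G ⧸ H) ⁻¹' {c}) ∧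
      μ ((QuotientAddGroup.mk : G → G ⧸ H) ⁻¹' {c}) = μ H := by
    intro c
    obtain ⟨g, rfl⟩ := QuotientAddGroup.mk_surjective c
    rw [hcoset]
    exact ⟨(hH.preimage (continuous_const_add (-g))).measurableSet, measure_preimage_add μ (-g) _⟩
  conv_lhs => rw [hunion]
  rw [measure_biUnion_finset]
  · rw [Finset.sum_congr rfl fun c _ => (hpre c).2, Finset.sum_const, nsmul_eq_mul,
      Set.ncard_eq_toFinset_card _ hfin]
  · intro c _ c' _ hcc
    exact Disjoint.preimage _ (Set.disjoint_singleton.2 hcc)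
  · exact fun c _ => (hpre c).1

end Counting

/-! ### Haar measure of balls. -/

section Measure

variable {F : Type*} [Field F] [ValuativeRel F] [TopologicalSpace F] [IsNonarchimedeanLocalField F]

theorem mem_maximalIdeal_iff (x : 𝒪[F]) :
    x ∈ 𝓂[F] ↔ (x : F) ∈ ball F (-1) := by
  have h1 : intVal F (x : F) ≤ 1 := mem_ball_zero.2 x.2
  have h2 : (x : F) ∈ ball F (-1) ↔ intVal F (x : F) < 1 := by
    rw [mem_ball]
    rcases eq_or_ne (x : F) 0 with h | h
    · simp [h]
    · obtain ⟨m, hm⟩ := exists_eq_exp h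
      rw [hm, ← exp_zero, exp_le_exp, exp_lt_exp]
      omega
  rw [h2, IsLocalRing.mem_maximalIdeal, mem_nonunits_iff,
    (Valuation.integer.integers (valuation F)).isUnit_iff_valuation_eq_one]
  change ¬ valuation F (x : F) = 1 ↔ _
  have h3 : valuation F (x : F) ≤ 1 := x.2
  rw [← map_one (intVal F), ← not_le, intVal_le_iff, map_one, not_iff_not]
  exact ⟨fun h => h.ge, fun h => le_antisymm h3 h⟩

/-- Multiplication by an `s` with `|s| = q ^ m` carries the residue field onto the quotient of
consecutive balls. -/
theorem ncard_ball_quotient (m : ℤ) :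
    ((QuotientAddGroup.mk : F → F ⧸ ball F (m - 1)) '' (ball F m : Set F)).ncard =
      residueCard F := by
  obtain ⟨s, hs⟩ := exists_intVal_eq_exp (F := F) m
  have hs0 : s ≠ 0 := (intVal F).ne_zero_iff.1 (hs ▸ exp_ne_zero)
  let f : 𝒪[F] →+ F ⧸ ball F (m - 1) :=
    (QuotientAddGroup.mk' (ball F (m - 1))).comp
      ((AddMonoidHom.mulLeft s).comp (𝒪[F].subtype : 𝒪[F] →+* F).toAddMonoidHom)
  have hker : f.ker = 𝓂[F].toAddSubgroup := by
    ext x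
    rw [AddMonoidHom.mem_ker, Submodule.mem_toAddSubgroup, mem_maximalIdeal_iff]
    change ((s * (x : F) : F) : F ⧸ ball F (m - 1)) = 0 ↔ _
    rw [QuotientAddGroup.eq_zero_iff, sub_eq_add_neg, mul_mem_ball_iff hs]
  have hrange : (f.range : Set (F ⧸ ball F (m - 1))) =
      (QuotientAddGroup.mk : F → F ⧸ ball F (m - 1)) '' (ball F m : Set F) := by
    ext c
    constructor
    · rintro ⟨x, rfl⟩
      refine ⟨s * x, ?_, rfl⟩
      have h := (mul_mem_ball_iff hs).2 (mem_ball_zero.2 x.2)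
      rwa [add_zero] at h
    · rintro ⟨y, hy, rfl⟩
      have h : s⁻¹ * y ∈ ball F 0 := by
        rw [← mul_mem_ball_iff hs, mul_inv_cancel_left₀ hs0, add_zero]
        exact hy
      refine ⟨⟨s⁻¹ * y, mem_ball_zero.1 h⟩, ?_⟩
      change ((s * (s⁻¹ * y) : F) : F ⧸ ball F (m - 1)) = _
      rw [mul_inv_cancel_left₀ hs0]
  rw [← hrange, residueCard]
  change Nat.card f.range = _
  rw [← Nat.card_congr (QuotientAddGroup.quotientKerEquivRange f).toEquiv, hker]
  rfl

theorem residueCard_pos : 0 < residueCard F := Nat.card_pos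

variable [MeasurableSpace F] [BorelSpace F] (μ : Measure F) [μ.IsAddHaarMeasure]

theorem measureReal_ball (m : ℤ) :
    μ.real (ball F m) = (residueCard F : ℝ) ^ m * μ.real (ball F 0) := by
  have hq : (residueCard F : ℝ) ≠ 0 := Nat.cast_ne_zero.2 residueCard_pos.ne'
  have step : ∀ m : ℤ, μ.real (ball F m) = residueCard F * μ.real (ball F (m - 1)) := fun m => by
    rw [measureReal_def, measureReal_def, measure_eq_ncard_mul μ (isOpen_ball (m - 1))
      (isCompact_ball m), ncard_ball_quotient]
    · simp
    · exact fun x hx h hh => add_mem hx (ball_mono (by omega) hh)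
  induction m using Int.induction_on with
  | zero => simp
  | succ n ih => rw [step, add_sub_cancel_right, ih, zpow_add_one₀ hq]; ring
  | pred n ih =>
    rw [step] at ih
    rw [zpow_sub_one₀ hq]
    field_simp
    linarith

theorem measureReal_ball_pos (m : ℤ) : 0 < μ.real (ball F m) :=
  ENNReal.toReal_pos ((isOpen_ball m).measure_pos μ ⟨0, zero_mem _⟩).ne'
    (isCompact_ball m).measure_lt_top.ne

end Measure

/-! ### Integrals of locally constant functions as finite sums. -/

section Integral

variable {G : Type*} [TopologicalSpace G] [MeasurableSpace G] [BorelSpace G]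
  {A : Type*} [AddCommGroup A]

theorem exists_finset_support {f : G → A} (hf : IsLocallyConstant f) (hc : HasCompactSupport f) :
    ∃ Z : Finset A, (0 : A) ∉ Z ∧ ∀ x, f x ≠ 0 → f x ∈ Z := by
  classical
  have hfin : (f '' tsupport f).Finite := by
    -- Local constancy is continuity into the discrete topology, where compact sets are finite.
    letI : TopologicalSpace A := ⊥
    haveI : DiscreteTopology A := ⟨rfl⟩
    exact (hc.isCompact.image hf.continuous).finite_of_discrete
  refine ⟨hfin.toFinset.erase 0, by simp, fun x hx => ?_⟩
  simp only [Finset.mem_erase, Set.Finite.mem_toFinset]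
  exact ⟨hx, Set.mem_image_of_mem _ (subset_closure hx)⟩

theorem isCompact_fiber {f : G → A} (hf : IsLocallyConstant f) (hc : HasCompactSupport f)
    {z : A} (hz : z ≠ 0) : IsCompact (f ⁻¹' {z}) :=
  hc.isCompact.of_isClosed_subset (hf.isClopen_fiber z).1 fun x hx =>
    subset_closure (by rw [Function.mem_support, show f x = z from hx]; exact hz)

theorem integrable_of_isLocallyConstant {μ : Measure G} [IsFiniteMeasureOnCompacts μ] {f : G → ℂ}
    (hf : IsLocallyConstant f) (hc : HasCompactSupport f) : Integrable f μ :=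
  hf.continuous.integrable_of_hasCompactSupport hc

/-- The integral of a locally constant function of compact support is a finite sum. -/
theorem integral_comp_eq_sum (μ : Measure G) [IsFiniteMeasureOnCompacts μ] {f : G → A}
    (hf : IsLocallyConstant f) (hc : HasCompactSupport f) {Z : Finset A} (hZ0 : (0 : A) ∉ Z)
    (hZ : ∀ x, f x ≠ 0 → f x ∈ Z) (g : A → ℂ) (hg : g 0 = 0) :
    ∫ x, g (f x) ∂μ = ∑ z ∈ Z, g z * μ.real (f ⁻¹' {z}) := by
  classical
  have h1 : ∀ x, g (f x) = ∑ z ∈ Z, (f ⁻¹' {z}).indicator (fun _ => g z) x := by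
    intro x
    by_cases hx : f x = 0
    · rw [hx, hg, Finset.sum_eq_zero]
      intro z hz
      refine Set.indicator_of_notMem ?_ _
      rw [Set.mem_preimage, hx]
      rintro rfl
      exact hZ0 hz
    · rw [Finset.sum_eq_single_of_mem (f x) (hZ x hx)]
      · simp
      · intro z _ hz
        exact Set.indicator_of_notMem (fun h => hz (Eq.symm h)) _
  simp_rw [h1]
  have hz0 : ∀ z ∈ Z, z ≠ 0 := fun z hz h => hZ0 (h ▸ hz)
  rw [integral_finsetSum]
  · refine Finset.sum_congr rfl fun z hz => ?_
    exact (integral_indicator_const (g z) (hf.isClopen_fiber z).isOpen.measurableSet).trans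
      ((Complex.real_smul).trans (mul_comm _ _))
  · intro z hz
    refine (integrable_indicator_iff (hf.isClopen_fiber z).isOpen.measurableSet).2 ?_
    exact integrableOn_const (isCompact_fiber hf hc (hz0 z hz)).measure_lt_top.ne

/-- If the measures of compact open sets lie in a subfield `K` of `L`, then integration preserves
`L` and commutes with the automorphisms of `L` over `K`. -/
theorem exists_integral_mem (μ : Measure G) [IsFiniteMeasureOnCompacts μ]
    {L : IntermediateField ℚ ℂ} (K : IntermediateField ℚ L)
    (hμ : ∀ S : Set G, IsCompact S → IsOpen S → ∃ r ∈ K, ((r : L) : ℂ) = μ.real S)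
    {f : G → L} (hf : IsLocallyConstant f) (hc : HasCompactSupport f) :
    ∃ I : L, (I : ℂ) = ∫ x, ((f x : L) : ℂ) ∂μ ∧
      ∀ σ ∈ K.fixingSubgroup, ((σ I : L) : ℂ) = ∫ x, ((σ (f x) : L) : ℂ) ∂μ := by
  obtain ⟨Z, hZ0, hZ⟩ := exists_finset_support hf hc
  have hz0 : ∀ z ∈ Z, z ≠ 0 := fun z hz h => hZ0 (h ▸ hz)
  -- The number `r z` is the measure of the fibre over `z`, seen in `K`. Outside `Z` its value is
  -- irrelevant and is taken to be 0.
  have hr : ∀ z : L, ∃ r ∈ K, z ∈ Z → ((r : L) : ℂ) = μ.real (f ⁻¹' {z}) := by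
    intro z
    by_cases hz : z ∈ Z
    · obtain ⟨r, hr, h⟩ := hμ _ (isCompact_fiber hf hc (hz0 z hz)) (hf.isClopen_fiber z).isOpen
      exact ⟨r, hr, fun _ => h⟩
    · exact ⟨0, zero_mem _, fun h => absurd h hz⟩
  choose r hrK hr using hr
  refine ⟨∑ z ∈ Z, z * r z, ?_, fun σ hσ => ?_⟩
  · rw [integral_comp_eq_sum μ hf hc hZ0 hZ (fun z : L => (z : ℂ)) rfl]
    push_cast
    exact Finset.sum_congr rfl fun z hz => by rw [hr z hz]
  · rw [integral_comp_eq_sum μ hf hc hZ0 hZ (fun z : L => ((σ z : L) : ℂ)) (by simp)]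
    rw [map_sum]
    push_cast
    refine Finset.sum_congr rfl fun z hz => ?_
    rw [map_mul, ← hr z hz]
    have h : σ (r z) = r z := hσ ⟨r z, hrK z⟩
    rw [h]
    rfl

end Integral

/-! ### Uniform local constancy. -/

section Invariance

variable {G : Type*} [AddCommGroup G] [TopologicalSpace G] [IsTopologicalAddGroup G]
  {A : Type*} [Zero A]

/-- Compactness makes `h` uniform over the support. If only `x + h` lies in the support, the
statement for `x + h` and `-h` gives the equality; this is why `h` and `-h` are controlled together.
-/
theorem eventually_forall_add_eq {f : G → A} (hf : IsLocallyConstant f)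
    (hc : HasCompactSupport f) : ∀ᶠ h in 𝓝 (0 : G), ∀ x, f (x + h) = f x := by
  have h1 : ∀ᶠ h in 𝓝 (0 : G), ∀ x ∈ tsupport f, f (x + h) = f x := by
    refine hc.isCompact.eventually_forall_of_forall_eventually fun x _ => ?_
    have h2 : ∀ᶠ p : G × G in 𝓝 (0, x), f (p.2 + p.1) = f (x + 0) :=
      ((continuous_snd.add continuous_fst).tendsto' ((0 : G), x) (x + 0) rfl).eventually
        (hf.eventually_eq _)
    have h3 : ∀ᶠ p : G × G in 𝓝 (0, x), f p.2 = f x :=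
      (continuous_snd.tendsto' ((0 : G), x) x rfl).eventually (hf.eventually_eq _)
    filter_upwards [h2, h3] with p hp hp'
    rw [hp, hp', add_zero]
  have h2 : ∀ᶠ h in 𝓝 (0 : G), ∀ x ∈ tsupport f, f (x + -h) = f x :=
    (continuous_neg.tendsto' (0 : G) 0 neg_zero).eventually h1
  filter_upwards [h1, h2] with h hh hh' x
  by_cases hx : x ∈ tsupport f
  · exact hh x hx
  · by_cases hxh : x + h ∈ tsupport f
    · rw [← hh' _ hxh, add_neg_cancel_right]
    · rw [image_eq_zero_of_notMem_tsupport hx, image_eq_zero_of_notMem_tsupport hxh]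

end Invariance

/-! ### Fourier inversion on `F` and the self-dual measure. -/

section Fourier

variable {F : Type*} [Field F] [ValuativeRel F] [TopologicalSpace F] [IsNonarchimedeanLocalField F]

theorem exists_ball_forall_add_eq {A : Type*} [Zero A] {f : F → A} (hf : IsLocallyConstant f)
    (hc : HasCompactSupport f) : ∃ m : ℤ, ∀ x, ∀ h ∈ ball F m, f (x + h) = f x := by
  obtain ⟨m, -, hm⟩ := hasBasis_ball.eventually_iff.1 (eventually_forall_add_eq hf hc)
  exact ⟨m, fun x h hh => hm hh x⟩

variable [MeasurableSpace F] [BorelSpace F] (μ : Measure F) [μ.IsAddHaarMeasure]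
  {χ : AddChar F Circle}

/-- Translation by `h` leaves the integral unchanged and also multiplies it by `ψ h ≠ 1`. -/
theorem integral_addChar_mul_eq_zero {G : Type*} [AddCommGroup G] [TopologicalSpace G]
    [IsTopologicalAddGroup G] [MeasurableSpace G] [BorelSpace G] (μ : Measure G)
    [μ.IsAddRightInvariant] (ψ : AddChar G Circle) {φ : G → ℂ}
    {h : G} (hφ : ∀ x, φ (x + h) = φ x) (hψ : ψ h ≠ 1) : ∫ x, (ψ x : ℂ) * φ x ∂μ = 0 := by
  have h1 := integral_add_right_eq_self (μ := μ) (fun x => (ψ x : ℂ) * φ x) h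
  have h2 : ∫ x, (ψ (x + h) : ℂ) * φ (x + h) ∂μ = (ψ h : ℂ) * ∫ x, (ψ x : ℂ) * φ x ∂μ := by
    rw [← integral_const_mul]
    refine integral_congr_ae (.of_forall fun x => ?_)
    simp only [hφ, AddChar.map_add_eq_mul, Circle.coe_mul]
    ring
  rw [h2] at h1
  have h3 : ((ψ h : ℂ) - 1) * ∫ x, (ψ x : ℂ) * φ x ∂μ = 0 := by rw [sub_mul, h1, one_mul, sub_self]
  refine (mul_eq_zero.1 h3).resolve_left fun h4 => hψ ?_
  exact Circle.ext (sub_eq_zero.1 h4)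

theorem setIntegral_addChar (ψ : AddChar F Circle) (m : ℤ) [Decidable (∀ t ∈ ball F m, ψ t = 1)] :
    ∫ t in (ball F m : Set F), (ψ t : ℂ) ∂μ =
      if ∀ t ∈ ball F m, ψ t = 1 then (μ.real (ball F m) : ℂ) else 0 := by
  split_ifs with h
  · rw [setIntegral_congr_fun (g := fun _ => (1 : ℂ)) (isOpen_ball m).measurableSet
      fun t ht => by simp [h t ht]]
    simp
  · push Not at h
    obtain ⟨t, ht, hψ⟩ := h
    have h1 := integral_addChar_mul_eq_zero μ ψ
      (φ := (ball F m : Set F).indicator fun _ => 1) (h := t)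
      (fun x => by
        classical
        simp only [Set.indicator_apply, SetLike.mem_coe,
          AddSubgroup.add_mem_cancel_right _ ht]) hψ
    rw [← h1, ← integral_indicator (isOpen_ball m).measurableSet]
    refine integral_congr_ae (.of_forall fun x => ?_)
    by_cases hx : x ∈ (ball F m : Set F) <;> simp [hx]

-- On a small ball `Re χ > 0` by continuity, so the integral of `χ` over that ball is nonzero. By
-- orthogonality it would vanish if `χ` were nontrivial there.
omit [MeasurableSpace F] [BorelSpace F] in
theorem exists_ball_trivial (hχ : Continuous χ) : ∃ m : ℤ, ∀ t ∈ ball F m, χ t = 1 := by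
  classical
  borelize F
  have h1 : ∀ᶠ t in 𝓝 (0 : F), 0 < (χ t : ℂ).re := by
    have h2 : Continuous fun t => (χ t : ℂ).re :=
      Complex.continuous_re.comp (continuous_subtype_val.comp hχ)
    exact h2.tendsto' 0 1 (by simp) |>.eventually (lt_mem_nhds one_pos)
  obtain ⟨m, -, hm⟩ := hasBasis_ball.eventually_iff.1 h1
  refine ⟨m, ?_⟩
  by_contra hne
  have h3 := setIntegral_addChar (Measure.addHaar : Measure F) χ m
  rw [if_neg hne] at h3
  have hint : IntegrableOn (fun t => (χ t : ℂ)) (ball F m : Set F) (Measure.addHaar : Measure F) :=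
    (continuous_subtype_val.comp hχ).continuousOn.integrableOn_compact (isCompact_ball m)
  have h4 : 0 < ∫ t in (ball F m : Set F), (χ t : ℂ).re ∂(Measure.addHaar : Measure F) := by
    rw [setIntegral_pos_iff_support_of_nonneg_ae]
    · refine lt_of_lt_of_le ((isOpen_ball m).measure_pos _ ⟨0, zero_mem _⟩)
        (measure_mono fun t ht => ⟨(hm ht).ne', ht⟩)
    · exact (ae_restrict_iff' (isOpen_ball m).measurableSet).2 (.of_forall fun t ht => (hm ht).le)
    · exact hint.re
  have h5 := congrArg Complex.re h3
  rw [Complex.zero_re] at h5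
  have h6 : ∫ t in (ball F m : Set F), (χ t : ℂ).re ∂(Measure.addHaar : Measure F) =
      (∫ t in (ball F m : Set F), (χ t : ℂ) ∂(Measure.addHaar : Measure F)).re := integral_re hint
  rw [h6, h5] at h4
  exact lt_irrefl _ h4

/-- `χ` is trivial on the ball of radius `q ^ d`, and this is the largest such ball. -/
def IsConductor (χ : AddChar F Circle) (d : ℤ) : Prop :=
  ∀ m : ℤ, (∀ t ∈ ball F m, χ t = 1) ↔ m ≤ d

omit [MeasurableSpace F] [BorelSpace F] in
theorem exists_isConductor (hχ : Continuous χ) (hχ1 : χ ≠ 1) : ∃ d, IsConductor χ d := by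
  obtain ⟨x, hx⟩ := (AddChar.ne_one_iff).1 hχ1
  obtain ⟨b, hb⟩ := exists_mem_ball x
  obtain ⟨d, hd, hmax⟩ := Int.exists_greatest_of_bdd (P := fun m => ∀ t ∈ ball F m, χ t = 1)
    ⟨b, fun m hm => le_of_not_gt fun hlt => hx (hm x (ball_mono hlt.le hb))⟩
    (exists_ball_trivial hχ)
  exact ⟨d, fun m => ⟨hmax m, fun h t ht => hd t (ball_mono h ht)⟩⟩

-- Duality of balls under the pairing `(t, s) ↦ χ(ts)`: multiplication by `s` with `|s| = q ^ k`
-- carries `ball F m` onto `ball F (k + m)`.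
omit [MeasurableSpace F] [BorelSpace F] in
theorem IsConductor.forall_mul_iff {d : ℤ} (hd : IsConductor χ d) (m : ℤ) (s : F) :
    (∀ t ∈ ball F m, χ (t * s) = 1) ↔ s ∈ ball F (d - m) := by
  rcases eq_or_ne s 0 with rfl | hs
  · simp
  obtain ⟨k, hk⟩ := exists_eq_exp hs
  have h1 : s ∈ ball F (d - m) ↔ k + m ≤ d := by
    rw [mem_ball, hk, exp_le_exp]; omega
  rw [h1, ← hd]
  refine ⟨fun h t ht => ?_, fun h t ht => ?_⟩
  · have h2 := h (s⁻¹ * t) (by rw [← mul_mem_ball_iff hk, mul_inv_cancel_left₀ hs]; exact ht)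
    rwa [mul_comm, mul_inv_cancel_left₀ hs] at h2
  · rw [mul_comm]
    exact h _ ((mul_mem_ball_iff hk).2 ht)

/-- If `φ` is invariant under `ball F m`, its transform is supported on the dual ball `ball F (d -
m)`, so Fubini applies on a compact set. The integral over that ball is its measure times the
indicator of `t + u ∈ ball F m`, where `φ u = φ (-t)`. The constant is the product of the measures
of the two dual balls. -/
theorem fourier_fourier (hχ : Continuous χ) {d : ℤ} (hd : IsConductor χ d) {φ : F → ℂ}
    (hφ : IsLocallyConstant φ) (hc : HasCompactSupport φ) (t : F) :
    fourier χ μ (fourier χ μ φ) t =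
      ((μ.real (ball F 0) ^ 2 * (residueCard F : ℝ) ^ d : ℝ) : ℂ) * φ (-t) := by
  classical
  obtain ⟨m, hm⟩ := exists_ball_forall_add_eq hφ hc
  have hvanish : ∀ s ∉ ball F (d - m), fourier χ μ φ s = 0 := by
    intro s hs
    rw [← hd.forall_mul_iff] at hs
    push Not at hs
    obtain ⟨h, hh, hne⟩ := hs
    refine integral_addChar_mul_eq_zero μ (χ.compAddMonoidHom (AddMonoidHom.mulLeft s))
      (h := h) (fun x => hm x h hh) ?_
    rw [mul_comm] at hne
    exact hne
  set H' : Set F := (ball F (d - m) : Set F) with hH'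
  have hH'm : MeasurableSet H' := (isOpen_ball _).measurableSet
  have hcl : IsClopen H' := ⟨isClosed_ball _, isOpen_ball _⟩
  have h1 : fourier χ μ (fourier χ μ φ) t =
      ∫ s, ∫ u, H'.indicator (fun s => (χ (s * (t + u)) : ℂ)) s * φ u ∂μ ∂μ := by
    refine integral_congr_ae (.of_forall fun s => ?_)
    by_cases hs : s ∈ H'
    · simp only [Set.indicator_of_mem hs, fourier]
      rw [← integral_const_mul]
      refine integral_congr_ae (.of_forall fun u => ?_)
      simp only [mul_add, AddChar.map_add_eq_mul, Circle.coe_mul, mul_comm t s, mul_assoc]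
    · simp [Set.indicator_of_notMem hs, hvanish s hs]
  have hcont : Continuous fun p : F × F =>
      H'.indicator (fun s => (χ (s * (t + p.2)) : ℂ)) p.1 * φ p.2 := by
    have h2 : Continuous fun p : F × F =>
        (Prod.fst ⁻¹' H').indicator (fun p : F × F => (χ (p.1 * (t + p.2)) : ℂ)) p :=
      Continuous.indicator (by simp [(hcl.preimage continuous_fst).frontier_eq])
        (continuous_subtype_val.comp (hχ.comp (by fun_prop)))
    exact h2.mul (hφ.continuous.comp continuous_snd)
  have hint : Integrable (Function.uncurry fun s u =>
      H'.indicator (fun s => (χ (s * (t + u)) : ℂ)) s * φ u) (μ.prod μ) := by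
    refine hcont.integrable_of_hasCompactSupport ?_
    refine HasCompactSupport.intro ((isCompact_ball (F := F) (d - m)).prod hc.isCompact) ?_
    rintro ⟨s, u⟩ hsu
    rw [Set.mem_prod, not_and_or] at hsu
    rcases hsu with h | h
    · simp only [Set.indicator_of_notMem (show s ∉ H' from h), zero_mul]
    · simp only [image_eq_zero_of_notMem_tsupport h, mul_zero]
  rw [h1, integral_integral_swap hint]
  have h3 : ∀ u, ∫ s, H'.indicator (fun s => (χ (s * (t + u)) : ℂ)) s * φ u ∂μ =
      ((fun x => -(-t) + x) ⁻¹' (ball F m : Set F)).indicator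
        (fun _ => (μ.real (ball F (d - m)) : ℂ) * φ (-t)) u := by
    intro u
    rw [integral_mul_const, integral_indicator hH'm]
    have h4 := setIntegral_addChar μ (χ.compAddMonoidHom (AddMonoidHom.mulRight (t + u))) (d - m)
    have h5 : (∀ s ∈ ball F (d - m),
        (χ.compAddMonoidHom (AddMonoidHom.mulRight (t + u))) s = 1) ↔ t + u ∈ ball F m := by
      refine (hd.forall_mul_iff (d - m) (t + u)).trans ?_
      rw [sub_sub_cancel]
    rw [if_congr h5 rfl rfl] at h4
    refine (congrArg (· * φ u) h4).trans ?_
    by_cases hu : t + u ∈ ball F m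
    · rw [if_pos hu, Set.indicator_of_mem (by simpa using hu), ← hm (-t) _ hu,
        neg_add_cancel_left]
    · rw [if_neg hu, Set.indicator_of_notMem (by simpa using hu), zero_mul]
  simp_rw [h3]
  rw [integral_indicator_const _ ((isOpen_ball (F := F) m).preimage
    (continuous_const_add (- -t))).measurableSet, measureReal_def, measure_preimage_add,
    ← measureReal_def, measureReal_ball, measureReal_ball μ (d - m), Complex.real_smul]
  have hq : (residueCard F : ℝ) ≠ 0 := Nat.cast_ne_zero.2 residueCard_pos.ne'
  rw [← mul_assoc, ← Complex.ofReal_mul]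
  congr 2
  rw [zpow_sub₀ hq]
  field_simp

theorem isSelfDual_iff (hχ : Continuous χ) {d : ℤ} (hd : IsConductor χ d) :
    IsSelfDual χ μ ↔ μ.real (ball F 0) ^ 2 * (residueCard F : ℝ) ^ d = 1 := by
  refine ⟨fun h => ?_, fun h => ⟨inferInstance, fun φ hφ hc t => ?_⟩⟩
  -- Testing the inversion formula at 0 on the indicator of the ring of integers isolates the
  -- constant.
  · have hcl : IsClopen (ball F 0 : Set F) := ⟨isClosed_ball _, isOpen_ball _⟩
    have hφ : IsLocallyConstant ((ball F 0 : Set F).indicator fun _ => (1 : ℂ)) :=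
      LocallyConstant.coe_charFn (Y := ℂ) hcl ▸ (LocallyConstant.charFn ℂ hcl).isLocallyConstant
    have hc : HasCompactSupport ((ball F 0 : Set F).indicator fun _ => (1 : ℂ)) :=
      HasCompactSupport.intro (isCompact_ball 0) fun x hx => Set.indicator_of_notMem hx _
    have h1 := h.2 _ hφ hc 0
    rw [fourier_fourier μ hχ hd hφ hc, neg_zero, Set.indicator_of_mem (zero_mem (ball F 0)),
      mul_one] at h1
    exact_mod_cast h1
  · rw [fourier_fourier μ hχ hd hφ hc, h, Complex.ofReal_one, one_mul]

/-- This is where `√q` enters: self-duality prescribes only the square of the measure of the ring of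
integers, as `q ^ (-d)`, and positivity selects the root. -/
theorem IsSelfDual.measureReal_ball (hχ : Continuous χ) {d : ℤ} (hd : IsConductor χ d)
    {μ : Measure F} (h : IsSelfDual χ μ) (m : ℤ) :
    μ.real (ball F m) = Real.sqrt (residueCard F) ^ (2 * m - d) := by
  haveI := h.1
  have hq : 0 < Real.sqrt (residueCard F) := Real.sqrt_pos.2 (Nat.cast_pos.2 residueCard_pos)
  have hq2 : (residueCard F : ℝ) = Real.sqrt (residueCard F) ^ (2 : ℤ) := by
    norm_cast
    exact (Real.sq_sqrt (Nat.cast_nonneg _)).symm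
  have h1 := (isSelfDual_iff μ hχ hd).1 h
  have h0 : μ.real (ball F 0) = Real.sqrt (residueCard F) ^ (-d) := by
    rw [hq2, ← zpow_mul, two_mul, zpow_add₀ hq.ne', ← sq, ← mul_pow, pow_eq_one_iff_of_nonneg
      (mul_pos (measureReal_ball_pos μ 0) (zpow_pos hq d)).le two_ne_zero] at h1
    rw [zpow_neg]
    exact eq_inv_of_mul_eq_one_left h1
  rw [WeilRep.measureReal_ball, h0, sub_eq_add_neg, zpow_add₀ hq.ne', zpow_mul, ← hq2]

theorem exists_isSelfDual (hχ : Continuous χ) (hχ1 : χ ≠ 1) : ∃ μ : Measure F, IsSelfDual χ μ := by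
  obtain ⟨d, hd⟩ := exists_isConductor hχ hχ1
  set ν : Measure F := Measure.addHaar
  have hν := measureReal_ball_pos ν 0
  have hq : 0 < Real.sqrt (residueCard F) := Real.sqrt_pos.2 (Nat.cast_pos.2 residueCard_pos)
  have hq2 : (residueCard F : ℝ) = Real.sqrt (residueCard F) ^ (2 : ℤ) := by
    norm_cast
    exact (Real.sq_sqrt (Nat.cast_nonneg _)).symm
  set c : ℝ := (ν.real (ball F 0))⁻¹ * Real.sqrt (residueCard F) ^ (-d)
  have hc : 0 < c := mul_pos (inv_pos.2 hν) (zpow_pos hq _)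
  haveI : (ENNReal.ofReal c • ν).IsAddHaarMeasure :=
    Measure.IsAddHaarMeasure.smul ν (by simpa using hc) ENNReal.ofReal_ne_top
  refine ⟨ENNReal.ofReal c • ν, (isSelfDual_iff _ hχ hd).2 ?_⟩
  rw [measureReal_ennreal_smul_apply, ENNReal.toReal_ofReal hc.le]
  have h1 : c * ν.real (ball F 0) = Real.sqrt (residueCard F) ^ (-d) := by
    simp only [c]
    field_simp
  have h2 : (residueCard F : ℝ) ^ d = Real.sqrt (residueCard F) ^ (2 * d) := by
    rw [zpow_mul, ← hq2]
  rw [h1, h2, two_mul, zpow_add₀ hq.ne', ← sq, ← mul_pow, ← zpow_add₀ hq.ne']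
  simp

theorem IsSelfDual.unique (hχ : Continuous χ) (hχ1 : χ ≠ 1) {μ ν : Measure F}
    (hμ : IsSelfDual χ μ) (hν : IsSelfDual χ ν) : μ = ν := by
  obtain ⟨d, hd⟩ := exists_isConductor hχ hχ1
  haveI := hμ.1
  haveI := hν.1
  have h0 := (hμ.measureReal_ball hχ hd 0).trans (hν.measureReal_ball hχ hd 0).symm
  have h1 := Measure.isAddLeftInvariant_eq_smul μ ν
  have h2 := measureReal_ball_pos ν 0
  rw [h1, measureReal_nnreal_smul_apply] at h0
  have h3 : μ.addHaarScalarFactor ν = 1 := by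
    have := mul_right_cancel₀ h2.ne' (h0.trans (one_mul _).symm)
    exact_mod_cast this
  rw [h1, h3, one_smul]

end Fourier

/-! ### Values of the character and the membership of `√q` in `E`. -/

section SqrtCard

variable {F : Type*} [Field F] [ValuativeRel F] [TopologicalSpace F] [IsNonarchimedeanLocalField F]
  {χ : AddChar F Circle}

variable (F) in
theorem exists_residueCard_eq_pow :
    (residueChar F).Prime ∧ ∃ n : ℕ, residueCard F = residueChar F ^ n := by
  letI := Fintype.ofFinite 𝓀[F]
  haveI : CharP 𝓀[F] (residueChar F) := ringChar.charP _
  obtain ⟨n, hp, hn⟩ := FiniteField.card 𝓀[F] (residueChar F)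
  exact ⟨hp, n, by rw [residueCard, Nat.card_eq_fintype_card, hn]⟩

theorem residueChar_mem_ball : (residueChar F : F) ∈ ball F (-1) := by
  haveI : CharP 𝓀[F] (residueChar F) := ringChar.charP _
  have h1 : ((residueChar F : ℕ) : 𝒪[F]) ∈ 𝓂[F] := by
    rw [← IsLocalRing.residue_eq_zero_iff, map_natCast, CharP.cast_eq_zero]
  exact (mem_maximalIdeal_iff _).1 h1

theorem residueChar_pow_mem_ball (n : ℕ) : (residueChar F : F) ^ n ∈ ball F (-n) := by
  induction n with
  | zero => simpa using mem_ball_zero.2 (one_mem 𝒪[F])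
  | succ n ih =>
    rw [pow_succ]
    have h := mul_mem_ball ih (residueChar_mem_ball (F := F))
    convert h using 2
    push_cast
    ring

/-- Since `|p| < 1`, the `p ^ n t` tend to 0. Once `χ` is trivial on a ball, its values are
therefore roots of unity of `p`-power order. -/
theorem exists_residueChar_pow_mul_mem (t : F) (m : ℤ) :
    ∃ n : ℕ, (residueChar F : F) ^ n * t ∈ ball F m := by
  obtain ⟨k, hk⟩ := exists_mem_ball t
  exact ⟨(k - m).toNat, ball_mono (by omega) (mul_mem_ball (residueChar_pow_mem_ball _) hk)⟩

theorem addChar_residueChar_pow_mul (n : ℕ) (t : F) :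
    χ ((residueChar F : F) ^ n * t) = χ t ^ residueChar F ^ n := by
  rw [← AddChar.map_nsmul_eq_pow, nsmul_eq_mul, Nat.cast_pow]

/-- With `χ x ≠ 1` and `n` minimal such that `χ (p ^ n x) = 1`, the value at `p ^ (n - 1) x` has
order exactly `p`. -/
theorem exists_isPrimitiveRoot (hχ : Continuous χ) (hχ1 : χ ≠ 1) :
    ∃ t : F, IsPrimitiveRoot (χ t : ℂ) (residueChar F) := by
  classical
  have hp := (exists_residueCard_eq_pow F).1
  obtain ⟨x, hx⟩ := (AddChar.ne_one_iff).1 hχ1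
  obtain ⟨m, hm⟩ := exists_ball_trivial hχ
  have hex : ∃ n : ℕ, χ ((residueChar F : F) ^ n * x) = 1 := by
    obtain ⟨n, hn⟩ := exists_residueChar_pow_mul_mem x m
    exact ⟨n, hm _ hn⟩
  have h1 := Nat.find_spec hex
  have h2 : Nat.find hex ≠ 0 := fun h => by
    rw [h, pow_zero, one_mul] at h1
    exact hx h1
  obtain ⟨k, hk⟩ := Nat.exists_eq_succ_of_ne_zero h2
  have h3 := Nat.find_min hex (m := k) (by omega)
  rw [hk, Nat.succ_eq_add_one, pow_succ', mul_assoc] at h1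
  have h4 := addChar_residueChar_pow_mul (χ := χ) 1 ((residueChar F : F) ^ k * x)
  rw [pow_one, pow_one, h1] at h4
  refine ⟨(residueChar F : F) ^ k * x, ?_⟩
  haveI := Fact.mk hp
  have h5 : orderOf (χ ((residueChar F : F) ^ k * x) : ℂ) = residueChar F := by
    refine orderOf_eq_prime ?_ ?_
    · rw [← Circle.coe_pow, ← h4, Circle.coe_one]
    · rwa [Ne, Circle.coe_eq_one]
  have h6 := IsPrimitiveRoot.orderOf (χ ((residueChar F : F) ^ k * x) : ℂ)
  rwa [h5] at h6

theorem apply_mem_charField (t : F) : (χ t : ℂ) ∈ charField χ :=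
  IntermediateField.subset_adjoin ℚ _ ⟨t, rfl⟩

theorem apply_mem_fieldE (t : F) : (χ t : ℂ) ∈ fieldE χ :=
  (le_sup_left : charField χ ≤ fieldE χ) (apply_mem_charField t)

theorem I_mem_fieldE : Complex.I ∈ fieldE χ :=
  (le_sup_right : _ ≤ fieldE χ) (IntermediateField.mem_adjoin_simple_self ℚ _)

/-- A subfield of `ℂ` containing `√-1` and a primitive `p`-th root of unity contains `√p`. -/
theorem sqrt_prime_mem {L : IntermediateField ℚ ℂ} (hI : Complex.I ∈ L) {p : ℕ} (hp : p.Prime)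
    (hp2 : p ≠ 2) {ζ : ℂ} (hζ : ζ ∈ L) (hprim : IsPrimitiveRoot ζ p) :
    ((Real.sqrt p : ℝ) : ℂ) ∈ L := by
  haveI := Fact.mk hp
  have hprim' : IsPrimitiveRoot (⟨ζ, hζ⟩ : L) p :=
    IsPrimitiveRoot.of_map_of_injective (f := L.val) hprim L.val.injective
  have hchar : ringChar (ZMod p) ≠ 2 := by rwa [ZMod.ringChar_zmod_n]
  -- The quadratic Gauss sum `g` satisfies `g² = η(-1) p` with `η(-1) = ±1`, so `g` or `√-1 g` is a
  -- square root of `p` in `L`.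
  let η : MulChar (ZMod p) L := (quadraticChar (ZMod p)).ringHomComp (Int.castRingHom L)
  have hη1 : η ≠ 1 := by
    rw [MulChar.ringHomComp_ne_one_iff (RingHom.injective_int _)]
    exact quadraticChar_ne_one hchar
  have hη2 : η.IsQuadratic := (quadraticChar_isQuadratic (ZMod p)).comp _
  have hg := gaussSum_sq hη1 hη2 (AddChar.zmodChar_primitive_of_primitive_root p hprim')
  set g := gaussSum η (AddChar.zmodChar p ((IsPrimitiveRoot.iff_def _ p).mp hprim').left)
  rw [ZMod.card] at hg
  have hs : ((Real.sqrt p : ℝ) : ℂ) ^ 2 = p := by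
    rw [← Complex.ofReal_pow, Real.sq_sqrt (Nat.cast_nonneg p), Complex.ofReal_natCast]
  have key : ∃ w : ℂ, w ∈ L ∧ w ^ 2 = p := by
    rcases hη2 (-1) with h | h | h
    · rw [h, zero_mul] at hg
      exfalso
      have : η (-1) ^ 2 = 1 := by rw [← map_pow, neg_one_sq, map_one]
      rw [h] at this
      simp at this
    · refine ⟨g, g.2, ?_⟩
      rw [h, one_mul] at hg
      exact_mod_cast congrArg (Subtype.val : L → ℂ) hg
    · refine ⟨Complex.I * g, mul_mem hI g.2, ?_⟩
      rw [h] at hg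
      have h2 : (g : ℂ) ^ 2 = -1 * p := by exact_mod_cast congrArg (Subtype.val : L → ℂ) hg
      rw [mul_pow, Complex.I_sq, h2]
      ring
  obtain ⟨w, hw, hw2⟩ := key
  rcases sq_eq_sq_iff_eq_or_eq_neg.1 (hs.trans hw2.symm) with h | h
  · rwa [h]
  · rw [h]
    exact neg_mem hw

theorem sqrt_residueCard_mem (hp : residueChar F ≠ 2) (hχ : Continuous χ) (hχ1 : χ ≠ 1) :
    ((Real.sqrt (residueCard F) : ℝ) : ℂ) ∈ fieldE χ := by
  obtain ⟨hprime, n, hn⟩ := exists_residueCard_eq_pow F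
  obtain ⟨t, ht⟩ := exists_isPrimitiveRoot hχ hχ1
  have h1 : Real.sqrt ((residueChar F : ℝ) ^ n) = Real.sqrt (residueChar F) ^ n := by
    rw [Real.sqrt_eq_iff_mul_self_eq (by positivity) (by positivity), ← mul_pow,
      Real.mul_self_sqrt (Nat.cast_nonneg _)]
  rw [hn, Nat.cast_pow, h1, Complex.ofReal_pow]
  exact pow_mem (sqrt_prime_mem I_mem_fieldE hprime hp (apply_mem_fieldE t) ht) n

theorem exists_sqrtField_eq_zpow (hp : residueChar F ≠ 2) (hχ : Continuous χ) (hχ1 : χ ≠ 1)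
    (k : ℤ) : ∃ r ∈ sqrtField χ,
      ((r : fieldE χ) : ℂ) = ((Real.sqrt (residueCard F) ^ k : ℝ) : ℂ) := by
  refine ⟨⟨_, sqrt_residueCard_mem hp hχ hχ1⟩ ^ k, zpow_mem ?_ k, by push_cast; rfl⟩
  exact IntermediateField.mem_adjoin_simple_self ℚ _

end SqrtCard

/-! ### The Galois action on the values of the character. -/

section Galois

variable {F : Type*} [Field F] [ValuativeRel F] [TopologicalSpace F] [IsNonarchimedeanLocalField F]
  {χ : AddChar F Circle}

theorem primeRing_le : (primeRing F : Set F) ⊆ ball F 0 := by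
  have h : primeRing F ≤ 𝒪[F] := Subring.topologicalClosure_minimal _ bot_le
    (by
      convert isClosed_ball (F := F) 0 using 1
      ext x
      exact mem_ball_zero.symm)
  exact fun x hx => mem_ball_zero.2 (h hx)

theorem isCompact_primeRing : IsCompact (primeRing F : Set F) :=
  (isCompact_ball 0).of_isClosed_subset (Subring.isClosed_topologicalClosure _) primeRing_le

/-- The finitely many classes `r + p ^ n 𝒫` with `0 ≤ r < p ^ n` are compact. Their union is closed
and contains the prime ring, hence also its closure `𝒫`. -/
theorem exists_int_sub_eq {s : F} (hs : s ∈ primeRing F) (n : ℕ) :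
    ∃ r : ℤ, ∃ w ∈ primeRing F, s - r = (residueChar F : F) ^ n * w := by
  set N : ℕ := residueChar F ^ n with hN
  have hN0 : (N : ℤ) ≠ 0 :=
    Nat.cast_ne_zero.2 (pow_ne_zero _ (exists_residueCard_eq_pow F).1.ne_zero)
  let S : Set F := ⋃ r ∈ Finset.range N, (fun w : F => (r : F) + (N : F) * w) '' (primeRing F : Set F)
  have hS : IsClosed S := by
    refine isClosed_biUnion_finset fun r _ => ?_
    exact (isCompact_primeRing.image (by fun_prop)).isClosed
  have hsub : ((⊥ : Subring F) : Set F) ⊆ S := by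
    intro x hx
    obtain ⟨k, rfl⟩ := Subring.mem_bot.1 hx
    refine Set.mem_biUnion (x := (k % N).toNat) ?_ ⟨((k / N : ℤ) : F), intCast_mem _ _, ?_⟩
    · have := Int.emod_lt_of_pos k (by omega : (0 : ℤ) < N)
      have := Int.emod_nonneg k hN0
      simp only [Finset.coe_range, Set.mem_Iio]
      omega
    · have h1 : (((k % N).toNat : ℤ) : F) = ((k % N : ℤ) : F) := by
        rw [Int.toNat_of_nonneg (Int.emod_nonneg k hN0)]
      have h2 : ((k % N + N * (k / N) : ℤ) : F) = (k : F) := by rw [Int.emod_add_mul_ediv]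
      push_cast at h1 h2
      simp only
      rw [h1, h2]
  have h3 : s ∈ S := closure_minimal hsub hS hs
  simp only [S, Set.mem_iUnion] at h3
  obtain ⟨r, -, w, hw, hsw⟩ := h3
  refine ⟨r, w, hw, ?_⟩
  rw [← hsw, hN]
  push_cast
  ring

/-- Converts the power `z ↦ z ^ s` into a scaling of the argument. If `p ^ n t` lies in a ball on
which `χ` is trivial and `s ≡ r` modulo `p ^ n 𝒫`, then `st` and `rt` differ by an element of that
ball, because `𝒫` is integral. -/
theorem RestrictsToSigma.apply_eq (hχ : Continuous χ) {σ : Gal(fieldE χ/ℚ)} {s : Fˣ}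
    (h : RestrictsToSigma χ σ s) (t : F) :
    ((σ ⟨χ t, apply_mem_fieldE t⟩ : fieldE χ) : ℂ) = χ (s * t) := by
  obtain ⟨τ, ⟨hs, -, hτ⟩, hστ⟩ := h
  obtain ⟨m, hm⟩ := exists_ball_trivial hχ
  obtain ⟨n, hn⟩ := exists_residueChar_pow_mul_mem t m
  obtain ⟨r, w, hw, hsr⟩ := exists_int_sub_eq hs n
  have h1 := hτ n r ⟨w, hw, hsr⟩ ⟨χ t, apply_mem_charField t⟩ ⟨t, rfl⟩ (by
    refine Subtype.ext ?_
    rw [SubmonoidClass.coe_pow, ← Circle.coe_pow, ← addChar_residueChar_pow_mul, hm _ hn]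
    rfl)
  have h2 : χ (s * t) = χ t ^ r := by
    have h3 : (s : F) * t = r • t + (residueChar F : F) ^ n * t * w := by
      rw [zsmul_eq_mul]
      linear_combination t * hsr
    have h4 : (residueChar F : F) ^ n * t * w ∈ ball F m := by
      simpa using mul_mem_ball hn (primeRing_le hw)
    rw [h3, AddChar.map_add_eq_mul, AddChar.map_zsmul_eq_zpow, hm _ h4, mul_one]
  have h5 := congrArg (Subtype.val : fieldE χ → ℂ) (hστ ⟨χ t, apply_mem_charField t⟩)
  refine h5.trans ?_
  rw [h1, h2, Circle.coe_zpow]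
  rfl

end Galois

/-! ### Haar measure on `F ^ ι`. -/

section PiMeasure

variable {F : Type*} [Field F] [ValuativeRel F] [TopologicalSpace F] [IsNonarchimedeanLocalField F]
  {ι : Type*} [Fintype ι]

variable (F ι) in
/-- The vectors all of whose coordinates lie in `ball F m`. -/
def box (m : ℤ) : AddSubgroup (ι → F) := AddSubgroup.pi Set.univ fun _ => ball F m

theorem mem_box {m : ℤ} {x : ι → F} : x ∈ box F ι m ↔ ∀ i, x i ∈ ball F m := by
  simp [box, AddSubgroup.mem_pi]

theorem coe_box (m : ℤ) : (box F ι m : Set (ι → F)) = Set.univ.pi fun _ => (ball F m : Set F) :=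
  rfl

theorem isOpen_box (m : ℤ) : IsOpen (box F ι m : Set (ι → F)) :=
  isOpen_set_pi Set.finite_univ fun _ _ => isOpen_ball m

theorem exists_box_subset {U : Set (ι → F)} (hU : U ∈ 𝓝 (0 : ι → F)) :
    ∃ m : ℤ, (box F ι m : Set (ι → F)) ⊆ U := by
  rw [nhds_pi] at hU
  obtain ⟨⟨I, m⟩, -, h⟩ := (hasBasis_ball (F := F)).pi_self.mem_iff.1 hU
  exact ⟨m, fun x hx => h fun i _ => mem_box.1 hx i⟩

variable [MeasurableSpace F] [BorelSpace F] (μ : Measure F) [μ.IsAddHaarMeasure]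

/-- A compact open set is a finite union of translates of a small box, and a box is a product of
balls whose self-dual measure is a power of `√q`. -/
theorem exists_sqrtField_eq_measureReal_pi (hp : residueChar F ≠ 2) {χ : AddChar F Circle}
    (hχ : Continuous χ) (hχ1 : χ ≠ 1) {μ : Measure F} (hμ : IsSelfDual χ μ) {S : Set (ι → F)}
    (hS : IsCompact S) (hSo : IsOpen S) :
    ∃ r ∈ sqrtField χ, ((r : fieldE χ) : ℂ) = (Measure.pi fun _ : ι => μ).real S := by
  haveI := hμ.1
  obtain ⟨d, hd⟩ := exists_isConductor hχ hχ1
  obtain ⟨V, hV, hSV⟩ := compact_open_separated_add_right hS hSo subset_rfl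
  obtain ⟨m, hm⟩ := exists_box_subset hV
  obtain ⟨r, hr, hr'⟩ := exists_sqrtField_eq_zpow hp hχ hχ1 (2 * m - d)
  have h1 := measure_eq_ncard_mul (Measure.pi fun _ : ι => μ) (isOpen_box m) hS
    fun x hx h hh => hSV (Set.add_mem_add hx (hm hh))
  set N := ((QuotientAddGroup.mk : (ι → F) → (ι → F) ⧸ box F ι m) '' S).ncard
  refine ⟨N * r ^ Fintype.card ι, mul_mem (natCast_mem _ _) (pow_mem hr _), ?_⟩
  rw [measureReal_def, h1, coe_box, Measure.pi_pi, Finset.prod_const, Finset.card_univ,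
    ENNReal.toReal_mul, ENNReal.toReal_pow, ← measureReal_def, hμ.measureReal_ball hχ hd]
  push_cast
  rw [hr']
  simp

/-- The image is again a Haar measure. The factor is read off on the unit ball, whose preimage is
the ball of radius `|a|⁻¹`. -/
theorem map_mul_left_eq {a : F} (ha : a ≠ 0) :
    Measure.map (a * ·) μ = ENNReal.ofReal (absF a)⁻¹ • μ := by
  obtain ⟨k, hk⟩ := exists_eq_exp ha
  haveI : (Measure.map (a * ·) μ).IsAddHaarMeasure :=
    AddEquiv.isAddHaarMeasure_map μ (AddAut.mulLeft (Units.mk0 a ha)) (continuous_const_mul a)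
      (continuous_const_mul _)
  have h1 := Measure.isAddLeftInvariant_eq_smul (Measure.map (a * ·) μ) μ
  set c := (Measure.map (a * ·) μ).addHaarScalarFactor μ
  have h2 : (Measure.map (a * ·) μ).real (ball F 0) = μ.real (ball F (-k)) := by
    rw [map_measureReal_apply (measurable_const_mul a) (isOpen_ball 0).measurableSet]
    congr 1
    ext x
    have h := mul_mem_ball_iff (m := -k) (x := x) hk
    rw [add_neg_cancel] at h
    exact h
  rw [h1, measureReal_nnreal_smul_apply, measureReal_ball μ (-k), zpow_neg, ← absF_eq hk] at h2
  have h3 : (c : ℝ) = (absF a)⁻¹ := mul_right_cancel₀ (measureReal_ball_pos μ 0).ne' h2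
  rw [h1, ← h3, ENNReal.ofReal_coe_nnreal]
  rfl

theorem absF_prod (D : ι → F) : absF (∏ i, D i) = ∏ i, absF (D i) :=
  map_prod (⟨⟨absF, absF_one⟩, absF_mul⟩ : F →* ℝ) D _

theorem absF_inv (x : F) : absF x⁻¹ = (absF x)⁻¹ := by
  simp [absF]

theorem absF_nonneg (x : F) : 0 ≤ absF x := NNReal.coe_nonneg _

variable [DecidableEq ι]

theorem map_diagonal_pi {D : ι → F} (hD : (Matrix.diagonal D).det ≠ 0) :
    Measure.map (Matrix.toLin' (Matrix.diagonal D)) (Measure.pi fun _ => μ) =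
      ENNReal.ofReal (absF (Matrix.diagonal D).det)⁻¹ • Measure.pi fun _ => μ := by
  have hD' : ∀ i, D i ≠ 0 := by
    rw [Matrix.det_diagonal] at hD
    exact fun i => Finset.prod_ne_zero_iff.1 hD i (Finset.mem_univ i)
  have h1 : (Matrix.toLin' (Matrix.diagonal D) : (ι → F) → ι → F) = fun x i => D i * x i := by
    ext x i
    simp [Matrix.mulVec_diagonal]
  rw [h1]
  haveI : ∀ i, SigmaFinite (Measure.map (D i * ·) μ) := fun i => by
    haveI : (Measure.map (D i * ·) μ).IsAddHaarMeasure :=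
      AddEquiv.isAddHaarMeasure_map μ (AddAut.mulLeft (Units.mk0 _ (hD' i)))
        (continuous_const_mul _) (continuous_const_mul _)
    infer_instance
  rw [Measure.pi_map_pi (f := fun i x => D i * x) fun i => (measurable_const_mul _).aemeasurable]
  refine Measure.pi_eq fun s hs => ?_
  rw [Measure.smul_apply, Measure.pi_pi, Matrix.det_diagonal, absF_prod, ← Finset.prod_inv_distrib,
    ENNReal.ofReal_prod_of_nonneg fun i _ => inv_nonneg.2 (absF_nonneg _), smul_eq_mul,
    ← Finset.prod_mul_distrib]
  refine Finset.prod_congr rfl fun i _ => ?_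
  rw [map_mul_left_eq μ (hD' i)]
  rfl

theorem continuous_toLin' (A : Matrix ι ι F) : Continuous (Matrix.toLin' A) :=
  LinearMap.continuous_on_pi _

/-- A shear translates the coordinate `t.i` by a multiple of another one, so integrating over that
coordinate first shows invariance. -/
theorem map_transvection_pi (t : Matrix.TransvectionStruct ι F) :
    Measure.map (Matrix.toLin' t.toMatrix) (Measure.pi fun _ => μ) = Measure.pi fun _ => μ := by
  have ht : Measurable (Matrix.toLin' t.toMatrix) := (continuous_toLin' _).measurable
  refine (Measure.pi_eq fun s hs => ?_).symm
  have h2s : MeasurableSet (Set.univ.pi s) := .pi Set.countable_univ fun i _ => hs i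
  rw [← Measure.pi_pi (fun _ => μ)]
  simp_rw [← lintegral_indicator_one h2s]
  rw [lintegral_map (measurable_one.indicator h2s) ht]
  refine lintegral_eq_of_lmarginal_eq {t.i} ((measurable_one.indicator h2s).comp ht)
    (measurable_one.indicator h2s) ?_
  simp_rw [lmarginal_singleton]
  ext x
  cases t with | mk t_i t_j t_hij t_c =>
  simp [Matrix.transvection, Matrix.single_mulVec, t_hij.symm, ← Function.update_add,
    lintegral_add_right_eq_self fun xᵢ => Set.indicator (Set.univ.pi s) 1
      (Function.update x t_i xᵢ)]

/-- An invertible matrix scales the Haar measure on `F ^ ι` by the absolute value of its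
determinant. -/
theorem map_matrix_pi {A : Matrix ι ι F} (hA : A.det ≠ 0) :
    Measure.map (Matrix.toLin' A) (Measure.pi fun _ => μ) =
      ENNReal.ofReal (absF A.det)⁻¹ • Measure.pi fun _ => μ := by
  apply Matrix.diagonal_transvection_induction_of_det_ne_zero _ A hA
  · exact fun D hD => map_diagonal_pi μ hD
  · intro t
    rw [map_transvection_pi, Matrix.TransvectionStruct.det, absF_one, inv_one, ENNReal.ofReal_one,
      one_smul]
  · intro A B _ _ hA hB
    rw [Matrix.toLin'_mul, Matrix.det_mul, LinearMap.coe_comp, ← Measure.map_map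
      (continuous_toLin' A).measurable (continuous_toLin' B).measurable, hB, Measure.map_smul, hA,
      smul_smul, ← ENNReal.ofReal_mul (inv_nonneg.2 (absF_nonneg _)), absF_mul, mul_comm, mul_inv]

end PiMeasure

/-! ### Symplectic bases and the Bruhat decomposition. -/

section Symplectic

variable {F : Type*} [Field F] {V : Type*} [AddCommGroup V] [Module F V]
  {B : LinearMap.BilinForm F V}

theorem Sp.inv_apply_apply (g : Sp B) (v : V) : (g⁻¹).1 (g.1 v) = v := g.1.symm_apply_apply v

theorem Sp.apply_inv_apply (g : Sp B) (v : V) : g.1 ((g⁻¹).1 v) = v := g.1.apply_symm_apply v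

theorem Sp.mul_apply (g h : Sp B) (v : V) : (g * h).1 v = g.1 (h.1 v) := rfl

namespace Polarization

variable (P : Polarization B)

theorem projX_coe (x : P.X) : P.projX (x : V) = x :=
  congrArg Prod.fst (Submodule.prodEquivOfIsCompl_symm_apply_left _ _ P.isCompl x)

theorem projY_coe_X (x : P.X) : P.projY (x : V) = 0 :=
  congrArg Prod.snd (Submodule.prodEquivOfIsCompl_symm_apply_left _ _ P.isCompl x)

theorem projX_coe_Y (y : P.Y) : P.projX (y : V) = 0 :=
  congrArg Prod.fst (Submodule.prodEquivOfIsCompl_symm_apply_right _ _ P.isCompl y)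

theorem projY_coe (y : P.Y) : P.projY (y : V) = y :=
  congrArg Prod.snd (Submodule.prodEquivOfIsCompl_symm_apply_right _ _ P.isCompl y)

theorem projX_eq_zero_iff {v : V} : P.projX v = 0 ↔ v ∈ P.Y := by
  refine ⟨fun h => ?_, fun h => P.projX_coe_Y ⟨v, h⟩⟩
  rw [← P.proj_add v, h, ZeroMemClass.coe_zero, zero_add]
  exact (P.projY v).2

theorem projY_eq_zero_iff {v : V} : P.projY v = 0 ↔ v ∈ P.X := by
  refine ⟨fun h => ?_, fun h => P.projY_coe_X ⟨v, h⟩⟩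
  rw [← P.proj_add v, h, ZeroMemClass.coe_zero, add_zero]
  exact (P.projX v).2

theorem form_basisX (j : Fin P.n) (v : V) :
    B (P.basisX j : V) v = P.basisY.repr (P.projY v) j := by
  rw [P.form_eq, P.projX_coe, P.projY_coe_X, ZeroMemClass.coe_zero, map_zero,
    LinearMap.zero_apply, add_zero]
  generalize P.projY v = y
  conv_lhs => rw [← P.basisY.sum_repr y]
  rw [Submodule.coe_sum, map_sum]
  simp [P.dual, -Module.Basis.sum_repr]

theorem form_basisY (v : V) (j : Fin P.n) :
    B v (P.basisY j : V) = P.basisX.repr (P.projX v) j := by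
  rw [P.form_eq, P.projY_coe, P.projX_coe_Y, ZeroMemClass.coe_zero, map_zero, add_zero]
  generalize P.projX v = x
  conv_lhs => rw [← P.basisX.sum_repr x]
  rw [Submodule.coe_sum, map_sum, LinearMap.sum_apply]
  simp [P.dual, -Module.Basis.sum_repr]

theorem mem_Y_of_forall_form {v : V} (h : ∀ j, B v (P.basisY j : V) = 0) : v ∈ P.Y := by
  rw [← P.projX_eq_zero_iff]
  refine P.basisX.repr.injective (Finsupp.ext fun j => ?_)
  rw [← P.form_basisY, h]
  simp

theorem mem_X_of_forall_form {v : V} (h : ∀ j, B (P.basisX j : V) v = 0) : v ∈ P.X := by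
  rw [← P.projY_eq_zero_iff]
  refine P.basisY.repr.injective (Finsupp.ext fun j => ?_)
  rw [← P.form_basisX, h]
  simp

/-- The basis `x_1, …, x_n, y_1, …, y_n` of `V`. -/
def basis : Module.Basis (Fin P.n ⊕ Fin P.n) F V := (P.basisX.prod P.basisY).map P.split.symm

theorem basis_inl (j : Fin P.n) : P.basis (Sum.inl j) = P.basisX j := by
  simp [basis, split]

theorem basis_inr (j : Fin P.n) : P.basis (Sum.inr j) = P.basisY j := by
  simp [basis, split]

theorem form_basisY_basisX (hB : B.IsAlt) (i j : Fin P.n) :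
    B (P.basisY i : V) (P.basisX j : V) = if i = j then -1 else 0 := by
  rw [← hB.neg_eq, P.dual]
  simp [eq_comm (a := i), apply_ite]

/-- Two symplectic bases are related by an element of the symplectic group. -/
theorem exists_Sp_of_basis (hB : B.IsAlt) {x' y' : Fin P.n → V} (hx : ∀ i j, B (x' i) (x' j) = 0)
    (hy : ∀ i j, B (y' i) (y' j) = 0) (hxy : ∀ i j, B (x' i) (y' j) = if i = j then 1 else 0) :
    ∃ g : Sp B, (∀ j, g.1 (P.basisX j) = x' j) ∧ ∀ j, g.1 (P.basisY j) = y' j := by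
  set f : V →ₗ[F] V := P.basis.constr F (Sum.elim x' y') with hf
  have hfx : ∀ j, f (P.basisX j) = x' j := fun j => by
    rw [← P.basis_inl, hf, Module.Basis.constr_basis, Sum.elim_inl]
  have hfy : ∀ j, f (P.basisY j) = y' j := fun j => by
    rw [← P.basis_inr, hf, Module.Basis.constr_basis, Sum.elim_inr]
  have hyx : ∀ i j, B (y' i) (x' j) = if i = j then -1 else 0 := fun i j => by
    rw [← hB.neg_eq, hxy]
    simp [eq_comm (a := i), apply_ite]
  have hpres : ∀ v w, B (f v) (f w) = B v w := by
    have h : B.comp f f = B := by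
      refine LinearMap.BilinForm.ext_basis P.basis fun i j => ?_
      rw [LinearMap.BilinForm.comp_apply]
      rcases i with i | i <;> rcases j with j | j <;>
        simp only [basis_inl, basis_inr, hfx, hfy, hx, hy, hxy, hyx, P.dual,
          P.form_basisY_basisX hB, P.isotropic_X _ (P.basisX i).2 _ (P.basisX j).2,
          P.isotropic_Y _ (P.basisY i).2 _ (P.basisY j).2]
    exact fun v w => LinearMap.congr_fun₂ h v w
  have hinj : Function.Injective f := by
    rw [← LinearMap.ker_eq_bot, LinearMap.ker_eq_bot']
    intro v hv
    have h0 : ∀ w, B v w = 0 := fun w => by rw [← hpres, hv, map_zero, LinearMap.zero_apply]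
    have h1 : v ∈ P.Y := P.mem_Y_of_forall_form fun j => h0 _
    have h2 : v ∈ P.X := P.mem_X_of_forall_form fun j => by rw [← hB.neg_eq, h0, neg_zero]
    exact (Submodule.disjoint_def.1 P.isCompl.disjoint) v h2 h1
  haveI : FiniteDimensional F V := Module.Basis.finiteDimensional_of_finite P.basis
  exact ⟨⟨LinearEquiv.ofInjectiveEndo f hinj, hpres⟩, hfx, hfy⟩

theorem tau_basisX (i : ℕ) (j : Fin P.n) :
    P.tau i (P.basisX j) = if j.val < i then -(P.basisY j : V) else (P.basisX j : V) := by
  have h : P.split (P.basisX j : V) = (P.basisX j, 0) :=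
    Submodule.prodEquivOfIsCompl_symm_apply_left _ _ P.isCompl _
  rw [tau, LinearMap.comp_apply, LinearEquiv.coe_coe, h, LinearMap.coprod_apply, map_zero, add_zero,
    Module.Basis.constr_basis]

theorem tau_basisY (i : ℕ) (j : Fin P.n) :
    P.tau i (P.basisY j) = if j.val < i then (P.basisX j : V) else (P.basisY j : V) := by
  have h : P.split (P.basisY j : V) = (0, P.basisY j) :=
    Submodule.prodEquivOfIsCompl_symm_apply_right _ _ P.isCompl _
  rw [tau, LinearMap.comp_apply, LinearEquiv.coe_coe, h, LinearMap.coprod_apply, map_zero, zero_add,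
    Module.Basis.constr_basis]

theorem exists_Sp_eq_tau (hB : B.IsAlt) (i : ℕ) : ∃ t : Sp B, ∀ v, t.1 v = P.tau i v := by
  obtain ⟨t, htx, hty⟩ := P.exists_Sp_of_basis hB
    (x' := fun j => if j.val < i then -(P.basisY j : V) else (P.basisX j : V))
    (y' := fun j => if j.val < i then (P.basisX j : V) else (P.basisY j : V))
    (fun j k => by
      have hX := P.isotropic_X _ (P.basisX j).2 _ (P.basisX k).2
      have hY := P.isotropic_Y _ (P.basisY j).2 _ (P.basisY k).2
      have h1 := P.dual j k
      have h2 := P.form_basisY_basisX hB j k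
      rcases eq_or_ne j k with rfl | hjk
      · exact hB _
      · split_ifs <;> simp_all)
    (fun j k => by
      have hX := P.isotropic_X _ (P.basisX j).2 _ (P.basisX k).2
      have hY := P.isotropic_Y _ (P.basisY j).2 _ (P.basisY k).2
      have h1 := P.dual j k
      have h2 := P.form_basisY_basisX hB j k
      rcases eq_or_ne j k with rfl | hjk
      · exact hB _
      · split_ifs <;> simp_all)
    (fun j k => by
      have hX := P.isotropic_X _ (P.basisX j).2 _ (P.basisX k).2
      have hY := P.isotropic_Y _ (P.basisY j).2 _ (P.basisY k).2
      have h1 := P.dual j k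
      have h2 := P.form_basisY_basisX hB j k
      rcases eq_or_ne j k with rfl | hjk
      · split_ifs <;> simp_all
      · split_ifs <;> simp_all)
  refine ⟨t, fun v => ?_⟩
  refine LinearMap.congr_fun (f := t.1.toLinearMap) (P.basis.ext fun j => ?_) v
  rcases j with j | j
  · rw [basis_inl, tau_basisX]; exact htx j
  · rw [basis_inr, tau_basisY]; exact hty j

theorem finiteDimensional (P : Polarization B) : FiniteDimensional F V :=
  Module.Basis.finiteDimensional_of_finite P.basis

theorem finrank_Y : Module.finrank F P.Y = P.n := by
  rw [Module.finrank_eq_card_basis P.basisY, Fintype.card_fin]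

theorem mem_parabolic_iff {g : Sp B} : g ∈ P.parabolic ↔ ∀ y ∈ P.Y, g.1 y ∈ P.Y := by
  haveI := P.finiteDimensional
  constructor
  · intro h y hy
    rw [← (show P.Y.map g.1.toLinearMap = P.Y from h)]
    exact Submodule.mem_map_of_mem hy
  · intro h
    refine Submodule.eq_of_le_of_finrank_eq (Submodule.map_le_iff_le_comap.2 h) ?_
    exact LinearEquiv.finrank_map_eq g.1 P.Y

theorem mul_mem_parabolic {g h : Sp B} (hg : g ∈ P.parabolic) (hh : h ∈ P.parabolic) :
    g * h ∈ P.parabolic :=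
  P.mem_parabolic_iff.2 fun y hy =>
    P.mem_parabolic_iff.1 hg _ (P.mem_parabolic_iff.1 hh y hy)

theorem inv_mem_parabolic {g : Sp B} (hg : g ∈ P.parabolic) : g⁻¹ ∈ P.parabolic := by
  refine P.mem_parabolic_iff.2 fun y hy => ?_
  rw [← (show P.Y.map g.1.toLinearMap = P.Y from hg)] at hy
  obtain ⟨z, hz, rfl⟩ := hy
  have h : (g⁻¹).1 (g.1 z) = z := Sp.inv_apply_apply g z
  exact h.symm ▸ hz

theorem one_mem_parabolic : (1 : Sp B) ∈ P.parabolic := P.mem_parabolic_iff.2 fun _ hy => hy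

theorem exists_X_form_eq (f : P.Y →ₗ[F] F) : ∃ x : P.X, ∀ y : P.Y, B (x : V) (y : V) = f y := by
  refine ⟨∑ j, f (P.basisY j) • P.basisX j, fun y => ?_⟩
  conv_rhs => rw [← P.basisY.sum_repr y, map_sum]
  rw [Submodule.coe_sum, map_sum, LinearMap.sum_apply]
  refine Finset.sum_congr rfl fun j _ => ?_
  rw [Submodule.coe_smul, map_smul, LinearMap.smul_apply, P.form_basisX, P.projY_coe, map_smul,
    smul_eq_mul, smul_eq_mul, mul_comm]

/-- Every Lagrangian subspace is the image of the span of `x_1, …, x_i, y_{i+1}, …, y_n` under some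
element of the parabolic subgroup. -/
theorem exists_parabolic_of_lagrangian (hB : B.IsAlt) {L : Submodule F V}
    (hL : ∀ v ∈ L, ∀ w ∈ L, B v w = 0) (hdim : Module.finrank F L = P.n) :
    ∃ i ≤ P.n, ∃ p ∈ P.parabolic, ∀ j, p.1 (P.tau i (P.basisY j)) ∈ L := by
  classical
  haveI := P.finiteDimensional
  -- The basis `y'` of `Y` is adapted to `Y = U ⊕ K` with `K = L ∩ Y`, and `i = dim U` will be the
  -- index. The `x''` are the dual basis in `X`.
  set K : Submodule F P.Y := L.comap P.Y.subtype with hK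
  obtain ⟨U, hU⟩ := K.exists_isCompl
  set k := Module.finrank F K
  set i := Module.finrank F U
  have hik : i + k = P.n := by
    rw [← P.finrank_Y, ← Submodule.finrank_add_eq_of_isCompl hU, add_comm]
  let y' : Module.Basis (Fin i ⊕ Fin k) F P.Y :=
    ((Module.finBasis F U).prod (Module.finBasis F K)).map
      (Submodule.prodEquivOfIsCompl U K hU.symm)
  have hyK : ∀ b, (y' (Sum.inr b) : V) ∈ L := fun b => by
    have h : y' (Sum.inr b) = (Module.finBasis F K b : P.Y) := by simp [y']
    rw [h]
    exact (Module.finBasis F K b).2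
  choose x'' hx'' using fun s => P.exists_X_form_eq (y'.coord s)
  have hx''y : ∀ s t, B (x'' s : V) (y' t : V) = if s = t then 1 else 0 := fun s t => by
    rw [hx'', Module.Basis.coord_apply, Module.Basis.repr_self, Finsupp.single_apply]
    simp [eq_comm]
  have hYY : ∀ s t, B (y' s : V) (y' t : V) = 0 := fun s t =>
    P.isotropic_Y _ (y' s).2 _ (y' t).2
  -- Pair `L` with the basis of `U`. As `L` is isotropic it pairs trivially with `K`, so a vector of
  -- the kernel is orthogonal to all of `Y` and lies in `L ∩ Y`. Counting dimensions, `Φ` is onto,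
  -- and `L` contains vectors dual to the basis of `U`.
  let Φ : L →ₗ[F] (Fin i → F) := LinearMap.pi fun c => (B.flip (y' (Sum.inl c))) ∘ₗ L.subtype
  have hΦ : ∀ l c, Φ l c = B (l : V) (y' (Sum.inl c) : V) := fun _ _ => rfl
  have hker : ∀ l : L, l ∈ LinearMap.ker Φ → (l : V) ∈ P.Y := by
    intro l hl
    have hz : ∀ s, B (l : V) (y' s : V) = 0 := by
      rintro (c | b)
      · rw [← hΦ, LinearMap.mem_ker.1 hl, Pi.zero_apply]
      · exact hL _ l.2 _ (hyK b)
    have hz' : ∀ y : P.Y, B (l : V) (y : V) = 0 := fun y => by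
      have h : (B (l : V)) ∘ₗ P.Y.subtype = 0 := y'.ext hz
      exact LinearMap.congr_fun h y
    exact P.mem_Y_of_forall_form fun j => hz' _
  have hkerdim : Module.finrank F (LinearMap.ker Φ) ≤ k := by
    let ι : LinearMap.ker Φ →ₗ[F] K :=
      { toFun := fun l => ⟨⟨l.1, hker l.1 l.2⟩, l.1.2⟩
        map_add' := fun _ _ => rfl
        map_smul' := fun _ _ => rfl }
    refine LinearMap.finrank_le_finrank_of_injective (f := ι) fun l l' h => ?_
    exact Subtype.ext (Subtype.ext (congrArg (fun z : K => ((z : P.Y) : V)) h))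
  have hsurj : Function.Surjective Φ := by
    rw [← LinearMap.range_eq_top]
    refine Submodule.eq_top_of_finrank_eq (le_antisymm (Submodule.finrank_le _) ?_)
    have h := LinearMap.finrank_range_add_finrank_ker Φ
    rw [hdim] at h
    rw [Module.finrank_fin_fun]
    omega
  choose l hl using fun a : Fin i => hsurj (Pi.single a 1)
  -- Subtracting elements of `K` keeps `l a` in `L` and makes it orthogonal to the `x''` dual to
  -- `K`. The `l'` and these `x''` then form an isotropic family dual to `y'`.
  let l' : Fin i → V := fun a =>
    (l a : V) - ∑ b, B (x'' (Sum.inr b) : V) (l a : V) • (y' (Sum.inr b) : V)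
  have hl'L : ∀ a, l' a ∈ L := fun a =>
    sub_mem (l a).2 (Submodule.sum_mem _ fun b _ => L.smul_mem _ (hyK b))
  have hl'x : ∀ a b, B (x'' (Sum.inr b) : V) (l' a) = 0 := fun a b => by
    simp [l', hx''y]
  have hl'y : ∀ a s, B (l' a) (y' s : V) = if Sum.inl a = s then 1 else 0 := by
    rintro a (c | b)
    · have h : B (l a : V) (y' (Sum.inl c) : V) = if a = c then 1 else 0 := by
        rw [← hΦ, hl, Pi.single_apply]
        simp [eq_comm]
      simp [l', hYY, h]
    · rw [hL _ (hl'L a) _ (hyK b)]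
      simp
  let e : Fin i ⊕ Fin k ≃ Fin P.n := finSumFinEquiv.trans (finCongr hik)
  let x' : Fin i ⊕ Fin k → V := Sum.elim l' fun b => x'' (Sum.inr b)
  have hx'x' : ∀ s t, B (x' s) (x' t) = 0 := by
    rintro (a | b) (a' | b')
    · exact hL _ (hl'L a) _ (hl'L a')
    · change B (l' a) (x'' (Sum.inr b') : V) = 0
      rw [← hB.neg_eq, hl'x, neg_zero]
    · exact hl'x a' b
    · exact P.isotropic_X _ (x'' _).2 _ (x'' _).2
  have hx'y' : ∀ s t, B (x' s) (y' t : V) = if s = t then 1 else 0 := by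
    rintro (a | b) t
    · exact hl'y a t
    · exact hx''y _ t
  obtain ⟨p, hpx, hpy⟩ := P.exists_Sp_of_basis hB (x' := fun j => x' (e.symm j))
    (y' := fun j => y' (e.symm j)) (fun _ _ => hx'x' _ _) (fun _ _ => hYY _ _)
    (fun j j' => by rw [hx'y']; simp)
  refine ⟨i, by omega, p, P.mem_parabolic_iff.2 fun y hy => ?_, fun j => ?_⟩
  · have h : (p.1.toLinearMap ∘ₗ P.Y.subtype).range ≤ P.Y := by
      rw [LinearMap.range_eq_map, ← P.basisY.span_eq, Submodule.map_span_le]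
      rintro _ ⟨j, rfl⟩
      change p.1 (P.basisY j) ∈ P.Y
      rw [hpy]
      exact (y' _).2
    exact h ⟨⟨y, hy⟩, rfl⟩
  · obtain ⟨s, rfl⟩ := e.surjective j
    rw [tau_basisY]
    rcases s with a | b
    · have h : (e (Sum.inl a)).val < i := by simp [e]
      rw [if_pos h, hpx, e.symm_apply_apply]
      exact hl'L a
    · have h : ¬ (e (Sum.inr b)).val < i := by simp [e]
      rw [if_neg h, hpy, e.symm_apply_apply]
      exact hyK b

/-- The Bruhat decomposition with respect to the parabolic subgroup. -/
theorem exists_bruhat (hB : B.IsAlt) (g : Sp B) : ∃ i ≤ P.n, ∃ p₁ ∈ P.parabolic,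
    ∃ p₂ ∈ P.parabolic, ∀ v, g.1 v = p₂.1 (P.tau i (p₁.1 v)) := by
  haveI := P.finiteDimensional
  obtain ⟨i, hi, p, hp, hpL⟩ := P.exists_parabolic_of_lagrangian hB
    (L := P.Y.map g.1.toLinearMap)
    (by
      rintro _ ⟨v, hv, rfl⟩ _ ⟨w, hw, rfl⟩
      exact (g.2 v w).trans (P.isotropic_Y v hv w hw))
    ((LinearEquiv.finrank_map_eq g.1 P.Y).trans P.finrank_Y)
  obtain ⟨t, ht⟩ := P.exists_Sp_eq_tau hB i
  have hmap : P.Y.map (p * t).1.toLinearMap = P.Y.map g.1.toLinearMap := by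
    refine Submodule.eq_of_le_of_finrank_eq ?_ ?_
    · rintro _ ⟨y, hy, rfl⟩
      have h : ((p * t).1.toLinearMap ∘ₗ P.Y.subtype).range ≤ P.Y.map g.1.toLinearMap := by
        rw [LinearMap.range_eq_map, ← P.basisY.span_eq, Submodule.map_span_le]
        rintro _ ⟨j, rfl⟩
        change p.1 (t.1 (P.basisY j)) ∈ _
        rw [ht]
        exact hpL j
      exact h ⟨⟨y, hy⟩, rfl⟩
    · exact (LinearEquiv.finrank_map_eq (p * t).1 P.Y).trans
        (LinearEquiv.finrank_map_eq g.1 P.Y).symm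
  -- Both `p τ_i` and `g` send `Y` to the same Lagrangian, so their quotient stabilizes `Y` and
  -- serves as `p₁`.
  refine ⟨i, hi, (p * t)⁻¹ * g, P.mem_parabolic_iff.2 fun y hy => ?_, p, hp, fun v => ?_⟩
  · have h : g.1 y ∈ P.Y.map (p * t).1.toLinearMap := hmap ▸ Submodule.mem_map_of_mem hy
    obtain ⟨z, hz, hzy⟩ := h
    have h2 : ((p * t)⁻¹ * g).1 y = z := by
      rw [Sp.mul_apply, ← hzy]
      exact Sp.inv_apply_apply (p * t) z
    rw [h2]
    exact hz
  · rw [← ht, ← Sp.mul_apply p t, Sp.mul_apply _ g, Sp.apply_inv_apply]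

end Polarization

end Symplectic

/-! ### Comparison of two Bruhat decompositions. -/

section ParabolicAlgebra

variable {F : Type*} [Field F] {V : Type*} [AddCommGroup V] [Module F V]
  {B : LinearMap.BilinForm F V}

namespace Polarization

variable (P : Polarization B)

theorem coe_blockD {p : Sp B} (hp : p ∈ P.parabolic) (y : P.Y) :
    (P.blockD p y : V) = p.1 (y : V) :=
  congrArg Subtype.val (P.projY_coe ⟨p.1 y, P.mem_parabolic_iff.1 hp y y.2⟩)

theorem blockC_eq_zero {p : Sp B} (hp : p ∈ P.parabolic) (y : P.Y) : P.blockC p y = 0 :=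
  P.projX_eq_zero_iff.2 (P.mem_parabolic_iff.1 hp y y.2)

theorem blockD_mul {p p' : Sp B} (hp : p ∈ P.parabolic) (hp' : p' ∈ P.parabolic) :
    P.blockD (p * p') = P.blockD p ∘ₗ P.blockD p' := by
  refine LinearMap.ext fun y => Subtype.ext ?_
  rw [P.coe_blockD (P.mul_mem_parabolic hp hp'), LinearMap.comp_apply, P.coe_blockD hp,
    P.coe_blockD hp']
  rfl

theorem blockD_one : P.blockD (1 : Sp B) = LinearMap.id :=
  LinearMap.ext fun y => P.projY_coe y

theorem det_blockD_ne_zero {p : Sp B} (hp : p ∈ P.parabolic) :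
    LinearMap.det (P.blockD p) ≠ 0 := by
  have h := P.blockD_mul hp (P.inv_mem_parabolic hp)
  rw [mul_inv_cancel, blockD_one] at h
  have h2 := congrArg LinearMap.det h
  rw [LinearMap.det_id, LinearMap.det_comp] at h2
  exact left_ne_zero_of_mul_eq_one h2.symm

theorem repr_projX_tau (i : ℕ) (v : V) (j : Fin P.n) :
    P.basisX.repr (P.projX (P.tau i v)) j =
      if j.val < i then P.basisY.repr (P.projY v) j else P.basisX.repr (P.projX v) j := by
  have h : (P.basisX.coord j) ∘ₗ P.projX ∘ₗ P.tau i =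
      if j.val < i then P.basisY.coord j ∘ₗ P.projY else P.basisX.coord j ∘ₗ P.projX := by
    refine P.basis.ext fun k => ?_
    rcases k with k | k
    · rw [basis_inl, LinearMap.comp_apply, LinearMap.comp_apply, tau_basisX]
      split_ifs <;> simp_all [projX_coe, projX_coe_Y, projY_coe, projY_coe_X, Finsupp.single_apply]
      all_goals
        rintro rfl
        omega
    · rw [basis_inr, LinearMap.comp_apply, LinearMap.comp_apply, tau_basisY]
      split_ifs <;> simp_all [projX_coe, projX_coe_Y, projY_coe, projY_coe_X, Finsupp.single_apply]
      all_goals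
        rintro rfl
        omega
  have h2 := LinearMap.congr_fun h v
  split_ifs at h2 ⊢ <;> exact h2

theorem repr_projY_tau (i : ℕ) (v : V) (j : Fin P.n) :
    P.basisY.repr (P.projY (P.tau i v)) j =
      if j.val < i then -P.basisX.repr (P.projX v) j else P.basisY.repr (P.projY v) j := by
  have h : (P.basisY.coord j) ∘ₗ P.projY ∘ₗ P.tau i =
      if j.val < i then -(P.basisX.coord j ∘ₗ P.projX) else P.basisY.coord j ∘ₗ P.projY := by
    refine P.basis.ext fun k => ?_
    rcases k with k | k
    · rw [basis_inl, LinearMap.comp_apply, LinearMap.comp_apply, tau_basisX]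
      split_ifs <;> simp_all [projX_coe, projX_coe_Y, projY_coe, projY_coe_X, Finsupp.single_apply]
      all_goals
        rintro rfl
        omega
    · rw [basis_inr, LinearMap.comp_apply, LinearMap.comp_apply, tau_basisY]
      split_ifs <;> simp_all [projX_coe, projX_coe_Y, projY_coe, projY_coe_X, Finsupp.single_apply]
      all_goals
        rintro rfl
        omega
  have h2 := LinearMap.congr_fun h v
  split_ifs at h2 ⊢ <;> exact h2

/-- The first `i` coordinates of an element of `Y`. -/
def headCoord {i : ℕ} (hi : i ≤ P.n) : P.Y →ₗ[F] (Fin i → F) :=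
  LinearMap.pi fun k => P.basisY.coord (Fin.castLE hi k)

/-- The vector `∑ u_k y_k`, `k ≤ i`. -/
def headVec {i : ℕ} (hi : i ≤ P.n) : (Fin i → F) →ₗ[F] P.Y where
  toFun u := ∑ k : Fin i, u k • P.basisY (Fin.castLE hi k)
  map_add' u u' := by simp [add_smul, Finset.sum_add_distrib]
  map_smul' c u := by simp [mul_smul, Finset.smul_sum]

variable {i : ℕ} (hi : i ≤ P.n)

theorem headCoord_apply (y : P.Y) (k : Fin i) :
    P.headCoord hi y k = P.basisY.repr y (Fin.castLE hi k) := rfl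

theorem headVec_apply (u : Fin i → F) :
    P.headVec hi u = ∑ k : Fin i, u k • P.basisY (Fin.castLE hi k) := rfl

theorem repr_headVec (u : Fin i → F) (j : Fin P.n) :
    P.basisY.repr (P.headVec hi u) j = if h : j.val < i then u ⟨j, h⟩ else 0 := by
  rw [headVec_apply, map_sum, Finsupp.finsetSum_apply]
  simp only [map_smul, Module.Basis.repr_self, Finsupp.smul_apply, Finsupp.single_apply,
    smul_eq_mul, mul_ite, mul_one, mul_zero]
  split_ifs with h
  · rw [Finset.sum_eq_single ⟨j, h⟩]
    · simp [Fin.castLE]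
    · intro k _ hk
      rw [if_neg]
      rintro rfl
      exact hk rfl
    · simp
  · refine Finset.sum_eq_zero fun k _ => if_neg ?_
    rintro rfl
    exact h k.2

theorem headCoord_headVec (u : Fin i → F) : P.headCoord hi (P.headVec hi u) = u := by
  ext k
  rw [headCoord_apply, repr_headVec, dif_pos (show (Fin.castLE hi k).val < i from k.2)]
  rfl

theorem headCoord_eq_zero_iff {y : P.Y} : P.headCoord hi y = 0 ↔ P.tau i y ∈ P.Y := by
  rw [← P.projX_eq_zero_iff, ← P.basisX.repr.map_eq_zero_iff, Finsupp.ext_iff, funext_iff]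
  simp only [repr_projX_tau, projY_coe, projX_coe_Y]
  constructor
  · intro h j
    split_ifs with hj
    · exact h ⟨j, hj⟩
    · simp
  · intro h k
    have := h (Fin.castLE hi k)
    rwa [if_pos (show (Fin.castLE hi k).val < i from k.2)] at this

theorem tau_eq_self {y : P.Y} (hy : P.headCoord hi y = 0) : P.tau i y = y := by
  have h1 := (P.headCoord_eq_zero_iff hi).1 hy
  have h2 : P.projY (P.tau i y) = y := by
    refine P.basisY.repr.injective (Finsupp.ext fun j => ?_)
    rw [repr_projY_tau, projY_coe, projX_coe_Y]
    split_ifs with hj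
    · have := congrFun hy ⟨j, hj⟩
      rw [headCoord_apply] at this
      simpa using this.symm
    · rfl
  rw [← P.proj_add (P.tau i y), P.projX_eq_zero_iff.2 h1, h2, ZeroMemClass.coe_zero, zero_add]

section Bruhat

variable {g p₁ p₂ : Sp B} (hp₁ : p₁ ∈ P.parabolic) (hp₂ : p₂ ∈ P.parabolic)
  (hg : ∀ v, g.1 v = p₂.1 (P.tau i (p₁.1 v)))

include hi hp₁ hp₂ hg

/-- The factor `p₂` does not affect whether a vector lands in `Y`. Hence the first `i` coordinates
of the image under `p₁` are coordinates on `Y_g`. -/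
theorem blockC_eq_zero_iff_headCoord (y : P.Y) :
    P.blockC g y = 0 ↔ P.headCoord hi (P.blockD p₁ y) = 0 := by
  rw [headCoord_eq_zero_iff, coe_blockD P hp₁]
  refine (P.projX_eq_zero_iff (v := g.1 y)).trans ?_
  rw [hg]
  refine ⟨fun h => ?_, fun h => P.mem_parabolic_iff.1 hp₂ _ h⟩
  rw [← Sp.inv_apply_apply p₂ (P.tau i _)]
  exact P.mem_parabolic_iff.1 (P.inv_mem_parabolic hp₂) _ h

/-- This makes `i` the rank of `c`, so it depends on `g` alone. -/
theorem finrank_ker_blockC : i + Module.finrank F (LinearMap.ker (P.blockC g)) = P.n := by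
  haveI := P.finiteDimensional
  have hker : LinearMap.ker (P.blockC g) = LinearMap.ker (P.headCoord hi ∘ₗ P.blockD p₁) := by
    ext y
    rw [LinearMap.mem_ker, LinearMap.mem_ker, P.blockC_eq_zero_iff_headCoord hi hp₁ hp₂ hg]
    rfl
  have hsurj : Function.Surjective (P.headCoord hi ∘ₗ P.blockD p₁) := fun u => by
    refine ⟨P.blockD p₁⁻¹ (P.headVec hi u), ?_⟩
    rw [← LinearMap.comp_apply, LinearMap.comp_assoc, ← P.blockD_mul hp₁ (P.inv_mem_parabolic hp₁),
      mul_inv_cancel, blockD_one]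
    exact P.headCoord_headVec hi u
  rw [hker]
  have h := LinearMap.finrank_range_add_finrank_ker (P.headCoord hi ∘ₗ P.blockD p₁)
  rwa [LinearMap.range_eq_top.2 hsurj, finrank_top, Module.finrank_fin_fun, P.finrank_Y] at h

end Bruhat

section Intertwine

variable {h₁ h₂ : Sp B} (hh₁ : h₁ ∈ P.parabolic) (hh₂ : h₂ ∈ P.parabolic)
  (hτ : ∀ v, h₂.1 (P.tau i v) = P.tau i (h₁.1 v))

/-- The upper left block of the action of an element of the parabolic subgroup on `Y`. -/
def headMatrix (p : Sp B) : Matrix (Fin i) (Fin i) F := fun k l =>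
  P.basisY.repr (P.blockD p (P.basisY (Fin.castLE hi l))) (Fin.castLE hi k)

theorem toLin'_headMatrix (p : Sp B) (u : Fin i → F) :
    Matrix.toLin' (P.headMatrix hi p) u = P.headCoord hi (P.blockD p (P.headVec hi u)) := by
  ext k
  rw [Matrix.toLin'_apply, headCoord_apply, headVec_apply, map_sum, map_sum,
    Finsupp.finsetSum_apply]
  simp [Matrix.mulVec, dotProduct, headMatrix, mul_comm]

/-- The matrix of an element of the parabolic subgroup on `Y`. -/
def matY (p : Sp B) : Matrix (Fin P.n) (Fin P.n) F :=
  LinearMap.toMatrix P.basisY P.basisY (P.blockD p)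

theorem matY_apply (p : Sp B) (k l : Fin P.n) :
    P.matY p k l = P.basisY.repr (P.blockD p (P.basisY l)) k := LinearMap.toMatrix_apply _ _ _ _ _

theorem det_matY_of_triangular {p : Sp B}
    (h : ∀ k l : Fin P.n, k.val < i → ¬ l.val < i → P.matY p k l = 0) :
    LinearMap.det (P.blockD p) =
      ((P.matY p).toSquareBlockProp fun j => ¬ j.val < i).det * (P.headMatrix hi p).det := by
  rw [← LinearMap.det_toMatrix P.basisY]
  refine (Matrix.twoBlockTriangular_det (P.matY p) (fun j => ¬ j.val < i)
    fun k hk l hl => h k l (not_not.1 hk) hl).trans ?_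
  congr 1
  let e : Fin i ≃ {j : Fin P.n // ¬ ¬ j.val < i} :=
    { toFun := fun k => ⟨Fin.castLE hi k, not_not.2 k.2⟩
      invFun := fun j => ⟨j.1, not_not.1 j.2⟩
      left_inv := fun _ => rfl
      right_inv := fun _ => rfl }
  rw [← Matrix.det_submatrix_equiv_self e]
  congr 1
  ext k l
  exact P.matY_apply p _ _

-- `τ_i` fixes the `y ∈ Y` with vanishing head. So `h₂ y = h₂ τ_i y = τ_i h₁ y`; this lies in `Y`,
-- which forces the head of `h₁ y` to vanish and `τ_i` to fix it as well.
include hh₁ hτ in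
theorem blockD_eq_of_intertwine (hh₂ : h₂ ∈ P.parabolic) {y : P.Y} (hy : P.headCoord hi y = 0) :
    P.headCoord hi (P.blockD h₁ y) = 0 ∧ P.blockD h₂ y = P.blockD h₁ y := by
  have h1 : P.tau i (P.blockD h₁ y) = P.blockD h₂ y := by
    rw [coe_blockD P hh₁, ← hτ, P.tau_eq_self hi hy, coe_blockD P hh₂]
  have h2 : P.headCoord hi (P.blockD h₁ y) = 0 := by
    rw [headCoord_eq_zero_iff, h1]
    exact (P.blockD h₂ y).2
  refine ⟨h2, Subtype.ext ?_⟩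
  rw [← h1, P.tau_eq_self hi h2]

-- On `Y` both maps are block triangular with the same tail block, so the determinants differ only
-- through the head blocks. These are inverse transposes of each other, which accounts for the
-- square.
include hh₁ hh₂ hτ in
theorem det_blockD_of_intertwine : (P.headMatrix hi h₁).det ≠ 0 ∧
    LinearMap.det (P.blockD h₁) =
      (P.headMatrix hi h₁).det ^ 2 * LinearMap.det (P.blockD h₂) := by
  have hcol : ∀ l : Fin P.n, ¬ l.val < i → P.headCoord hi (P.basisY l) = 0 := fun l hl => by
    ext k
    rw [headCoord_apply, Module.Basis.repr_self, Finsupp.single_apply, if_neg, Pi.zero_apply]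
    rintro rfl
    exact hl k.2
  have hz₁ : ∀ k l : Fin P.n, k.val < i → ¬ l.val < i → P.matY h₁ k l = 0 := fun k l hk hl => by
    rw [matY_apply]
    exact congrFun (P.blockD_eq_of_intertwine hi hh₁ hτ hh₂ (hcol l hl)).1 ⟨k, hk⟩
  have heq : ∀ k l : Fin P.n, ¬ l.val < i → P.matY h₂ k l = P.matY h₁ k l := fun k l hl => by
    rw [matY_apply, matY_apply, (P.blockD_eq_of_intertwine hi hh₁ hτ hh₂ (hcol l hl)).2]
  have hd₁ := P.det_matY_of_triangular hi hz₁
  have hd₂ := P.det_matY_of_triangular hi (p := h₂) fun k l hk hl => (heq k l hl).trans (hz₁ k l hk hl)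
  have hblock : ((P.matY h₂).toSquareBlockProp fun j => ¬ j.val < i) =
      (P.matY h₁).toSquareBlockProp fun j => ¬ j.val < i := by
    ext k l
    exact heq _ _ l.2
  -- Evaluate `⟨h₂ x_l, h₂ y_m⟩ = δ_lm` with `h₂ x_l = h₂ τ_i y_l = τ_i h₁ y_l`, whose `X`-component
  -- is the head of `h₁ y_l`.
  have hinv : (P.headMatrix hi h₁).transpose * P.headMatrix hi h₂ = 1 := by
    ext l m
    have h1 : h₂.1 (P.basisX (Fin.castLE hi l)) = P.tau i (P.blockD h₁ (P.basisY (Fin.castLE hi l))) := by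
      rw [coe_blockD P hh₁, ← hτ, tau_basisY, if_pos (show (Fin.castLE hi l).val < i from l.2)]
    have h2 := h₂.2 (P.basisX (Fin.castLE hi l)) (P.basisY (Fin.castLE hi m))
    rw [P.dual, h1, ← coe_blockD P hh₂] at h2
    have h3 : ∀ (x : V) (y : P.Y), B x (y : V) =
        ∑ j, P.basisX.repr (P.projX x) j * P.basisY.repr y j := fun x y => by
      conv_lhs => rw [← P.basisY.sum_repr y]
      rw [Submodule.coe_sum, map_sum]
      refine Finset.sum_congr rfl fun j _ => ?_
      rw [Submodule.coe_smul, map_smul, form_basisY, smul_eq_mul, mul_comm]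
    rw [h3] at h2
    simp only [repr_projX_tau, projY_coe, projX_coe_Y, map_zero, Finsupp.zero_apply, ite_mul,
      zero_mul] at h2
    rw [← Finset.sum_filter] at h2
    rw [Matrix.mul_apply, Matrix.one_apply]
    have h4 : (if Fin.castLE hi l = Fin.castLE hi m then (1 : F) else 0) = if l = m then 1 else 0 := by
      simp
    rw [← h4, ← h2]
    refine Finset.sum_bij (fun k _ => Fin.castLE hi k) ?_ ?_ ?_ ?_
    · intro k _
      simp
    · intro k _ k' _ h
      exact Fin.castLE_injective hi h
    · intro j hj
      exact ⟨⟨j, (Finset.mem_filter.1 hj).2⟩, Finset.mem_univ _, rfl⟩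
    · intro k _
      rfl
  have hdet := congrArg Matrix.det hinv
  rw [Matrix.det_mul, Matrix.det_transpose, Matrix.det_one] at hdet
  refine ⟨left_ne_zero_of_mul_eq_one hdet, ?_⟩
  rw [hd₁, hd₂, hblock]
  linear_combination (-(P.headMatrix hi h₁).det *
    ((P.matY h₁).toSquareBlockProp fun j => ¬ j.val < i).det) * hdet

end Intertwine

end Polarization

end ParabolicAlgebra

/-! ### The topology of `X` and `Y`. -/

section Topology

variable {F : Type*} [Field F] [ValuativeRel F] [TopologicalSpace F] [IsNonarchimedeanLocalField F]
  {V : Type*} [AddCommGroup V] [Module F V] [TopologicalSpace V] [IsModuleTopology F V]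
  {B : LinearMap.BilinForm F V}

/-- The retraction `π` is continuous from `V` to the module topology of `W`, and restricts to the
identity on `W`. So the subspace topology is the module topology, and linear maps out of `X` and `Y`
are continuous. -/
theorem isModuleTopology_of_retraction (W : Submodule F V) (π : V →ₗ[F] W)
    (hπ : ∀ w : W, π w = w) : IsModuleTopology F W := by
  haveI : IsTopologicalAddGroup V := IsModuleTopology.topologicalAddGroup F V
  refine IsModuleTopology.of_continuous_id ?_
  have h1 : @Continuous V W _ (moduleTopology F W) π :=
    letI := moduleTopology F W
    haveI : IsModuleTopology F W := ⟨rfl⟩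
    haveI : ContinuousAdd W := IsModuleTopology.toContinuousAdd F W
    IsModuleTopology.continuous_of_linearMap π
  have h2 : (id : W → W) = π ∘ (Subtype.val : W → V) := funext fun w => (hπ w).symm
  rw [h2]
  exact @Continuous.comp _ _ _ _ _ (moduleTopology F W) _ _ h1 continuous_subtype_val


namespace Polarization

variable (P : Polarization B)

theorem isModuleTopology_X : IsModuleTopology F P.X :=
  isModuleTopology_of_retraction P.X P.projX P.projX_coe

theorem isModuleTopology_Y : IsModuleTopology F P.Y :=
  isModuleTopology_of_retraction P.Y P.projY P.projY_coe

theorem continuous_of_linear_X {W : Type*} [AddCommGroup W] [Module F W] [TopologicalSpace W]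
    [ContinuousAdd W] [ContinuousSMul F W] (f : P.X →ₗ[F] W) : Continuous f :=
  haveI := P.isModuleTopology_X
  IsModuleTopology.continuous_of_linearMap f

theorem continuous_of_linear_Y {W : Type*} [AddCommGroup W] [Module F W] [TopologicalSpace W]
    [ContinuousAdd W] [ContinuousSMul F W] (f : P.Y →ₗ[F] W) : Continuous f :=
  haveI := P.isModuleTopology_Y
  IsModuleTopology.continuous_of_linearMap f

theorem measurable_mk_headVec {i : ℕ} (hi : i ≤ P.n) [MeasurableSpace F] [BorelSpace F]
    (g p : Sp B) : @Measurable (Fin i → F) (P.quotY g) _ (borel _)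
      fun u => Submodule.Quotient.mk (P.blockD p (P.headVec hi u)) := by
  haveI : IsTopologicalAddGroup V := IsModuleTopology.topologicalAddGroup F V
  letI : MeasurableSpace (P.quotY g) := borel _
  haveI : BorelSpace (P.quotY g) := ⟨rfl⟩
  exact (LinearMap.continuous_on_pi ((LinearMap.ker (P.blockC g)).mkQ ∘ₗ P.blockD p ∘ₗ
    P.headVec hi)).measurable

end Polarization

end Topology

/-! ### Existence and uniqueness of the measure on `Y_g`. -/

section WeilMeasure

variable {F : Type*} [Field F] [ValuativeRel F] [TopologicalSpace F] [IsNonarchimedeanLocalField F]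
  [MeasurableSpace F] [BorelSpace F]
  {V : Type*} [AddCommGroup V] [Module F V] [TopologicalSpace V] [IsModuleTopology F V]
  {B : LinearMap.BilinForm F V} (P : Polarization B) {χ : AddChar F Circle}

theorem exists_isWeilMeasure (hB : B.IsAlt) (hχ : Continuous χ) (hχ1 : χ ≠ 1) (g : Sp B) :
    ∃ m, IsWeilMeasure P χ g m := by
  obtain ⟨μ, hμ⟩ := exists_isSelfDual (F := F) hχ hχ1
  obtain ⟨i, hi, p₁, hp₁, p₂, hp₂, h⟩ := P.exists_bruhat hB g
  exact ⟨_, μ, hμ, i, hi, p₁, hp₁, p₂, hp₂, h, rfl⟩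

/-- Two decompositions differ by `h₁ = p₁' p₁⁻¹` and `h₂ = p₂'⁻¹ p₂`, with `h₂ τ_i = τ_i h₁`. The
coordinates on `Y_g` change by the head block `A` of `h₁`, which scales the measure on `F^i` by
`|det A|⁻¹`. The determinant of the decomposition changes by `(det A)²`, and the exponent `-1/2`
compensates exactly. -/
theorem IsWeilMeasure.unique (hχ : Continuous χ) (hχ1 : χ ≠ 1) {g : Sp B}
    {m m' : @Measure (P.quotY g) (borel _)}
    (hm : IsWeilMeasure P χ g m) (hm' : IsWeilMeasure P χ g m') : m = m' := by
  obtain ⟨μ, hμ, i, hi, p₁, hp₁, p₂, hp₂, hg, rfl⟩ := hm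
  obtain ⟨μ', hμ', i', hi', p₁', hp₁', p₂', hp₂', hg', rfl⟩ := hm'
  obtain rfl := hμ.unique hχ hχ1 hμ'
  have hii : i = i' := by
    have h1 := P.finrank_ker_blockC hi hp₁ hp₂ hg
    have h2 := P.finrank_ker_blockC hi' hp₁' hp₂' hg'
    omega
  subst hii
  haveI := hμ.1
  set h₁ : Sp B := p₁' * p₁⁻¹ with hh₁
  set h₂ : Sp B := p₂'⁻¹ * p₂ with hh₂
  have hh₁p : h₁ ∈ P.parabolic := P.mul_mem_parabolic hp₁' (P.inv_mem_parabolic hp₁)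
  have hh₂p : h₂ ∈ P.parabolic := P.mul_mem_parabolic (P.inv_mem_parabolic hp₂') hp₂
  have hτ : ∀ v, h₂.1 (P.tau i v) = P.tau i (h₁.1 v) := fun v => by
    rw [hh₁, hh₂, Sp.mul_apply, Sp.mul_apply]
    have h3 := hg (p₁⁻¹.1 v)
    rw [hg', Sp.apply_inv_apply] at h3
    rw [← h3, Sp.inv_apply_apply]
  obtain ⟨hA0, hdet⟩ := P.det_blockD_of_intertwine hi hh₁p hh₂p hτ
  set A := P.headMatrix hi h₁
  have hp₁'_eq : p₁' = h₁ * p₁ := by rw [hh₁, inv_mul_cancel_right]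
  have hp₂_eq : p₂ = p₂' * h₂ := by rw [hh₂, mul_inv_cancel_left]
  have hdet' : LinearMap.det (P.blockD (p₂' * p₁')) =
      A.det ^ 2 * LinearMap.det (P.blockD (p₂ * p₁)) := by
    rw [P.blockD_mul hp₂' hp₁', P.blockD_mul hp₂ hp₁, LinearMap.det_comp, LinearMap.det_comp,
      hp₁'_eq, hp₂_eq, P.blockD_mul hh₁p hp₁, P.blockD_mul hp₂' hh₂p, LinearMap.det_comp,
      LinearMap.det_comp, hdet]
    ring
  have habs : absF (LinearMap.det (P.blockD (p₂' * p₁'))) ^ (-(1 / 2) : ℝ) =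
      (absF A.det)⁻¹ * absF (LinearMap.det (P.blockD (p₂ * p₁))) ^ (-(1 / 2) : ℝ) := by
    rw [hdet', absF_mul, Real.mul_rpow (absF_nonneg _) (absF_nonneg _), sq, absF_mul, ← sq,
      ← Real.rpow_natCast, ← Real.rpow_mul (absF_nonneg _)]
    norm_num
    left
    exact Real.rpow_neg_one _
  rw [habs, ENNReal.ofReal_mul (inv_nonneg.2 (absF_nonneg _)), mul_comm, mul_smul]
  congr 1
  letI : MeasurableSpace (P.quotY g) := borel _
  have hfun : (fun u : Fin i → F => (Submodule.Quotient.mk (P.blockD p₁⁻¹ (P.headVec hi u)) :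
      P.quotY g)) =
      (fun u => Submodule.Quotient.mk (P.blockD p₁'⁻¹ (P.headVec hi u))) ∘ Matrix.toLin' A := by
    ext u
    rw [Function.comp_apply, Submodule.Quotient.eq, LinearMap.mem_ker,
      P.blockC_eq_zero_iff_headCoord hi hp₁' hp₂' hg', map_sub]
    have h3 : ∀ (p p' : Sp B), p ∈ P.parabolic → p' ∈ P.parabolic → ∀ y,
        P.blockD p (P.blockD p' y) = P.blockD (p * p') y := fun p p' hp hp' y => by
      rw [P.blockD_mul hp hp']; rfl
    rw [h3 _ _ hp₁' (P.inv_mem_parabolic hp₁), h3 _ _ hp₁' (P.inv_mem_parabolic hp₁'),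
      mul_inv_cancel, P.blockD_one, LinearMap.id_apply, map_sub, P.headCoord_headVec,
      P.toLin'_headMatrix, sub_self]
  refine (congrArg (fun f => Measure.map f (Measure.pi fun _ : Fin i => μ)) hfun).trans ?_
  rw [← Measure.map_map (P.measurable_mk_headVec hi g p₁'⁻¹) (continuous_toLin' A).measurable,
    map_matrix_pi μ hA0, Measure.map_smul]
  rfl

end WeilMeasure

/-! ### The phase as a coboundary. -/

section Phase

variable {F : Type*} [Field F] {V : Type*} [AddCommGroup V] [Module F V]
  {B : LinearMap.BilinForm F V}

namespace Polarization

variable (P : Polarization B)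

/-- The quadratic form `x + y ↦ ⟨x, y⟩`. -/
def quadForm (v : V) : F := B (P.projX v : V) (P.projY v : V)

theorem form_eq_sum (v : V) (y : P.Y) :
    B v (y : V) = ∑ j, P.basisX.repr (P.projX v) j * P.basisY.repr y j := by
  conv_lhs => rw [← P.basisY.sum_repr y]
  rw [Submodule.coe_sum, map_sum]
  refine Finset.sum_congr rfl fun j _ => ?_
  rw [Submodule.coe_smul, map_smul, form_basisY, smul_eq_mul, mul_comm]

theorem quadForm_eq_sum (v : V) :
    P.quadForm v = ∑ j, P.basisX.repr (P.projX v) j * P.basisY.repr (P.projY v) j := by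
  rw [quadForm, form_eq_sum, projX_coe]

theorem projX_apply_add (g : Sp B) (x : P.X) (y : P.Y) :
    P.projX (g.1 (x + y : V)) = P.blockA g x + P.blockC g y := by
  rw [map_add, map_add]; rfl

theorem projY_apply_add (g : Sp B) (x : P.X) (y : P.Y) :
    P.projY (g.1 (x + y : V)) = P.blockB g x + P.blockD g y := by
  rw [map_add, map_add]; rfl

/-- The cross terms are reduced by `⟨xa, yd⟩ + ⟨xb, yc⟩ = ⟨x, y⟩`, which is the invariance of the
form. -/
theorem quadForm_apply_sub (hB : B.IsAlt) (g : Sp B) (x : P.X) (y : P.Y) :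
    P.quadForm (g.1 (x + y : V)) - P.quadForm (x + y : V) =
      B (P.blockA g x : V) (P.blockB g x : V) - 2 * B (P.blockB g x : V) (P.blockC g y : V)
        + B (P.blockC g y : V) (P.blockD g y : V) := by
  have h1 := g.2 (x : V) (y : V)
  rw [P.form_eq] at h1
  change B (P.blockA g x : V) (P.blockD g y : V) + B (P.blockB g x : V) (P.blockC g y : V) = _ at h1
  have h2 := hB.neg_eq (P.blockB g x : V) (P.blockC g y : V)
  have h3 : P.quadForm (x + y : V) = B (x : V) (y : V) := by
    rw [quadForm, map_add, map_add, projX_coe, projX_coe_Y, projY_coe, projY_coe_X, add_zero,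
      zero_add]
  rw [h3, quadForm, projX_apply_add, projY_apply_add]
  simp only [Submodule.coe_add, map_add, LinearMap.add_apply]
  linear_combination h1 - h2

/-- As half the variation of one fixed quadratic form along `g`, the phase is additive along
products, so it can be computed separately for `p₁`, `τ_i` and `p₂`. -/
theorem phase_eq (hB : B.IsAlt) (g : Sp B) (x : P.X) (y : P.Y) :
    P.phase g x y = (P.quadForm (g.1 (x + y : V)) - P.quadForm (x + y : V)) / 2 := by
  rw [quadForm_apply_sub P hB, phase]

theorem phase_parabolic {p : Sp B} (hp : p ∈ P.parabolic) (x : P.X) (y : P.Y) :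
    P.phase p x y = P.phase p x 0 :=
  P.phase_congr p x (by rw [P.blockC_eq_zero hp, map_zero])

theorem quadForm_parabolic (hB : B.IsAlt) (h2 : (2 : F) ≠ 0) {p : Sp B} (hp : p ∈ P.parabolic)
    (v : V) : P.quadForm (p.1 v) = P.quadForm v + 2 * P.phase p (P.projX v) 0 := by
  rw [← P.phase_parabolic hp _ (P.projY v), P.phase_eq hB, P.proj_add]
  field_simp
  ring

theorem projX_parabolic {p : Sp B} (hp : p ∈ P.parabolic) (v : V) :
    P.projX (p.1 v) = P.blockA p (P.projX v) := by
  conv_lhs => rw [← P.proj_add v]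
  rw [projX_apply_add, P.blockC_eq_zero hp, add_zero]

/-- The isomorphism from `X` to `Y` given by the bases. -/
def swap : P.X ≃ₗ[F] P.Y := P.basisX.equiv P.basisY (Equiv.refl _)

theorem repr_swap (x : P.X) : P.basisY.repr (P.swap x) = P.basisX.repr x := by
  have h : P.basisY.repr.toLinearMap ∘ₗ P.swap.toLinearMap = P.basisX.repr.toLinearMap := by
    refine P.basisX.ext fun j => ?_
    simp [swap]
  exact LinearMap.congr_fun h x

theorem repr_swap_symm (y : P.Y) : P.basisX.repr (P.swap.symm y) = P.basisY.repr y := by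
  rw [← repr_swap, LinearEquiv.apply_symm_apply]

variable {i : ℕ} (hi : i ≤ P.n)

/-- The first `i` coordinates of an element of `X`. -/
def headCoordX : P.X →ₗ[F] (Fin i → F) := P.headCoord hi ∘ₗ P.swap.toLinearMap

/-- Replace the first `i` coordinates of `x` by `w`. -/
def merge (x : P.X) (w : Fin i → F) : P.X :=
  x + P.swap.symm (P.headVec hi (w - P.headCoordX hi x))

theorem repr_merge (x : P.X) (w : Fin i → F) (j : Fin P.n) :
    P.basisX.repr (P.merge hi x w) j =
      if h : j.val < i then w ⟨j, h⟩ else P.basisX.repr x j := by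
  rw [merge, map_add, repr_swap_symm, Finsupp.add_apply, repr_headVec]
  split_ifs with h
  · have h1 : P.headCoordX hi x ⟨j, h⟩ = P.basisX.repr x j := by
      rw [headCoordX, LinearMap.comp_apply, headCoord_apply, LinearEquiv.coe_coe, repr_swap]
      rfl
    rw [Pi.sub_apply, h1, add_sub_cancel]
  · rw [add_zero]

theorem headCoordX_apply (x : P.X) (k : Fin i) :
    P.headCoordX hi x k = P.basisX.repr x (Fin.castLE hi k) := by
  rw [headCoordX, LinearMap.comp_apply, headCoord_apply, LinearEquiv.coe_coe, repr_swap]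

theorem headCoordX_merge (x : P.X) (w : Fin i → F) : P.headCoordX hi (P.merge hi x w) = w := by
  ext k
  rw [headCoordX_apply, repr_merge, dif_pos (show (Fin.castLE hi k).val < i from k.2)]
  rfl

theorem merge_add (x : P.X) (w w' : Fin i → F) :
    P.merge hi x (w + w') = P.merge hi x w + P.swap.symm (P.headVec hi w') := by
  rw [merge, merge, add_assoc, ← map_add, ← map_add, add_sub_right_comm]

theorem projX_tau (v : V) :
    P.projX (P.tau i v) = P.merge hi (P.projX v) (P.headCoord hi (P.projY v)) := by
  refine P.basisX.repr.injective (Finsupp.ext fun j => ?_)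
  rw [repr_projX_tau, repr_merge]
  split_ifs <;> rfl

/-- For each index below `i` the product of dual coordinates changes sign. The resulting dot product
is the kernel of the partial Fourier transform. -/
theorem quadForm_tau (v : V) : P.quadForm (P.tau i v) = P.quadForm v -
    2 * (P.headCoordX hi (P.projX v) ⬝ᵥ P.headCoord hi (P.projY v)) := by
  have h1 : P.headCoordX hi (P.projX v) ⬝ᵥ P.headCoord hi (P.projY v) =
      ∑ j : Fin P.n, if j.val < i then
        P.basisX.repr (P.projX v) j * P.basisY.repr (P.projY v) j else 0 := by
    rw [← Finset.sum_filter]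
    refine Finset.sum_bij (fun k _ => Fin.castLE hi k) ?_ ?_ ?_ ?_
    · intro k _
      simp
    · intro k _ k' _ h
      exact Fin.castLE_injective hi h
    · intro j hj
      exact ⟨⟨j, (Finset.mem_filter.1 hj).2⟩, Finset.mem_univ _, rfl⟩
    · intro k _
      rw [headCoordX_apply, headCoord_apply]
  rw [h1, quadForm_eq_sum, quadForm_eq_sum, Finset.mul_sum, ← Finset.sum_sub_distrib]
  refine Finset.sum_congr rfl fun j _ => ?_
  rw [repr_projX_tau, repr_projY_tau]
  split_ifs <;> ring

variable {g p₁ p₂ : Sp B} (hp₁ : p₁ ∈ P.parabolic) (hp₂ : p₂ ∈ P.parabolic)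
  (hg : ∀ v, g.1 v = p₂.1 (P.tau i (p₁.1 v)))

theorem parabolic_apply_add_headVec (hp₁ : p₁ ∈ P.parabolic) (x : P.X) (u : Fin i → F) :
    P.projX (p₁.1 (x + P.blockD p₁⁻¹ (P.headVec hi u) : V)) = P.blockA p₁ x ∧
    P.headCoord hi (P.projY (p₁.1 (x + P.blockD p₁⁻¹ (P.headVec hi u) : V))) =
      u + P.headCoord hi (P.blockB p₁ x) := by
  rw [projX_apply_add, projY_apply_add, P.blockC_eq_zero hp₁, add_zero]
  refine ⟨rfl, ?_⟩
  have h : P.blockD p₁ (P.blockD p₁⁻¹ (P.headVec hi u)) = P.headVec hi u := by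
    rw [← LinearMap.comp_apply, ← P.blockD_mul hp₁ (P.inv_mem_parabolic hp₁), mul_inv_cancel,
      blockD_one, LinearMap.id_apply]
  rw [h, map_add, headCoord_headVec, add_comm]

include hp₁ hp₂ hg

theorem arg_bruhat (x : P.X) (u : Fin i → F) :
    P.blockA g x + P.blockC g (P.blockD p₁⁻¹ (P.headVec hi u)) =
      P.blockA p₂ (P.merge hi (P.blockA p₁ x) (u + P.headCoord hi (P.blockB p₁ x))) := by
  obtain ⟨h1, h2⟩ := P.parabolic_apply_add_headVec hi hp₁ x u
  rw [← projX_apply_add, hg, P.projX_parabolic hp₂, P.projX_tau hi, h1, h2]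

theorem phase_bruhat (hB : B.IsAlt) (h2 : (2 : F) ≠ 0) (x : P.X) (u : Fin i → F) :
    P.phase g x (P.blockD p₁⁻¹ (P.headVec hi u)) =
      P.phase p₂ (P.merge hi (P.blockA p₁ x) (u + P.headCoord hi (P.blockB p₁ x))) 0 -
      P.headCoordX hi (P.blockA p₁ x) ⬝ᵥ (u + P.headCoord hi (P.blockB p₁ x)) +
      P.phase p₁ x 0 := by
  obtain ⟨h3, h4⟩ := P.parabolic_apply_add_headVec hi hp₁ x u
  rw [P.phase_eq hB, hg, P.quadForm_parabolic hB h2 hp₂, P.quadForm_tau hi,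
    P.quadForm_parabolic hB h2 hp₁, P.projX_tau hi, h3, h4, map_add P.projX, projX_coe,
    projX_coe_Y, add_zero]
  field_simp
  ring

end Polarization

end Phase

/-! ### The elementary factors preserve locally constant functions of compact support. -/

section Operators

variable {F : Type*} [Field F] [ValuativeRel F] [TopologicalSpace F] [IsNonarchimedeanLocalField F]
  {V : Type*} [AddCommGroup V] [Module F V] [TopologicalSpace V] [IsModuleTopology F V]
  {B : LinearMap.BilinForm F V}

theorem isLocallyConstant_addChar {χ : AddChar F Circle} (hχ : Continuous χ) :
    IsLocallyConstant χ := by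
  obtain ⟨m, hm⟩ := exists_ball_trivial hχ
  rw [IsLocallyConstant.iff_eventually_eq]
  intro x
  have h : ∀ᶠ y in 𝓝 x, y - x ∈ ball F m :=
    ((continuous_sub_right x).tendsto' x 0 (sub_self x)).eventually
      (hasBasis_ball.mem_of_mem (i := m) trivial)
  filter_upwards [h] with y hy
  rw [← sub_add_cancel y x, AddChar.map_add_eq_mul, hm _ hy, one_mul]

theorem isLocallyConstant_addChar_comp {χ : AddChar F Circle} (hχ : Continuous χ) {G : Type*}
    [TopologicalSpace G] {f : G → F} (hf : Continuous f) :
    IsLocallyConstant fun x => (χ (f x) : ℂ) :=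
  ((isLocallyConstant_addChar hχ).comp_continuous hf).comp ((↑) : Circle → ℂ)

namespace Polarization

variable (P : Polarization B)

theorem continuous_quadForm : Continuous P.quadForm := by
  have h : P.quadForm = fun v =>
      ∑ j, (P.basisX.coord j ∘ₗ P.projX) v * (P.basisY.coord j ∘ₗ P.projY) v :=
    funext P.quadForm_eq_sum
  rw [h]
  exact continuous_finsetSum _ fun j _ =>
    (IsModuleTopology.continuous_of_linearMap (P.basisX.coord j ∘ₗ P.projX)).mul
      (IsModuleTopology.continuous_of_linearMap (P.basisY.coord j ∘ₗ P.projY))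

theorem continuous_phase (hB : B.IsAlt) (g : Sp B) :
    Continuous fun p : P.X × P.Y => P.phase g p.1 p.2 := by
  haveI : IsTopologicalAddGroup V := IsModuleTopology.topologicalAddGroup F V
  have hadd : Continuous fun p : P.X × P.Y => (p.1 + p.2 : V) :=
    (continuous_subtype_val.comp continuous_fst).add (continuous_subtype_val.comp continuous_snd)
  have hgc : Continuous g.1 := IsModuleTopology.continuous_of_linearMap g.1.toLinearMap
  simp_rw [P.phase_eq hB, div_eq_mul_inv]
  exact ((P.continuous_quadForm.comp (hgc.comp hadd)).sub
    (P.continuous_quadForm.comp hadd)).mul continuous_const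

theorem continuous_phase_zero (hB : B.IsAlt) (g : Sp B) : Continuous fun x : P.X => P.phase g x 0 :=
  Continuous.comp (g := fun p : P.X × P.Y => P.phase g p.1 p.2) (f := fun x => (x, 0))
    (P.continuous_phase hB g) (continuous_id.prodMk continuous_const)

theorem blockA_blockA_inv {p : Sp B} (hp : p ∈ P.parabolic) (x : P.X) :
    P.blockA p (P.blockA p⁻¹ x) = x := by
  have h1 : P.blockA p⁻¹ x = P.projX (p⁻¹.1 x) := rfl
  rw [h1, ← P.projX_parabolic hp, Sp.apply_inv_apply, projX_coe]

theorem isTopologicalAddGroup_X : IsTopologicalAddGroup P.X :=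
  haveI : IsTopologicalAddGroup V := IsModuleTopology.topologicalAddGroup F V
  inferInstance

/-- The action of an element of the parabolic subgroup on `X`, as a homeomorphism. -/
def homeoX {p : Sp B} (hp : p ∈ P.parabolic) : P.X ≃ₜ P.X where
  toFun := P.blockA p
  invFun := P.blockA p⁻¹
  left_inv x := by
    have h := P.blockA_blockA_inv (P.inv_mem_parabolic hp) x
    rwa [inv_inv] at h
  right_inv x := P.blockA_blockA_inv hp x
  continuous_toFun :=
    haveI := P.isTopologicalAddGroup_X
    P.continuous_of_linear_X _
  continuous_invFun :=
    haveI := P.isTopologicalAddGroup_X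
    P.continuous_of_linear_X _

variable {χ : AddChar F Circle}

theorem mulAct_mem (hB : B.IsAlt) (hχ : Continuous χ) {p : Sp B} (hp : p ∈ P.parabolic)
    {f : P.X → ℂ} (hf : IsLocallyConstant f) (hc : HasCompactSupport f) :
    IsLocallyConstant (fun x => (χ (P.phase p x 0) : ℂ) * f (P.blockA p x)) ∧
      HasCompactSupport (fun x => (χ (P.phase p x 0) : ℂ) * f (P.blockA p x)) :=
  ⟨(isLocallyConstant_addChar_comp hχ (P.continuous_phase_zero hB p)).mul
    (hf.comp_continuous (P.homeoX hp).continuous), (hc.comp_homeomorph (P.homeoX hp)).mul_left⟩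

variable {i : ℕ} (hi : i ≤ P.n)

theorem continuous_headCoordX : Continuous (P.headCoordX hi) := P.continuous_of_linear_X _

theorem continuous_swap_symm_headVec : Continuous fun w => P.swap.symm (P.headVec hi w) :=
  haveI := P.isTopologicalAddGroup_X
  LinearMap.continuous_on_pi (P.swap.symm.toLinearMap ∘ₗ P.headVec hi)

theorem continuous_merge : Continuous fun q : P.X × (Fin i → F) => P.merge hi q.1 q.2 :=
  haveI := P.isTopologicalAddGroup_X
  continuous_fst.add ((P.continuous_swap_symm_headVec hi).comp
    (continuous_snd.sub ((P.continuous_headCoordX hi).comp continuous_fst)))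

theorem hasCompactSupport_merge {A : Type*} [Zero A] {f : P.X → A} (hc : HasCompactSupport f)
    (x : P.X) : HasCompactSupport fun w => f (P.merge hi x w) := by
  refine HasCompactSupport.intro (hc.isCompact.image (P.continuous_headCoordX hi)) fun w hw => ?_
  refine image_eq_zero_of_notMem_tsupport fun h => hw ⟨_, h, P.headCoordX_merge hi x w⟩

variable [MeasurableSpace F] [BorelSpace F] (μ : Measure F) [μ.IsAddHaarMeasure]

variable (χ) in
/-- The Fourier transform with respect to the first `i` coordinates. -/
def partialFourier (f : P.X → ℂ) (x : P.X) : ℂ :=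
  ∫ w, (χ (-(P.headCoordX hi x ⬝ᵥ w)) : ℂ) * f (P.merge hi x w) ∂Measure.pi fun _ : Fin i => μ

-- The integrand is locally constant in `(x, w)` and vanishes for `w` outside a compact set `C`
-- independent of `x`. Compactness of `C` makes it constant in `x` near `x₀`, uniformly in `w`.
omit [BorelSpace F] [μ.IsAddHaarMeasure] in
theorem isLocallyConstant_partialFourier (hχ : Continuous χ) {f : P.X → ℂ}
    (hf : IsLocallyConstant f) (hc : HasCompactSupport f) :
    IsLocallyConstant (P.partialFourier χ hi μ f) := by
  rw [IsLocallyConstant.iff_eventually_eq]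
  intro x₀
  set Φ : P.X × (Fin i → F) → ℂ := fun q =>
    (χ (-(P.headCoordX hi q.1 ⬝ᵥ q.2)) : ℂ) * f (P.merge hi q.1 q.2) with hΦ
  have hΦc : IsLocallyConstant Φ := by
    refine (isLocallyConstant_addChar_comp hχ ?_).mul (hf.comp_continuous (P.continuous_merge hi))
    exact (((P.continuous_headCoordX hi).comp continuous_fst).dotProduct continuous_snd).neg
  set C := P.headCoordX hi '' tsupport f
  have hC : IsCompact C := hc.isCompact.image (P.continuous_headCoordX hi)
  have hzero : ∀ x, ∀ w ∉ C, Φ (x, w) = 0 := fun x w hw => by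
    have h : f (P.merge hi x w) = 0 :=
      image_eq_zero_of_notMem_tsupport fun h => hw ⟨_, h, P.headCoordX_merge hi x w⟩
    simp only [hΦ, h, mul_zero]
  have hev : ∀ᶠ x in 𝓝 x₀, ∀ w ∈ C, Φ (x, w) = Φ (x₀, w) := by
    refine hC.eventually_forall_of_forall_eventually fun w _ => ?_
    have h1 : ∀ᶠ q : P.X × (Fin i → F) in 𝓝 (x₀, w), Φ q = Φ (x₀, w) := hΦc.eventually_eq _
    have h2 : ∀ᶠ q : P.X × (Fin i → F) in 𝓝 (x₀, w), Φ (x₀, q.2) = Φ (x₀, w) :=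
      ((continuous_const.prodMk continuous_snd).tendsto' (x₀, w) (x₀, w) rfl).eventually
        (hΦc.eventually_eq _)
    filter_upwards [h1, h2] with q hq hq'
    exact hq.trans hq'.symm
  filter_upwards [hev] with x hx
  refine integral_congr_ae (.of_forall fun w => ?_)
  change Φ (x, w) = Φ (x₀, w)
  by_cases hw : w ∈ C
  · exact hx w hw
  · rw [hzero x w hw, hzero x₀ w hw]

/-- Invariance of `f` under small shifts of the first `i` coordinates forces the transform to vanish
unless those of `x` lie in the dual ball. The other coordinates are untouched and stay within those
of the support of `f`. -/
theorem hasCompactSupport_partialFourier (hχ : Continuous χ) (hχ1 : χ ≠ 1) {f : P.X → ℂ}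
    (hf : IsLocallyConstant f) (hc : HasCompactSupport f) :
    HasCompactSupport (P.partialFourier χ hi μ f) := by
  haveI := P.isTopologicalAddGroup_X
  obtain ⟨d, hd⟩ := exists_isConductor hχ hχ1
  have hinv : ∀ᶠ w' in 𝓝 (0 : Fin i → F), ∀ x, f (x + P.swap.symm (P.headVec hi w')) = f x :=
    ((P.continuous_swap_symm_headVec hi).tendsto' 0 0 (by simp)).eventually
      (eventually_forall_add_eq hf hc)
  obtain ⟨m, hm⟩ := exists_box_subset hinv
  have hcoord : Continuous fun x : P.X => (fun j => P.basisX.repr x j : Fin P.n → F) :=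
    continuous_pi fun j => P.continuous_of_linear_X (P.basisX.coord j)
  have hex : ∃ N : ℤ, ∀ j, ∀ x ∈ tsupport f, P.basisX.repr x j ∈ ball F N := by
    have h1 : ∀ j : Fin P.n, ∃ N : ℤ, ∀ x ∈ tsupport f, P.basisX.repr x j ∈ ball F N := fun j => by
      obtain ⟨N, hN⟩ := isCompact_subset_ball
        (hc.isCompact.image (P.continuous_of_linear_X (P.basisX.coord j)))
      exact ⟨N, fun x hx => hN ⟨x, hx, rfl⟩⟩
    choose N hN using h1
    obtain ⟨M, hM⟩ := Finset.exists_le (Finset.univ.image N)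
    exact ⟨M, fun j x hx => ball_mono (hM _ (Finset.mem_image_of_mem _ (Finset.mem_univ j)))
      (hN j x hx)⟩
  obtain ⟨N, hN⟩ := hex
  have hback : Continuous fun t : Fin P.n → F => ∑ j, t j • P.basisX j :=
    continuous_finsetSum _ fun j _ => (continuous_apply j).smul continuous_const
  refine HasCompactSupport.intro
    ((isCompact_univ_pi fun _ : Fin P.n => isCompact_ball (F := F) (max (d - m) N)).image hback)
    fun x hx => ?_
  by_contra hne
  refine hx ⟨fun j => P.basisX.repr x j, fun j _ => ?_, P.basisX.sum_repr x⟩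
  by_cases hj : j.val < i
  · refine ball_mono (le_max_left _ _) ((hd.forall_mul_iff m _).1 fun t ht => ?_)
    by_contra hne'
    refine hne ?_
    let ψ : AddChar (Fin i → F) Circle := χ.compAddMonoidHom
      ⟨⟨fun w => -(P.headCoordX hi x ⬝ᵥ w), by simp⟩, fun w w' => by
        simp only [dotProduct_add, neg_add]⟩
    -- The sign of `-t` cancels the sign in the Fourier kernel.
    refine integral_addChar_mul_eq_zero _ ψ (h := Pi.single ⟨j, hj⟩ (-t)) (fun w => ?_) ?_
    · rw [P.merge_add hi]
      refine hm (mem_box.2 fun k => ?_) _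
      rw [Pi.single_apply]
      split_ifs
      · exact neg_mem ht
      · exact zero_mem _
    · change χ (-(P.headCoordX hi x ⬝ᵥ Pi.single ⟨j, hj⟩ (-t))) ≠ 1
      rw [dotProduct_single, headCoordX_apply, mul_neg, neg_neg, mul_comm]
      exact hne'
  · refine ball_mono (le_max_right _ _) ?_
    by_contra hxj
    refine hne ?_
    refine (integral_congr_ae (.of_forall fun w => ?_)).trans (integral_zero _ _)
    have h : f (P.merge hi x w) = 0 := by
      refine image_eq_zero_of_notMem_tsupport fun h => hxj ?_
      have h2 := hN j _ h
      rwa [repr_merge, dif_neg hj] at h2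
    simp only [h, mul_zero]

end Polarization

end Operators

/-! ### The integral formula in coordinates on `Y_g`. -/

section Formula

variable {F : Type*} [Field F] [ValuativeRel F] [TopologicalSpace F] [IsNonarchimedeanLocalField F]

theorem two_ne_zero_of_residueChar (hp : residueChar F ≠ 2) : (2 : F) ≠ 0 := by
  intro h
  haveI : CharP 𝓀[F] (residueChar F) := ringChar.charP _
  have h0 : (2 : 𝒪[F]) = 0 := Subtype.ext h
  have h1 : ((2 : ℕ) : 𝒪[F]) = 0 := by rw [Nat.cast_ofNat, h0]
  have h2 : ((2 : ℕ) : 𝓀[F]) = 0 := by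
    rw [← map_natCast (IsLocalRing.residue 𝒪[F]), h1, map_zero]
  rw [CharP.cast_eq_zero_iff 𝓀[F] (residueChar F)] at h2
  exact hp ((Nat.prime_dvd_prime_iff_eq (exists_residueCard_eq_pow F).1 Nat.prime_two).1 h2)

/-- Puts the normalizing factor `|det|^(-1/2)` into `ℚ(√q)`, so that it is fixed by `𝔊`. -/
theorem absF_rpow_neg_half {x : F} (hx : x ≠ 0) :
    ∃ k : ℤ, absF x ^ (-(1 / 2) : ℝ) = Real.sqrt (residueCard F) ^ k := by
  obtain ⟨m, hm⟩ := exists_eq_exp hx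
  refine ⟨-m, ?_⟩
  have hq : (0 : ℝ) ≤ residueCard F := Nat.cast_nonneg _
  rw [absF_eq hm, Real.sqrt_eq_rpow, ← Real.rpow_intCast, ← Real.rpow_intCast, ← Real.rpow_mul hq,
    ← Real.rpow_mul hq]
  congr 1
  push_cast
  ring

theorem integral_pi_smul [MeasurableSpace F] [BorelSpace F] (μ : Measure F) [μ.IsAddHaarMeasure]
    {ι : Type*} [Fintype ι] {s : F} (hs : absF s = 1) (f : (ι → F) → ℂ) :
    ∫ u, f (s • u) ∂Measure.pi (fun _ => μ) = ∫ u, f u ∂Measure.pi (fun _ => μ) := by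
  classical
  have hs0 : s ≠ 0 := by
    rintro rfl
    simp [absF] at hs
  have h1 : Measure.map (fun u : ι → F => s • u) (Measure.pi fun _ => μ) =
      Measure.pi fun _ => μ := by
    have hdet : (Matrix.diagonal fun _ : ι => s).det ≠ 0 := by
      rw [Matrix.det_diagonal]
      exact Finset.prod_ne_zero_iff.2 fun _ _ => hs0
    have h2 := map_matrix_pi μ hdet
    rw [Matrix.det_diagonal, absF_prod, Finset.prod_congr rfl fun _ _ => hs, Finset.prod_const_one,
      inv_one, ENNReal.ofReal_one, one_smul] at h2
    convert h2 using 2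
    ext u k
    simp [Matrix.mulVec_diagonal]
  conv_rhs => rw [← h1]
  exact ((Homeomorph.smulOfNeZero s hs0).measurableEmbedding.integral_map f).symm

variable {V : Type*} [AddCommGroup V] [Module F V] [TopologicalSpace V] [IsModuleTopology F V]
  {B : LinearMap.BilinForm F V}

namespace Polarization

variable (P : Polarization B) {i : ℕ} (hi : i ≤ P.n)

/-- The argument `xa + yc` of the integrand, for `y = (∑ u_k y_k) p⁻¹`. -/
def orbitPoint (g p : Sp B) (x : P.X) (u : Fin i → F) : P.X :=
  P.blockA g x + P.blockC g (P.blockD p⁻¹ (P.headVec hi u))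

/-- The phase of the integrand, for `y = (∑ u_k y_k) p⁻¹`. -/
def orbitPhase (g p : Sp B) (x : P.X) (u : Fin i → F) : F :=
  P.phase g x (P.blockD p⁻¹ (P.headVec hi u))

omit [ValuativeRel F] [TopologicalSpace F] [IsNonarchimedeanLocalField F]
  [TopologicalSpace V] [IsModuleTopology F V] in
theorem orbitPoint_smul (g p : Sp B) (s : F) (x : P.X) (u : Fin i → F) :
    P.orbitPoint hi g p (s • x) (s • u) = s • P.orbitPoint hi g p x u := by
  simp only [orbitPoint, map_smul, smul_add]

-- This homogeneity is why squares appear in `𝔊`: a factor `s ^ 2` in the character is absorbed by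
-- scaling `x` and `u` by `s`.
omit [ValuativeRel F] [TopologicalSpace F] [IsNonarchimedeanLocalField F]
  [TopologicalSpace V] [IsModuleTopology F V] in
theorem orbitPhase_smul (g p : Sp B) (s : F) (x : P.X) (u : Fin i → F) :
    P.orbitPhase hi g p (s • x) (s • u) = s ^ 2 * P.orbitPhase hi g p x u := by
  simp only [orbitPhase, phase, map_smul, Submodule.coe_smul, LinearMap.smul_apply, smul_eq_mul]
  ring

theorem continuous_orbitPhase (hB : B.IsAlt) (g p : Sp B) (x : P.X) :
    Continuous (P.orbitPhase hi g p x) := by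
  haveI : IsTopologicalAddGroup V := IsModuleTopology.topologicalAddGroup F V
  have h : Continuous fun u : Fin i → F => P.blockD p⁻¹ (P.headVec hi u) :=
    LinearMap.continuous_on_pi (P.blockD p⁻¹ ∘ₗ P.headVec hi)
  exact Continuous.comp (g := fun q : P.X × P.Y => P.phase g q.1 q.2) (f := fun u => (x, _))
    (P.continuous_phase hB g) (continuous_const.prodMk h)

theorem continuous_orbitPoint (g p : Sp B) (x : P.X) : Continuous (P.orbitPoint hi g p x) := by
  haveI := P.isTopologicalAddGroup_X
  exact continuous_const.add
    (LinearMap.continuous_on_pi (P.blockC g ∘ₗ P.blockD p⁻¹ ∘ₗ P.headVec hi))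

variable {χ : AddChar F Circle}

theorem continuous_weilIntegrand (hB : B.IsAlt) (hχ : Continuous χ) (g : Sp B) {f : P.X → ℂ}
    (hf : IsLocallyConstant f) (x : P.X) : Continuous (weilIntegrand P χ g f x) := by
  haveI := P.isTopologicalAddGroup_X
  refine Continuous.quotient_lift ?_ _
  have h1 : Continuous fun y : P.Y => P.phase g x y :=
    Continuous.comp (g := fun q : P.X × P.Y => P.phase g q.1 q.2) (f := fun y => (x, y))
      (P.continuous_phase hB g) (continuous_const.prodMk continuous_id)
  exact (isLocallyConstant_addChar_comp hχ h1).continuous.mul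
    (hf.continuous.comp (continuous_const.add (P.continuous_of_linear_Y (P.blockC g))))

variable [MeasurableSpace F] [BorelSpace F] (μ : Measure F)

theorem integral_weilIntegrand (hB : B.IsAlt) (hχ : Continuous χ) (g p : Sp B) {f : P.X → ℂ}
    (hf : IsLocallyConstant f) (x : P.X) {c : ℝ} (hc : 0 ≤ c)
    {m : @Measure (P.quotY g) (borel _)}
    (hm : m = ENNReal.ofReal c • @Measure.map (Fin i → F) (P.quotY g) _ (borel _)
      (fun u => Submodule.Quotient.mk (P.blockD p⁻¹ (P.headVec hi u)))
      (Measure.pi fun _ => μ)) :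
    ∫ y, weilIntegrand P χ g f x y ∂m =
      c * ∫ u, (χ (P.orbitPhase hi g p x u) : ℂ) * f (P.orbitPoint hi g p x u)
        ∂Measure.pi fun _ => μ := by
  letI : MeasurableSpace (P.quotY g) := borel _
  haveI : BorelSpace (P.quotY g) := ⟨rfl⟩
  subst hm
  rw [integral_smul_measure, ENNReal.toReal_ofReal hc, Complex.real_smul]
  congr 1
  exact integral_map (P.measurable_mk_headVec hi g p⁻¹).aemeasurable
    (P.continuous_weilIntegrand hB hχ g hf x).aestronglyMeasurable

variable {g p₁ p₂ : Sp B} (hp₁ : p₁ ∈ P.parabolic) (hp₂ : p₂ ∈ P.parabolic)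
  (hg : ∀ v, g.1 v = p₂.1 (P.tau i (p₁.1 v)))

omit [MeasurableSpace F] [BorelSpace F] in
include hp₁ hp₂ hg in
theorem hasCompactSupport_orbitPoint {A : Type*} [Zero A] {f : P.X → A}
    (hc : HasCompactSupport f) (x : P.X) :
    HasCompactSupport fun u => f (P.orbitPoint hi g p₁ x u) := by
  have h1 := P.hasCompactSupport_merge hi (hc.comp_homeomorph (P.homeoX hp₂)) (P.blockA p₁ x)
  have h2 := h1.comp_homeomorph (Homeomorph.addRight (P.headCoord hi (P.blockB p₁ x)))
  convert h2 using 2 with u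
  rw [orbitPoint, P.arg_bruhat hi hp₁ hp₂ hg]
  rfl

-- The translation of `u` by the head of `x b₁`, where `b₁` is the block of `p₁`, turns the integral
-- into a partial Fourier transform between the multiplications and substitutions attached to `p₂`
-- and `p₁`.
include hp₁ hp₂ hg in
theorem integral_orbit_eq [μ.IsAddHaarMeasure] (hB : B.IsAlt) (h2 : (2 : F) ≠ 0) (f : P.X → ℂ)
    (x : P.X) :
    ∫ u, (χ (P.orbitPhase hi g p₁ x u) : ℂ) * f (P.orbitPoint hi g p₁ x u)
        ∂Measure.pi (fun _ => μ) =
      (χ (P.phase p₁ x 0) : ℂ) * P.partialFourier χ hi μ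
        (fun x => (χ (P.phase p₂ x 0) : ℂ) * f (P.blockA p₂ x)) (P.blockA p₁ x) := by
  rw [partialFourier]
  conv_rhs => rw [← integral_add_right_eq_self _ (P.headCoord hi (P.blockB p₁ x)),
    ← integral_const_mul]
  refine integral_congr_ae (.of_forall fun u => ?_)
  simp only [orbitPhase, orbitPoint]
  rw [P.phase_bruhat hi hp₁ hp₂ hg hB h2, P.arg_bruhat hi hp₁ hp₂ hg, AddChar.map_add_eq_mul,
    sub_eq_add_neg, AddChar.map_add_eq_mul, Circle.coe_mul, Circle.coe_mul]
  ring

include hp₁ hp₂ hg in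
theorem integral_orbit_mem [μ.IsAddHaarMeasure] (hB : B.IsAlt) (h2 : (2 : F) ≠ 0)
    (hχ : Continuous χ) (hχ1 : χ ≠ 1) {f : P.X → ℂ} (hf : IsLocallyConstant f)
    (hc : HasCompactSupport f) (c : ℂ) :
    IsLocallyConstant (fun x => c * ∫ u, (χ (P.orbitPhase hi g p₁ x u) : ℂ) *
        f (P.orbitPoint hi g p₁ x u) ∂Measure.pi (fun _ => μ)) ∧
      HasCompactSupport (fun x => c * ∫ u, (χ (P.orbitPhase hi g p₁ x u) : ℂ) *
        f (P.orbitPoint hi g p₁ x u) ∂Measure.pi (fun _ => μ)) := by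
  obtain ⟨h3, h4⟩ := P.mulAct_mem hB hχ hp₂ hf hc
  obtain ⟨h5, h6⟩ := P.mulAct_mem hB hχ hp₁ (P.isLocallyConstant_partialFourier hi μ hχ h3 h4)
    (P.hasCompactSupport_partialFourier hi μ hχ hχ1 h3 h4)
  simp_rw [P.integral_orbit_eq hi μ hp₁ hp₂ hg hB h2]
  exact ⟨(IsLocallyConstant.const c).mul h5, h6.mul_left⟩

include hp₁ hp₂ hg in
/-- The integral defining the Weil operator takes values in `E`, and commutes with the
automorphisms of `E` that fix `√q`. -/
theorem exists_integral_orbit_eq (hp : residueChar F ≠ 2) (hB : B.IsAlt) (hχ : Continuous χ)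
    (hχ1 : χ ≠ 1) (hμ : IsSelfDual χ μ) (φ : schwartzBruhat P.X (fieldE χ)) (x : P.X) :
    ∃ I : fieldE χ,
      (I : ℂ) = ∫ u, (χ (P.orbitPhase hi g p₁ x u) : ℂ) *
        ((φ.1 (P.orbitPoint hi g p₁ x u) : fieldE χ) : ℂ) ∂Measure.pi (fun _ => μ) ∧
      ∀ σ ∈ (sqrtField χ).fixingSubgroup, ((σ I : fieldE χ) : ℂ) =
        ∫ u, ((σ ⟨χ (P.orbitPhase hi g p₁ x u), apply_mem_fieldE _⟩ : fieldE χ) : ℂ) *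
          ((σ (φ.1 (P.orbitPoint hi g p₁ x u)) : fieldE χ) : ℂ) ∂Measure.pi (fun _ => μ) := by
  classical
  haveI := hμ.1
  -- The map from the circle to `E` sends points outside `E` to 0, a default that values of `χ`
  -- never reach.
  have hlc : IsLocallyConstant fun u =>
      (⟨χ (P.orbitPhase hi g p₁ x u), apply_mem_fieldE _⟩ : fieldE χ) *
        φ.1 (P.orbitPoint hi g p₁ x u) :=
    (((isLocallyConstant_addChar hχ).comp_continuous (P.continuous_orbitPhase hi hB g p₁ x)).comp
      fun z : Circle => (if h : (z : ℂ) ∈ fieldE χ then ⟨z, h⟩ else 0 : fieldE χ)).mul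
      (φ.2.1.comp_continuous (P.continuous_orbitPoint hi g p₁ x)) |> fun h => by
        convert h using 3 with u
        simp [apply_mem_fieldE]
  obtain ⟨I, hI, hσ⟩ := exists_integral_mem (Measure.pi fun _ : Fin i => μ) (sqrtField χ)
    (fun S hS hSo => exists_sqrtField_eq_measureReal_pi hp hχ hχ1 hμ hS hSo) hlc
    (P.hasCompactSupport_orbitPoint hi hp₁ hp₂ hg φ.2.2 x).mul_left
  refine ⟨I, hI, fun σ h => (hσ σ h).trans ?_⟩
  simp only [map_mul]
  rfl

end Polarization

end Formula

/-! ### The Weil operators and the Fundamental Identity. -/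

section WeilOperator

variable {F : Type*} [Field F] [ValuativeRel F] [TopologicalSpace F] [IsNonarchimedeanLocalField F]
  [MeasurableSpace F] [BorelSpace F]
  {V : Type*} [AddCommGroup V] [Module F V] [TopologicalSpace V] [IsModuleTopology F V]
  {B : LinearMap.BilinForm F V} (P : Polarization B) {χ : AddChar F Circle}

theorem isLocallyConstant_coe {L : IntermediateField ℚ ℂ} {f : P.X → L}
    (hf : IsLocallyConstant f) : IsLocallyConstant fun x => (f x : ℂ) := hf.comp ((↑) : L → ℂ)

theorem hasCompactSupport_coe {L : IntermediateField ℚ ℂ} {f : P.X → L}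
    (hc : HasCompactSupport f) : HasCompactSupport fun x => (f x : ℂ) :=
  hc.comp_left (g := ((↑) : L → ℂ)) rfl

theorem isWeilOperator_exists (hp : residueChar F ≠ 2) (hB : B.IsAlt) (hχ : Continuous χ)
    (hχ1 : χ ≠ 1) (g : Sp B) : ∃ T, IsWeilOperator P χ (fieldE χ) g T := by
  obtain ⟨m, hm⟩ := exists_isWeilMeasure P hB hχ hχ1 g
  have hm' := hm
  obtain ⟨μ, hμ, i, hi, p₁, hp₁, p₂, hp₂, hg, hmeq⟩ := hm'
  haveI := hμ.1
  set D := LinearMap.det (P.blockD (p₂ * p₁))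
  obtain ⟨k, hk⟩ := absF_rpow_neg_half (P.det_blockD_ne_zero (P.mul_mem_parabolic hp₂ hp₁))
  obtain ⟨r, -, hr⟩ := exists_sqrtField_eq_zpow hp hχ hχ1 k
  choose I hI using P.exists_integral_orbit_eq hi μ hp₁ hp₂ hg hp hB hχ hχ1 hμ
  have hval : ∀ φ x, ((r * I φ x : fieldE χ) : ℂ) =
      ∫ y, weilIntegrand P χ g (fun x' => ((φ.1 x' : fieldE χ) : ℂ)) x y ∂m := fun φ x => by
    rw [P.integral_weilIntegrand hi μ hB hχ g p₁ (isLocallyConstant_coe P φ.2.1) x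
      (Real.rpow_nonneg (absF_nonneg D) _) hmeq, hk, ← hr, ← (hI φ x).1]
    rfl
  have hmem : ∀ φ, (fun x => r * I φ x) ∈ schwartzBruhat P.X (fieldE χ) := fun φ => by
    have h1 := P.integral_orbit_mem hi μ hp₁ hp₂ hg hB (two_ne_zero_of_residueChar hp) hχ hχ1
      (isLocallyConstant_coe P φ.2.1) (hasCompactSupport_coe P φ.2.2) r
    have h2 : (fun x => (r : ℂ) * ∫ u, (χ (P.orbitPhase hi g p₁ x u) : ℂ) *
        ((φ.1 (P.orbitPoint hi g p₁ x u) : fieldE χ) : ℂ) ∂Measure.pi (fun _ => μ)) =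
        ((↑) : fieldE χ → ℂ) ∘ fun x => r * I φ x := funext fun x => by
      rw [← (hI φ x).1]
      rfl
    rw [h2] at h1
    -- Local constancy and compact support are known for the complex-valued function and descend
    -- along the injection of `E` into `ℂ`.
    refine ⟨h1.1.desc _ _ Subtype.val_injective, ?_⟩
    refine h1.2.mono' (subset_trans (fun x hx => ?_) subset_closure)
    exact fun h => hx (Subtype.ext h)
  have hint : ∀ (φ : schwartzBruhat P.X (fieldE χ)) x, Integrable (fun u =>
      (χ (P.orbitPhase hi g p₁ x u) : ℂ) * ((φ.1 (P.orbitPoint hi g p₁ x u) : fieldE χ) : ℂ))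
      (Measure.pi fun _ => μ) := fun φ x =>
    integrable_of_isLocallyConstant
      ((isLocallyConstant_addChar_comp hχ (P.continuous_orbitPhase hi hB g p₁ x)).mul
        ((isLocallyConstant_coe P φ.2.1).comp_continuous (P.continuous_orbitPoint hi g p₁ x)))
      (P.hasCompactSupport_orbitPoint hi hp₁ hp₂ hg (hasCompactSupport_coe P φ.2.2) x).mul_left
  refine ⟨{ toFun := fun φ => ⟨fun x => r * I φ x, hmem φ⟩, map_add' := fun φ ψ => ?_,
            map_smul' := fun c φ => ?_ }, m, hm, hval⟩
  · refine Subtype.ext (funext fun x => ?_)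
    have h : I (φ + ψ) x = I φ x + I ψ x := by
      refine Subtype.ext ?_
      change (I (φ + ψ) x : ℂ) = (I φ x : ℂ) + (I ψ x : ℂ)
      rw [(hI (φ + ψ) x).1, (hI φ x).1, (hI ψ x).1, ← integral_add (hint φ x) (hint ψ x)]
      refine integral_congr_ae (.of_forall fun u => ?_)
      exact mul_add _ _ _
    change r * I (φ + ψ) x = r * I φ x + r * I ψ x
    rw [h, mul_add]
  · refine Subtype.ext (funext fun x => ?_)
    have h : I (c • φ) x = c * I φ x := by
      refine Subtype.ext ?_
      change (I (c • φ) x : ℂ) = (c : ℂ) * (I φ x : ℂ)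
      rw [(hI (c • φ) x).1, (hI φ x).1, ← integral_const_mul]
      refine integral_congr_ae (.of_forall fun u => ?_)
      exact mul_left_comm _ _ _
    change r * I (c • φ) x = c * (r * I φ x)
    rw [h, mul_left_comm]

theorem IsWeilOperator.unique (hχ : Continuous χ) (hχ1 : χ ≠ 1) {g : Sp B}
    {T T' : Module.End (fieldE χ) (schwartzBruhat P.X (fieldE χ))}
    (hT : IsWeilOperator P χ (fieldE χ) g T) (hT' : IsWeilOperator P χ (fieldE χ) g T') :
    T = T' := by
  obtain ⟨m, hm, h⟩ := hT
  obtain ⟨m', hm', h'⟩ := hT'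
  obtain rfl := hm.unique P hχ hχ1 hm'
  exact LinearMap.ext fun φ => Subtype.ext (funext fun x =>
    Subtype.ext ((h φ x).trans (h' φ x).symm))

theorem isWeilOperator_weilOperator (hp : residueChar F ≠ 2) (hB : B.IsAlt) (hχ : Continuous χ)
    (hχ1 : χ ≠ 1) (g : Sp B) : IsWeilOperator P χ (fieldE χ) g (weilOperator P χ g) :=
  Classical.epsilon_spec (isWeilOperator_exists P hp hB hχ hχ1 g)

/-- An automorphism that fixes `√q` fixes both the scalar `c` and the measures of compact open sets,
so it acts on the integrand alone. -/
theorem weilOperator_apply (hp : residueChar F ≠ 2) (hB : B.IsAlt) (hχ : Continuous χ)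
    (hχ1 : χ ≠ 1) (g : Sp B) :
    ∃ μ : Measure F, μ.IsAddHaarMeasure ∧ ∃ (i : ℕ) (hi : i ≤ P.n) (p : Sp B), ∃ c : fieldE χ,
      ∀ φ x,
        (((weilOperator P χ g φ).1 x : fieldE χ) : ℂ) = c *
          ∫ u, (χ (P.orbitPhase hi g p x u) : ℂ) *
            ((φ.1 (P.orbitPoint hi g p x u) : fieldE χ) : ℂ) ∂Measure.pi (fun _ => μ) ∧
        ∀ σ ∈ (sqrtField χ).fixingSubgroup,
          ((σ ((weilOperator P χ g φ).1 x) : fieldE χ) : ℂ) = c *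
            ∫ u, ((σ ⟨χ (P.orbitPhase hi g p x u), apply_mem_fieldE _⟩ : fieldE χ) : ℂ) *
              ((σ (φ.1 (P.orbitPoint hi g p x u)) : fieldE χ) : ℂ) ∂Measure.pi (fun _ => μ) := by
  obtain ⟨m, ⟨μ, hμ, i, hi, p₁, hp₁, p₂, hp₂, hg, hmeq⟩, hT⟩ :=
    isWeilOperator_weilOperator P hp hB hχ hχ1 g
  set D := LinearMap.det (P.blockD (p₂ * p₁))
  obtain ⟨k, hk⟩ := absF_rpow_neg_half (P.det_blockD_ne_zero (P.mul_mem_parabolic hp₂ hp₁))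
  obtain ⟨r, hrK, hr⟩ := exists_sqrtField_eq_zpow hp hχ hχ1 k
  refine ⟨μ, hμ.1, i, hi, p₁, r, fun φ x => ?_⟩
  obtain ⟨I, hI, hσ⟩ := P.exists_integral_orbit_eq hi μ hp₁ hp₂ hg hp hB hχ hχ1 hμ φ x
  have hval : (weilOperator P χ g φ).1 x = r * I := by
    refine Subtype.ext ?_
    rw [hT, P.integral_weilIntegrand hi μ hB hχ g p₁ (isLocallyConstant_coe P φ.2.1) x
      (Real.rpow_nonneg (absF_nonneg D) _) hmeq, hk, ← hr, ← hI]
    rfl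
  refine ⟨by rw [hval, ← hI]; rfl, fun σ h => ?_⟩
  have h1 : σ r = r := h ⟨r, hrK⟩
  rw [hval, map_mul, h1, ← hσ σ h]
  rfl

theorem gs_apply_X (t : Fˣ) (x : P.X) : (P.gs t).1 (x : V) = ((t⁻¹ : Fˣ) : F) • (x : V) := by
  refine (P.gsEquiv_apply t x).trans ?_
  rw [P.projX_coe, P.projY_coe_X, ZeroMemClass.coe_zero, smul_zero, add_zero]

theorem gs_apply_Y (t : Fˣ) (y : P.Y) : (P.gs t).1 (y : V) = (t : F) • (y : V) := by
  refine (P.gsEquiv_apply t y).trans ?_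
  rw [P.projY_coe, P.projX_coe_Y, ZeroMemClass.coe_zero, smul_zero, zero_add]

theorem gs_mem_parabolic (t : Fˣ) : P.gs t ∈ P.parabolic := by
  refine P.mem_parabolic_iff.2 fun y hy => ?_
  rw [gs_apply_Y P t ⟨y, hy⟩]
  exact P.Y.smul_mem _ hy

theorem blockA_gs (t : Fˣ) (x : P.X) : P.blockA (P.gs t) x = ((t⁻¹ : Fˣ) : F) • x := by
  change P.projX ((P.gs t).1 (x : V)) = _
  rw [gs_apply_X, map_smul, P.projX_coe]

theorem phase_gs (t : Fˣ) (x : P.X) : P.phase (P.gs t) x 0 = 0 := by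
  have h : P.blockB (P.gs t) x = 0 := by
    change P.projY ((P.gs t).1 (x : V)) = _
    rw [gs_apply_X, map_smul, P.projY_coe_X, smul_zero]
  simp [Polarization.phase, h]

theorem det_blockD_gs (t : Fˣ) : LinearMap.det (P.blockD (P.gs t)) = (t : F) ^ P.n := by
  have h : P.blockD (P.gs t) = (t : F) • LinearMap.id := by
    refine LinearMap.ext fun y => ?_
    change P.projY ((P.gs t).1 (y : V)) = _
    rw [gs_apply_Y, map_smul, P.projY_coe]
    rfl
  rw [h, LinearMap.det_smul, LinearMap.det_id, mul_one, P.finrank_Y]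

theorem tau_zero (v : V) : P.tau 0 v = v := by
  have h : P.tau 0 = LinearMap.id := by
    refine P.basis.ext fun j => ?_
    rcases j with j | j
    · rw [P.basis_inl, P.tau_basisX]; simp
    · rw [P.basis_inr, P.tau_basisY]; simp
  rw [h]
  rfl

theorem weilOperator_gs_apply (hp : residueChar F ≠ 2) (hB : B.IsAlt) (hχ : Continuous χ)
    (hχ1 : χ ≠ 1) (t : Fˣ) (φ : schwartzBruhat P.X (fieldE χ)) (x : P.X) :
    (((weilOperator P χ (P.gs t) φ).1 x : fieldE χ) : ℂ) =
      ((absF ((t : F) ^ P.n) ^ (-(1 / 2) : ℝ) : ℝ) : ℂ) *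
        ((φ.1 (((t⁻¹ : Fˣ) : F) • x) : fieldE χ) : ℂ) := by
  obtain ⟨m, hm, hT⟩ := isWeilOperator_weilOperator P hp hB hχ hχ1 (P.gs t)
  have hm' := hm
  obtain ⟨μ, hμ, -⟩ := hm'
  haveI := hμ.1
  -- Since `g_t` stabilizes `Y`, the decomposition with `i = 0`, `p₁ = 1`, `p₂ = g_t` is available,
  -- and by uniqueness it computes the same measure. The integral over `F^0` is then an evaluation.
  have hm₀ : IsWeilMeasure P χ (P.gs t) _ :=
    ⟨μ, hμ, 0, Nat.zero_le _, 1, P.one_mem_parabolic, P.gs t, gs_mem_parabolic P t,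
      fun v => by rw [tau_zero]; rfl, rfl⟩
  rw [hT, P.integral_weilIntegrand (Nat.zero_le _) μ hB hχ (P.gs t) 1
    (isLocallyConstant_coe P φ.2.1) x (Real.rpow_nonneg (absF_nonneg _) _)
    (hm.unique P hχ hχ1 hm₀), mul_one, det_blockD_gs]
  congr 1
  have h0 : ∀ u : Fin 0 → F, P.headVec (Nat.zero_le _) u = 0 := fun u => by
    rw [Subsingleton.elim u 0, map_zero]
  have hcongr : ∀ u : Fin 0 → F,
      (χ (P.orbitPhase (Nat.zero_le _) (P.gs t) 1 x u) : ℂ) *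
        ((φ.1 (P.orbitPoint (Nat.zero_le _) (P.gs t) 1 x u) : fieldE χ) : ℂ) =
      ((φ.1 (((t⁻¹ : Fˣ) : F) • x) : fieldE χ) : ℂ) := fun u => by
    rw [Polarization.orbitPhase, Polarization.orbitPoint, h0, map_zero, map_zero, add_zero,
      phase_gs, blockA_gs, AddChar.map_zero_eq_one, Circle.coe_one, one_mul]
  simp_rw [hcongr]
  rw [Measure.pi_of_empty _ 0, integral_dirac]

theorem weilOperator_gs_unit_apply (hp : residueChar F ≠ 2) (hB : B.IsAlt) (hχ : Continuous χ)
    (hχ1 : χ ≠ 1) {t : Fˣ} (ht : absF (t : F) = 1) (φ : schwartzBruhat P.X (fieldE χ)) (x : P.X) :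
    (weilOperator P χ (P.gs t) φ).1 x = φ.1 (((t⁻¹ : Fˣ) : F) • x) := by
  refine Subtype.ext ?_
  have h : absF ((t : F) ^ P.n) = 1 := by
    have := map_pow (⟨⟨absF, absF_one⟩, absF_mul⟩ : F →* ℝ) (t : F) P.n
    exact this.trans ((congrArg (· ^ P.n) ht).trans (one_pow _))
  rw [weilOperator_gs_apply P hp hB hχ hχ1, h, Real.one_rpow, Complex.ofReal_one, one_mul]

theorem absF_unitF (s : 𝒪[F]ˣ) : absF (unitF s : F) = 1 := by
  rw [absF_eq (m := 0) ((intVal_unitF s).trans exp_zero.symm), zpow_zero]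

/-- The inverse of the operator attached to `g_s`, for a unit `s`, is attached to `g_{s⁻¹}`. -/
theorem weilOperator_gs_mul_inv (hp : residueChar F ≠ 2) (hB : B.IsAlt) (hχ : Continuous χ)
    (hχ1 : χ ≠ 1) {t : Fˣ} (ht : absF (t : F) = 1) :
    weilOperator P χ (P.gs t) * weilOperator P χ (P.gs t⁻¹) = 1 := by
  have ht' : absF ((t⁻¹ : Fˣ) : F) = 1 := by rw [Units.val_inv_eq_inv_val, absF_inv, ht, inv_one]
  refine LinearMap.ext fun φ => Subtype.ext (funext fun x => ?_)
  rw [Module.End.mul_apply, weilOperator_gs_unit_apply P hp hB hχ hχ1 ht,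
    weilOperator_gs_unit_apply P hp hB hχ hχ1 ht', smul_smul, inv_inv, Units.mul_inv, one_smul]
  rfl

theorem fundamental_identity (hp : residueChar F ≠ 2) (hB : B.IsAlt) (hχ : Continuous χ)
    (hχ1 : χ ≠ 1) {σ : Gal(fieldE χ/ℚ)} (hσ : σ ∈ (sqrtField χ).fixingSubgroup) {s : Fˣ}
    (hs : absF (s : F) = 1) (hσs : RestrictsToSigma χ σ (s ^ 2)) (g : Sp B) :
    galoisConj σ (weilOperator P χ g) =
      weilOperator P χ (P.gs s⁻¹) * weilOperator P χ g * weilOperator P χ (P.gs s) := by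
  obtain ⟨μ, hμ, i, hi, p, c, h⟩ := weilOperator_apply P hp hB hχ hχ1 g
  have hs' : absF ((s⁻¹ : Fˣ) : F) = 1 := by rw [Units.val_inv_eq_inv_val, absF_inv, hs, inv_one]
  refine LinearMap.ext fun φ => Subtype.ext (funext fun x => Subtype.ext ?_)
  rw [Module.End.mul_apply, Module.End.mul_apply, weilOperator_gs_unit_apply P hp hB hχ hχ1 hs',
    inv_inv, (h _ _).1]
  refine ((h (galoisAct σ⁻¹ φ) x).2 σ hσ).trans ?_
  -- Replacing `u` by `su` costs nothing for a unit `s`; the integrands then agree pointwise by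
  -- homogeneity.
  conv_rhs => rw [← integral_pi_smul μ hs]
  congr 1
  refine integral_congr_ae (.of_forall fun u => ?_)
  simp only
  rw [hσs.apply_eq hχ, Units.val_pow_eq_pow_val, P.orbitPhase_smul, P.orbitPoint_smul,
    weilOperator_gs_unit_apply P hp hB hχ hχ1 hs, smul_smul, Units.inv_mul, one_smul]
  congr 2
  exact AlgEquiv.apply_symm_apply σ _

/-- The operator is a substitution times `|t ^ n|^(-1/2)`, a power of `√q`. No value of `χ` occurs,
so fixing `√q` suffices. -/
theorem galoisConj_weilOperator_gs (hp : residueChar F ≠ 2) (hB : B.IsAlt) (hχ : Continuous χ)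
    (hχ1 : χ ≠ 1) {σ : Gal(fieldE χ/ℚ)} (hσ : σ ∈ (sqrtField χ).fixingSubgroup) (t : Fˣ) :
    galoisConj σ (weilOperator P χ (P.gs t)) = weilOperator P χ (P.gs t) := by
  obtain ⟨k, hk⟩ := absF_rpow_neg_half (pow_ne_zero P.n t.ne_zero)
  obtain ⟨r, hrK, hr⟩ := exists_sqrtField_eq_zpow hp hχ hχ1 k
  have hval : ∀ φ x, (weilOperator P χ (P.gs t) φ).1 x = r * φ.1 (((t⁻¹ : Fˣ) : F) • x) :=
    fun φ x => Subtype.ext (by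
      rw [weilOperator_gs_apply P hp hB hχ hχ1, hk, ← hr]
      rfl)
  refine LinearMap.ext fun φ => Subtype.ext (funext fun x => ?_)
  change σ ((weilOperator P χ (P.gs t) (galoisAct σ⁻¹ φ)).1 x) = _
  have h1 : σ r = r := hσ ⟨r, hrK⟩
  rw [hval, hval, map_mul, h1]
  congr 1
  exact AlgEquiv.apply_symm_apply σ _

end WeilOperator

end WeilRep

end

theorem proposition14 {F : Type*} [Field F] [ValuativeRel F] [TopologicalSpace F]
    [IsNonarchimedeanLocalField F] [MeasurableSpace F] [BorelSpace F]
    (hp : WeilRep.residueChar F ≠ 2)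
    {V : Type*} [AddCommGroup V] [Module F V] [FiniteDimensional F V]
    [TopologicalSpace V] [IsModuleTopology F V]
    (B : LinearMap.BilinForm F V) (hB : B.IsAlt) (hnd : B.Nondegenerate)
    (P : WeilRep.Polarization B)
    (χ : AddChar F Circle) (hχ : Continuous χ) (hχ1 : χ ≠ 1) :
    -- the Weil operators on `S(X, E)` exist and are well defined
    (∀ g : WeilRep.Sp B, ∃! T : Module.End (WeilRep.fieldE χ)
        (WeilRep.schwartzBruhat P.X (WeilRep.fieldE χ)),
      WeilRep.IsWeilOperator P χ (WeilRep.fieldE χ) g T) ∧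
    -- the fundamental identity
    (∀ σ ∈ WeilRep.frakG χ, ∀ s : 𝒪[F]ˣ,
      WeilRep.RestrictsToSigma χ σ (WeilRep.unitF s ^ 2) →
        ∃ u : (Module.End (WeilRep.fieldE χ) (WeilRep.schwartzBruhat P.X (WeilRep.fieldE χ)))ˣ,
          (u : Module.End (WeilRep.fieldE χ) (WeilRep.schwartzBruhat P.X (WeilRep.fieldE χ))) =
            WeilRep.weilOperator P χ (P.gs (WeilRep.unitF s)) ∧
          ∀ g : WeilRep.Sp B, WeilRep.galoisConj σ (WeilRep.weilOperator P χ g) =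
            (↑u⁻¹ : Module.End (WeilRep.fieldE χ)
              (WeilRep.schwartzBruhat P.X (WeilRep.fieldE χ))) *
              WeilRep.weilOperator P χ g * ↑u) ∧
    -- the operators of the elements `g_t` are fixed by `𝔊`
    (∀ t : Fˣ, ∀ σ ∈ WeilRep.frakG χ,
      WeilRep.galoisConj σ (WeilRep.weilOperator P χ (P.gs t)) =
        WeilRep.weilOperator P χ (P.gs t)) := by
  refine ⟨fun g => ?_, fun σ hσ s hσs => ?_, fun t σ hσ =>
    WeilRep.galoisConj_weilOperator_gs P hp hB hχ hχ1 hσ.1 t⟩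
  · obtain ⟨T, hT⟩ := WeilRep.isWeilOperator_exists P hp hB hχ hχ1 g
    exact ⟨T, hT, fun T' h => WeilRep.IsWeilOperator.unique P hχ hχ1 h hT⟩
  · have hs := WeilRep.absF_unitF s
    have hs' : WeilRep.absF (((WeilRep.unitF s)⁻¹ : Fˣ) : F) = 1 := by
      rw [Units.val_inv_eq_inv_val, WeilRep.absF_inv, hs, inv_one]
    refine ⟨⟨WeilRep.weilOperator P χ (P.gs (WeilRep.unitF s)),
      WeilRep.weilOperator P χ (P.gs (WeilRep.unitF s)⁻¹),
      WeilRep.weilOperator_gs_mul_inv P hp hB hχ hχ1 hs, ?_⟩, rfl, fun g =>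
      WeilRep.fundamental_identity P hp hB hχ hχ1 hσ.1 hs hσs g⟩
    have h := WeilRep.weilOperator_gs_mul_inv P hp hB hχ hχ1 hs'
    rwa [inv_inv] at h
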